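/- Let $n\ge 1$. A cube is a cube in $\mathbb R^n$ with sides parallel to the axes, and $b_Q=\frac1{|Q|}\int_Q b$. A Calderón–Zygmund operator is a linear operator $T:C_c^\infty(\mathbb R^n)\to L^1_{loc}(\mathbb R^n)$ which extends to a bounded operator on $L^2(\mathbb R^n)$ (also denoted $T$) and for which there is a kernel $K(x,y)$, locally integrable off the diagonal of $\mathbb R^n\times\mathbb R^n$, such that $|K(x,y)|\le \frac{C}{|x-y|^{n}}$ for $x\neq y$, such that for some $\varepsilon>0$ $$|K(x,y)-K(z,y)|+|K(y,x)-K(y,z)|\le C\,\frac{|x-z|^{\varepsilon}}{|x-y|^{n+\varepsilon}}\qquad\text{whenever } 2|x-z|<|x-y|,$$ and such that $Tf(x)=\int_{\mathbb R^n}K(x,y)f(y)\,dy$ for all $f\in C_c^\infty(\mathbb R^n)$ and a.e. $x\notin\operatorname{supp} f$. A locally integrable function $b$ is in $BMO$ if $\|b\|_{BMO}=\sup_Q\frac1{|Q|}\int_Q|b-b_Q|\,dx<\infty$. A weight is a nonnegative locally integrable function; $w(E)=\int_E w\,dx$. A weight $w$ is in $A_1$ if $Mw\le c\,w$ a.e.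 for some finite $c$, where $Mw(x)=\sup_{Q\ni x}\frac1{|Q|}\int_Q w\,dy$, and $[w]_{A_1}$ is the smallest such $c\ge 0$. Put $\Phi(t)=t(1+\log^+t)$ and $[b,T]f=b\,T(f)-T(bf)$. **Theorem.** Let $T$ be a Calderón–Zygmund operator and $b\in BMO(\mathbb R^n)$. Then there is a constant $c=c(n,T,\|b\|_{BMO})$ such that for every $w\in A_1$, every bounded function $f$ with compact support and every $\lambda>0$ (for such $f$ both $f$ and $bf$ lie in $L^2(\mathbb R^n)$, so that $[b,T]f$ is defined), $$w\big(\{x\in\mathbb R^n: |[b,T]f(x)|>\lambda\}\big)\le c\,\Phi([w]_{A_1})^2\int_{\mathbb R^n}\Phi\!\left(\frac{|f(x)|}{\lambda}\right)w(x)\,dx .$$ -/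

import Mathlib

open MeasureTheory
open scoped ENNReal

noncomputable section

namespace CZ

/-- `ℝⁿ` with the Euclidean norm and Lebesgue measure. -/
abbrev Rn (n : ℕ) : Type := EuclideanSpace ℝ (Fin n)

/-- The function `Φ(t) = t (1 + log⁺ t)`. -/
def Phi (t : ℝ) : ℝ := t * (1 + Real.posLog t)

/-- The closed cube with sides parallel to the axes, lower corner `a` and side length `l`. -/
def cube {n : ℕ} (a : Rn n) (l : ℝ) : Set (Rn n) :=
  {y | ∀ i, a i ≤ y i ∧ y i ≤ a i + l}

/-- The (uncentred) Hardy–Littlewood maximal function: the supremum of the averages of `|f|`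
over all nondegenerate cubes containing `x`. -/
def maximalFunction {n : ℕ} (f : Rn n → ℝ) (x : Rn n) : ℝ≥0∞ :=
  ⨆ (a : Rn n) (l : ℝ) (_ : 0 < l) (_ : x ∈ cube a l),
    (volume (cube a l))⁻¹ * ∫⁻ y in cube a l, ‖f y‖ₑ

/-- A weight: a nonnegative locally integrable function. -/
structure IsWeight {n : ℕ} (w : Rn n → ℝ) : Prop where
  locallyIntegrable : LocallyIntegrable w volume
  nonneg : ∀ᵐ x ∂volume, 0 ≤ w x

/-- `M w ≤ c w` almost everywhere. -/
def A1Bound {n : ℕ} (w : Rn n → ℝ) (c : ℝ) : Prop :=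
  ∀ᵐ x ∂volume, maximalFunction w x ≤ ENNReal.ofReal c * ENNReal.ofReal (w x)

/-- `w ∈ A₁`: `w` is a weight and `M w ≤ c w` a.e. for some finite `c`. -/
structure MemA1 {n : ℕ} (w : Rn n → ℝ) : Prop where
  isWeight : IsWeight w
  exists_bound : ∃ c : ℝ, 0 ≤ c ∧ A1Bound w c

/-- The constant `[w]_{A₁}`: the smallest `c ≥ 0` with `M w ≤ c w` a.e. -/
def A1Const {n : ℕ} (w : Rn n → ℝ) : ℝ :=
  sInf {c : ℝ | 0 ≤ c ∧ A1Bound w c}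

/-- The `BMO` seminorm: the supremum over all cubes `Q` of the average over `Q` of
`|b - b_Q|`, where `b_Q` is the average of `b` over `Q`. -/
def bmoNorm {n : ℕ} {𝕜 : Type*} [RCLike 𝕜] (b : Rn n → 𝕜) : ℝ≥0∞ :=
  ⨆ (a : Rn n) (l : ℝ) (_ : 0 < l),
    (volume (cube a l))⁻¹ * ∫⁻ y in cube a l, ‖b y - ⨍ z in cube a l, b z‖ₑ

/-- `b ∈ BMO`. -/
structure MemBMO {n : ℕ} {𝕜 : Type*} [RCLike 𝕜] (b : Rn n → 𝕜) : Prop where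
  locallyIntegrable : LocallyIntegrable b volume
  bmoNorm_lt_top : bmoNorm b < ∞

/-- `K` is a standard Calderón–Zygmund kernel; only its values off the diagonal matter. -/
structure IsStandardKernel {n : ℕ} {𝕜 : Type*} [RCLike 𝕜] (K : Rn n → Rn n → 𝕜) : Prop where
  locallyIntegrable :
    LocallyIntegrableOn (fun p : Rn n × Rn n => K p.1 p.2) {p | p.1 ≠ p.2} volume
  size : ∃ c : ℝ, ∀ x y, x ≠ y → ‖K x y‖ ≤ c / ‖x - y‖ ^ n
  regularity : ∃ c ε : ℝ, 0 < ε ∧ ∀ x y z, 2 * ‖x - z‖ < ‖x - y‖ →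
    ‖K x y - K z y‖ + ‖K y x - K y z‖ ≤ c * (‖x - z‖ ^ ε / ‖x - y‖ ^ ((n : ℝ) + ε))

/-- A Calderón–Zygmund operator, given by its (unique, as `C_c^∞` is dense) bounded linear
extension `T` to `L²(ℝⁿ)`: there is a standard kernel `K` such that, for every `f ∈ C_c^∞`,
`T f (x) = ∫ K(x,y) f(y) dy` for (almost every) `x ∉ supp f`. -/
def IsCalderonZygmund {n : ℕ} {𝕜 : Type*} [RCLike 𝕜]
    (T : Lp 𝕜 2 (volume : Measure (Rn n)) →L[𝕜] Lp 𝕜 2 (volume : Measure (Rn n))) : Prop :=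
  ∃ K : Rn n → Rn n → 𝕜, IsStandardKernel K ∧
    ∀ (f : Rn n → 𝕜) (hf : MemLp f 2 volume), ContDiff ℝ (⊤ : ℕ∞) f → HasCompactSupport f →
      ∀ᵐ x ∂volume, x ∉ tsupport f → T (hf.toLp f) x = ∫ y, K x y * f y

/-- The commutator `[b,T] f = b T(f) - T(b f)`, for `f` and `b f` in the domain `L²` of `T`. -/
def commutator {n : ℕ} {𝕜 : Type*} [RCLike 𝕜] (b : Rn n → 𝕜)
    (T : Lp 𝕜 2 (volume : Measure (Rn n)) →L[𝕜] Lp 𝕜 2 (volume : Measure (Rn n)))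
    (f : Rn n → 𝕜) (hf : MemLp f 2 volume) (hbf : MemLp (fun x => b x * f x) 2 volume)
    (x : Rn n) : 𝕜 :=
  b x * T (hf.toLp f) x - T (hbf.toLp (fun x => b x * f x)) x

end CZ

end

noncomputable section

namespace CZ

variable {n : ℕ}

/-! ### Dyadic cubes -/

/-- Indices of dyadic cubes: the level `j` (side length `2 ^ (-j)`) and the position. -/
abbrev DIdx (n : ℕ) : Type := ℤ × (Fin n → ℤ)

/-- The position of the dyadic cube of level `j` that contains `x`. -/
def idx (j : ℤ) (x : Rn n) : Fin n → ℤ := fun i => ⌊(2 : ℝ) ^ j * x i⌋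

/-- The half-open dyadic cube with index `p`. -/
def dq (p : DIdx n) : Set (Rn n) := {x | idx p.1 x = p.2}

/-- The union of the dyadic cubes at distance at most `κ` positions from `p`. -/
def dil (κ : ℕ) (p : DIdx n) : Set (Rn n) :=
  {x | ∀ i, p.2 i - κ ≤ idx p.1 x i ∧ idx p.1 x i ≤ p.2 i + κ}

/-- The side length of a dyadic cube. -/
def side (p : DIdx n) : ℝ := (2 : ℝ) ^ (-p.1)

/-- The index of the dyadic cube of level `j` that contains `x`. -/
def cb (j : ℤ) (x : Rn n) : DIdx n := (j, idx j x)

lemma side_pos (p : DIdx n) : 0 < side p := by unfold side; positivity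

lemma mem_dq_cb (j : ℤ) (x : Rn n) : x ∈ dq (cb j x) := rfl

lemma mem_dq_iff {p : DIdx n} {x : Rn n} : x ∈ dq p ↔ cb p.1 x = p := by
  constructor
  · intro h; exact Prod.ext rfl h
  · intro h; rw [← h]; exact mem_dq_cb _ _

lemma dq_eq_dil (p : DIdx n) : dq p = dil 0 p := by
  ext x
  simp only [dq, dil, Set.mem_ofPred_eq, Nat.cast_zero, sub_zero, add_zero]
  constructor
  · intro h i; rw [h]; exact ⟨le_rfl, le_rfl⟩
  · intro h; funext i; exact le_antisymm (h i).2 (h i).1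

lemma idx_ediv (j : ℤ) (d : ℕ) (x : Rn n) (i : Fin n) :
    idx (j - d) x i = idx j x i / 2 ^ d := by
  unfold idx
  have h := Int.mul_cast_floor_div_cancel_of_pos (n := (2 : ℤ) ^ d) (by positivity)
    ((2 : ℝ) ^ (j - d) * x i)
  rw [← h]
  congr 2
  push_cast
  rw [mul_right_comm, zpow_sub₀ (by norm_num), zpow_natCast]
  field_simp

lemma idx_congr_of_le {i j : ℤ} (hij : i ≤ j) {x y : Rn n} (h : idx j x = idx j y) :
    idx i x = idx i y := by
  obtain ⟨d, hd⟩ := Int.le.dest hij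
  obtain rfl : i = j - d := by omega
  funext k
  rw [idx_ediv, idx_ediv, h]

lemma dq_subset_cb {p : DIdx n} {x : Rn n} (hx : x ∈ dq p) {i : ℤ} (hi : i ≤ p.1) :
    dq p ⊆ dq (cb i x) := by
  intro y hy
  exact idx_congr_of_le hi ((show idx p.1 y = p.2 from hy).trans
    (show idx p.1 x = p.2 from hx).symm)

lemma ediv_add_le {a b D : ℤ} {κ : ℕ} (hD : 0 < D) (h : a ≤ b + κ) : a / D ≤ b / D + κ := by
  have h1 : a ≤ b + κ * D := by nlinarith [show (0 : ℤ) ≤ κ from by positivity]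
  calc a / D ≤ (b + κ * D) / D := Int.ediv_le_ediv hD h1
    _ = b / D + κ := Int.add_mul_ediv_right _ _ hD.ne'

lemma dil_subset_cb {κ : ℕ} {p : DIdx n} {x : Rn n} (hx : x ∈ dq p) {i : ℤ} (hi : i ≤ p.1) :
    dil κ p ⊆ dil κ (cb i x) := by
  intro y hy k
  obtain ⟨d, hd⟩ := Int.le.dest hi
  obtain rfl : i = p.1 - d := by omega
  have hx' : idx p.1 x k = p.2 k := congrFun hx k
  have h := hy k
  simp only [cb, idx_ediv, hx']
  have hD : (0 : ℤ) < 2 ^ d := by positivity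
  have h1 := ediv_add_le hD h.2
  have h2 := ediv_add_le hD (show p.2 k ≤ idx p.1 y k + κ by linarith [h.1])
  constructor <;> linarith

lemma dq_subset_dil (κ : ℕ) (p : DIdx n) : dq p ⊆ dil κ p := by
  intro x hx i
  rw [show idx p.1 x = p.2 from hx]
  constructor <;> linarith [show (0 : ℤ) ≤ κ from by positivity]

lemma mem_dil_iff {κ : ℕ} {p : DIdx n} {x : Rn n} :
    x ∈ dil κ p ↔ ∀ i, side p * (p.2 i - κ) ≤ x i ∧ x i < side p * (p.2 i + κ + 1) := by
  have h2 : (2 : ℝ) ^ p.1 * side p = 1 := by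
    unfold side; rw [← zpow_add₀ (by norm_num)]; simp
  have hp : (0 : ℝ) < 2 ^ p.1 := by positivity
  refine forall_congr' fun i => ?_
  unfold idx
  refine and_congr ?_ ?_
  · rw [Int.le_floor]
    push_cast
    constructor
    · intro h
      have := mul_le_mul_of_nonneg_left h (side_pos p).le
      calc _ ≤ _ := this
        _ = (2 ^ p.1 * side p) * x i := by ring
        _ = x i := by rw [h2, one_mul]
    · intro h
      have := mul_le_mul_of_nonneg_left h hp.le
      rwa [← mul_assoc, h2, one_mul] at this
  · rw [← Int.lt_add_one_iff, Int.floor_lt]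
    push_cast
    constructor
    · intro h
      have := mul_lt_mul_of_pos_left h (side_pos p)
      calc x i = (2 ^ p.1 * side p) * x i := by rw [h2, one_mul]
        _ = side p * (2 ^ p.1 * x i) := by ring
        _ < _ := this
    · intro h
      have := mul_lt_mul_of_pos_left h hp
      rwa [← mul_assoc, h2, one_mul] at this

/-- The lower corner of `dil κ p`. -/
def corner (κ : ℕ) (p : DIdx n) : Rn n := WithLp.toLp 2 fun i => side p * (p.2 i - κ)

lemma dil_eq_preimage (κ : ℕ) (p : DIdx n) : dil κ p = WithLp.ofLp ⁻¹'
    (Set.univ.pi fun i => Set.Ico (side p * (p.2 i - κ)) (side p * (p.2 i + κ + 1))) := by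
  ext x
  simp only [mem_dil_iff, Set.mem_preimage, Set.mem_pi, Set.mem_univ, true_implies, Set.mem_Ico]

lemma cube_eq_preimage (a : Rn n) (l : ℝ) : cube a l = WithLp.ofLp ⁻¹'
    (Set.univ.pi fun i => Set.Icc (a i) (a i + l)) := by
  ext x
  simp only [cube, Set.mem_preimage, Set.mem_pi, Set.mem_univ, true_implies, Set.mem_Icc]
  rfl

lemma measurableSet_dil (κ : ℕ) (p : DIdx n) : MeasurableSet (dil κ p) := by
  rw [dil_eq_preimage]
  exact (PiLp.volume_preserving_ofLp (Fin n)).measurable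
    (MeasurableSet.univ_pi fun i => measurableSet_Ico)

lemma measurableSet_dq (p : DIdx n) : MeasurableSet (dq p) := by
  rw [dq_eq_dil]; exact measurableSet_dil 0 p

lemma dil_ae_eq_cube (κ : ℕ) (p : DIdx n) :
    dil κ p =ᵐ[volume] cube (corner κ p) (side p * (2 * κ + 1)) := by
  rw [dil_eq_preimage, cube_eq_preimage]
  have h : ∀ i, corner κ p i + side p * (2 * κ + 1) = side p * (p.2 i + κ + 1) := by
    intro i; simp only [corner]; ring
  simp only [h]
  refine (PiLp.volume_preserving_ofLp (Fin n)).quasiMeasurePreserving.preimage_ae_eq ?_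
  rw [Set.pi_univ_Icc]
  exact Measure.univ_pi_Ico_ae_eq_Icc

lemma volume_dil (κ : ℕ) (p : DIdx n) :
    volume (dil κ p) = ENNReal.ofReal (side p * (2 * κ + 1)) ^ n := by
  rw [dil_eq_preimage, (PiLp.volume_preserving_ofLp (Fin n)).measure_preimage
    (MeasurableSet.univ_pi fun i => measurableSet_Ico).nullMeasurableSet, Real.volume_pi_Ico]
  rw [Finset.prod_congr rfl fun i _ => by
    rw [show side p * (p.2 i + κ + 1) - side p * (p.2 i - κ) = side p * (2 * κ + 1) by ring]]
  simp

lemma volume_dq (p : DIdx n) : volume (dq p) = ENNReal.ofReal (side p) ^ n := by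
  rw [dq_eq_dil, volume_dil]; simp

lemma volume_dil_eq_mul (κ : ℕ) (p : DIdx n) :
    volume (dil κ p) = (2 * κ + 1) ^ n * volume (dq p) := by
  rw [volume_dil, volume_dq, ENNReal.ofReal_mul (side_pos p).le, mul_pow, mul_comm]
  congr 2
  rw [show (2 * (κ : ℝ) + 1) = ((2 * κ + 1 : ℕ) : ℝ) by push_cast; ring, ENNReal.ofReal_natCast]
  push_cast; rfl

lemma volume_dq_pos (p : DIdx n) : 0 < volume (dq p) := by
  rw [volume_dq]
  exact ENNReal.pow_pos (ENNReal.ofReal_pos.2 (side_pos p)) n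

lemma volume_dq_ne_zero (p : DIdx n) : volume (dq p) ≠ 0 := (volume_dq_pos p).ne'

lemma volume_dq_ne_top (p : DIdx n) : volume (dq p) ≠ ∞ := by
  rw [volume_dq]; exact ENNReal.pow_ne_top ENNReal.ofReal_ne_top

lemma volume_dil_ne_zero (κ : ℕ) (p : DIdx n) : volume (dil κ p) ≠ 0 :=
  ((volume_dq_pos p).trans_le (measure_mono (dq_subset_dil κ p))).ne'

lemma volume_dil_ne_top (κ : ℕ) (p : DIdx n) : volume (dil κ p) ≠ ∞ := by
  rw [volume_dil]; exact ENNReal.pow_ne_top ENNReal.ofReal_ne_top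

lemma dq_nonempty (p : DIdx n) : (dq p).Nonempty :=
  nonempty_of_measure_ne_zero (volume_dq_ne_zero p)

lemma volume_cb_pred (p : DIdx n) (x : Rn n) :
    volume (dq (cb (p.1 - 1) x)) = 2 ^ n * volume (dq p) := by
  have h : side (cb (p.1 - 1) x) = 2 * side p := by
    unfold side cb
    rw [show -(p.1 - 1) = -p.1 + 1 by ring, zpow_add₀ (by norm_num)]; ring
  rw [volume_dq, volume_dq, h, ENNReal.ofReal_mul (by norm_num), mul_pow]
  simp

lemma volume_dq_congr {p q : DIdx n} (h : p.1 = q.1) : volume (dq p) = volume (dq q) := by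
  rw [volume_dq, volume_dq, side, side, h]

/-- The neighbouring dyadic cubes that make up `dil κ p`. -/
def nbr (κ : ℕ) (p : DIdx n) : Finset (DIdx n) :=
  (Finset.Icc (fun i => p.2 i - κ) (fun i => p.2 i + κ)).image fun m => (p.1, m)

lemma mem_nbr {κ : ℕ} {p q : DIdx n} :
    q ∈ nbr κ p ↔ q.1 = p.1 ∧ ∀ i, p.2 i - κ ≤ q.2 i ∧ q.2 i ≤ p.2 i + κ := by
  simp only [nbr, Finset.mem_image, Finset.mem_Icc, Pi.le_def]
  constructor
  · rintro ⟨m, ⟨h1, h2⟩, rfl⟩; exact ⟨rfl, fun i => ⟨h1 i, h2 i⟩⟩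
  · rintro ⟨h, h'⟩
    exact ⟨q.2, ⟨fun i => (h' i).1, fun i => (h' i).2⟩, Prod.ext h.symm rfl⟩

lemma mem_dil_iff_cb {κ : ℕ} {p : DIdx n} {x : Rn n} : x ∈ dil κ p ↔ cb p.1 x ∈ nbr κ p := by
  rw [mem_nbr]; simp [cb, dil]

lemma dil_eq_biUnion (κ : ℕ) (p : DIdx n) : dil κ p = ⋃ q ∈ nbr κ p, dq q := by
  ext x
  simp only [Set.mem_iUnion, exists_prop, mem_dil_iff_cb]
  constructor
  · intro h; exact ⟨_, h, mem_dq_cb _ _⟩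
  · rintro ⟨q, hq, hx⟩
    rw [mem_dq_iff] at hx
    rwa [← (mem_nbr.1 hq).1, hx]

lemma dq_disjoint_of_level {p q : DIdx n} (h : p.1 = q.1) (hne : p ≠ q) :
    Disjoint (dq p) (dq q) := by
  rw [Set.disjoint_left]
  intro x hx hy
  rw [mem_dq_iff] at hx hy
  exact hne (by rw [← hx, ← hy, h])

lemma level_le_of_dq_subset {p q : DIdx n} (hn : 1 ≤ n) (h : dq q ⊆ dq p) : p.1 ≤ q.1 := by
  have := measure_mono (μ := volume) h
  rw [volume_dq, volume_dq] at this
  have h2 := (ENNReal.pow_le_pow_left_iff (by omega : n ≠ 0)).1 this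
  rw [ENNReal.ofReal_le_ofReal_iff (side_pos p).le] at h2
  unfold side at h2
  have := (zpow_le_zpow_iff_right₀ (by norm_num : (1 : ℝ) < 2)).1 h2
  linarith

lemma volume_dil_eq_sum (κ : ℕ) (p : DIdx n) (ν : Measure (Rn n)) :
    ν (dil κ p) = ∑ q ∈ nbr κ p, ν (dq q) := by
  rw [dil_eq_biUnion, measure_biUnion_finset _ fun q _ => measurableSet_dq q]
  intro q hq r hr hne
  exact dq_disjoint_of_level ((mem_nbr.1 hq).1.trans (mem_nbr.1 hr).1.symm) hne

lemma isBounded_dil (κ : ℕ) (p : DIdx n) : Bornology.IsBounded (dil κ p) := by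
  rw [dil_eq_preimage]
  refine (PiLp.antilipschitzWith_ofLp 2 (fun _ : Fin n => ℝ)).isBounded_preimage ?_
  refine Bornology.IsBounded.subset (Metric.isBounded_Icc
    (fun i => side p * (p.2 i - κ)) (fun i => side p * (p.2 i + κ + 1))) ?_
  intro x hx
  exact ⟨fun i => (hx i trivial).1, fun i => (hx i trivial).2.le⟩

lemma norm_le_sum_abs (x : Rn n) : ‖x‖ ≤ ∑ i, |x i| := by
  rw [EuclideanSpace.norm_eq]
  refine Real.sqrt_le_iff.2 ⟨Finset.sum_nonneg fun i _ => abs_nonneg _, ?_⟩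
  simp only [Real.norm_eq_abs]
  exact Finset.sum_sq_le_sq_sum_of_nonneg fun i _ => abs_nonneg _

lemma abs_apply_le_norm (x : Rn n) (i : Fin n) : |x i| ≤ ‖x‖ := by
  simpa using PiLp.norm_apply_le x i

lemma norm_sub_le_of_mem_dq {p : DIdx n} {x y : Rn n} (hx : x ∈ dq p) (hy : y ∈ dq p) :
    ‖x - y‖ ≤ n * side p := by
  rw [dq_eq_dil, mem_dil_iff] at hx hy
  refine (norm_le_sum_abs _).trans ?_
  have : ∀ i ∈ Finset.univ, |(x - y) i| ≤ side p := by
    intro i _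
    have h1 := hx i
    have h2 := hy i
    simp only [Nat.cast_zero, sub_zero, add_zero, PiLp.sub_apply] at *
    rw [abs_le]
    constructor <;> nlinarith
  simpa using Finset.sum_le_sum this

lemma le_norm_sub_of_notMem_dil {κ : ℕ} {p : DIdx n} {x y : Rn n} (hx : x ∈ dq p)
    (hy : y ∉ dil κ p) : κ * side p ≤ ‖x - y‖ := by
  rw [dq_eq_dil, mem_dil_iff] at hx
  rw [mem_dil_iff] at hy
  push Not at hy
  obtain ⟨i, hi⟩ := hy
  refine le_trans ?_ (abs_apply_le_norm (x - y) i)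
  have h1 := hx i
  simp only [Nat.cast_zero, sub_zero, add_zero, PiLp.sub_apply] at *
  by_cases h : side p * (p.2 i - κ) ≤ y i
  · have := hi h
    rw [abs_sub_comm]
    refine le_trans ?_ (le_abs_self _)
    nlinarith
  · push Not at h
    refine le_trans ?_ (le_abs_self _)
    nlinarith

/-- Any two points lie in neighbouring dyadic cubes of large size. -/
lemma exists_level_mem_dil {κ : ℕ} (hκ : 1 ≤ κ) (x y : Rn n) (j : ℤ) :
    ∃ d : ℕ, y ∈ dil κ (cb (j - d) x) := by
  obtain ⟨d, hd⟩ := pow_unbounded_of_one_lt ((2 : ℝ) ^ j * ‖x - y‖) (by norm_num : (1 : ℝ) < 2)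
  refine ⟨d, fun i => ?_⟩
  have h0 : (0 : ℝ) < 2 ^ (j - (d : ℤ)) := by positivity
  have h1 : (2 : ℝ) ^ (j - (d : ℤ)) * |x i - y i| < 1 := by
    have := abs_apply_le_norm (x - y) i
    simp only [PiLp.sub_apply] at this
    calc _ ≤ (2 : ℝ) ^ (j - (d : ℤ)) * ‖x - y‖ := by gcongr
      _ = (2 : ℝ) ^ j * ‖x - y‖ / 2 ^ d := by
        rw [zpow_sub₀ (by norm_num), zpow_natCast]; ring
      _ < 1 := by rw [div_lt_one (by positivity)]; exact hd
  have h2 : |(2 : ℝ) ^ (j - (d : ℤ)) * x i - (2 : ℝ) ^ (j - (d : ℤ)) * y i| < 1 := by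
    rwa [← mul_sub, abs_mul, abs_of_pos h0]
  have h3 : idx (j - (d : ℤ)) x i < idx (j - (d : ℤ)) y i + 2 := by
    unfold idx
    rw [Int.floor_lt]
    push_cast
    have := Int.lt_floor_add_one ((2 : ℝ) ^ (j - (d : ℤ)) * y i)
    linarith [(abs_lt.1 h2).2]
  have h4 : idx (j - (d : ℤ)) y i < idx (j - (d : ℤ)) x i + 2 := by
    unfold idx
    rw [Int.floor_lt]
    push_cast
    have := Int.lt_floor_add_one ((2 : ℝ) ^ (j - (d : ℤ)) * x i)
    linarith [(abs_lt.1 h2).1]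
  have : (1 : ℤ) ≤ κ := by exact_mod_cast hκ
  simp only [cb]
  constructor <;> linarith

end CZ

end

noncomputable section

namespace CZ

variable {n : ℕ}

/-! ### Differentiation along dyadic cubes -/

/-- Almost everywhere, a bound for all small dyadic averages bounds the function. -/
lemma ae_enorm_le_of_dyadic_average_le {E : Type*} [NormedAddCommGroup E] {g : Rn n → E}
    (hg : LocallyIntegrable g volume) :
    ∀ᵐ x ∂(volume : Measure (Rn n)), ∀ (t : ℝ≥0∞) (j₀ : ℤ),
      (∀ j, j₀ ≤ j → ∫⁻ y in dq (cb j x), ‖g y‖ₑ ≤ t * volume (dq (cb j x))) → ‖g x‖ₑ ≤ t := by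
  filter_upwards [IsUnifLocDoublingMeasure.ae_tendsto_average_norm_sub volume hg 1]
    with x hx t j₀ ht
  set δ : ℕ → ℝ := fun k => (n + 1) * ((1 / 2 : ℝ) ^ k * 2 ^ (-j₀)) with hδ
  have hδpos : ∀ k, 0 < δ k := fun k => by simp only [hδ]; positivity
  have hδlim : Filter.Tendsto δ Filter.atTop (nhdsWithin 0 (Set.Ioi 0)) := by
    refine tendsto_nhdsWithin_iff.2 ⟨?_, Filter.Eventually.of_forall hδpos⟩
    have := ((tendsto_pow_atTop_nhds_zero_of_lt_one (r := (1 / 2 : ℝ)) (by norm_num)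
      (by norm_num)).mul_const ((2 : ℝ) ^ (-j₀))).const_mul ((n : ℝ) + 1)
    simpa [hδ] using this
  have h1 := hx (fun _ => x) δ hδlim
    (Filter.Eventually.of_forall fun k => by
      rw [one_mul]; exact Metric.mem_closedBall_self (hδpos k).le)
  set R : ℝ≥0∞ := ENNReal.ofReal (((n : ℝ) + 1) ^ n) * volume (Metric.ball (0 : Rn n) 1)
  have hR : R ≠ ∞ := ENNReal.mul_ne_top ENNReal.ofReal_ne_top measure_ball_lt_top.ne
  have key : ∀ k : ℕ, ‖g x‖ₑ ≤
      t + ENNReal.ofReal (⨍ y in Metric.closedBall x (δ k), ‖g y - g x‖) * R := by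
    intro k
    set p := cb (j₀ + k) x
    have hs : side p = (1 / 2 : ℝ) ^ k * 2 ^ (-j₀) := by
      simp only [side, p, cb]
      rw [neg_add, zpow_add₀ (by norm_num), zpow_neg _ (k : ℤ), zpow_natCast]
      rw [one_div, inv_pow]; ring
    have hsub : dq p ⊆ Metric.closedBall x (δ k) := by
      intro y hy
      rw [Metric.mem_closedBall, dist_eq_norm]
      refine (norm_sub_le_of_mem_dq hy (mem_dq_cb _ _)).trans ?_
      simp only [hδ]
      rw [← hs]
      nlinarith [side_pos p]
    have hball : volume (Metric.closedBall x (δ k)) = R * volume (dq p) := by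
      rw [Measure.addHaar_closedBall _ _ (hδpos k).le, finrank_euclideanSpace_fin, volume_dq]
      simp only [hδ, ← hs, R]
      rw [mul_pow, ENNReal.ofReal_mul (by positivity), ENNReal.ofReal_pow (side_pos p).le]
      ring
    have hint : IntegrableOn (fun y => g y - g x) (Metric.closedBall x (δ k)) volume :=
      (hg.integrableOn_isCompact (isCompact_closedBall x _)).sub
        (integrableOn_const (hs := measure_closedBall_lt_top.ne))
    have e1 : ∫⁻ y in Metric.closedBall x (δ k), ‖g y - g x‖ₑ =
        ENNReal.ofReal (⨍ y in Metric.closedBall x (δ k), ‖g y - g x‖) *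
          volume (Metric.closedBall x (δ k)) := by
      have hne : (volume (Metric.closedBall x (δ k))) ≠ 0 :=
        (Metric.measure_closedBall_pos volume x (hδpos k)).ne'
      have hnt : (volume (Metric.closedBall x (δ k))) ≠ ∞ := measure_closedBall_lt_top.ne
      rw [← ofReal_integral_norm_eq_lintegral_enorm hint]
      rw [← ENNReal.ofReal_toReal hnt, ← ENNReal.ofReal_mul
        (by rw [setAverage_eq]; exact smul_nonneg (by positivity)
              (integral_nonneg fun _ => norm_nonneg _))]
      congr 1
      rw [setAverage_eq, smul_eq_mul, Measure.real]
      have : (volume (Metric.closedBall x (δ k))).toReal ≠ 0 := ENNReal.toReal_ne_zero.2 ⟨hne, hnt⟩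
      field_simp
    have e2 : ‖g x‖ₑ * volume (dq p) ≤ t * volume (dq p) +
        ENNReal.ofReal (⨍ y in Metric.closedBall x (δ k), ‖g y - g x‖) * R * volume (dq p) := by
      calc ‖g x‖ₑ * volume (dq p) = ∫⁻ _ in dq p, ‖g x‖ₑ := by rw [setLIntegral_const]
        _ ≤ ∫⁻ y in dq p, (‖g y‖ₑ + ‖g y - g x‖ₑ) := by
          refine lintegral_mono fun y => ?_
          have := enorm_sub_le (a := g y) (b := g y - g x)
          simpa using this
        _ = (∫⁻ y in dq p, ‖g y‖ₑ) + ∫⁻ y in dq p, ‖g y - g x‖ₑ := by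
          refine lintegral_add_right' _ ?_
          exact (hint.mono_set hsub).aestronglyMeasurable.enorm
        _ ≤ _ := by
          refine add_le_add (ht (j₀ + k) (by omega)) ?_
          rw [mul_assoc, ← hball, ← e1]
          exact lintegral_mono_set hsub
    rw [← add_mul] at e2
    exact (ENNReal.mul_le_mul_iff_left (volume_dq_ne_zero p) (volume_dq_ne_top p)).1 e2
  have hlim : Filter.Tendsto (fun k => t + ENNReal.ofReal
      (⨍ y in Metric.closedBall x (δ k), ‖g y - g x‖) * R) Filter.atTop (nhds (t + 0 * R)) := by
    refine Filter.Tendsto.add tendsto_const_nhds ?_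
    refine ENNReal.Tendsto.mul_const ?_ (Or.inr hR)
    simpa [Function.comp_def] using (ENNReal.continuous_ofReal.tendsto 0).comp h1
  rw [zero_mul, add_zero] at hlim
  exact ge_of_tendsto' hlim key

/-! ### Maximal cubes -/

/-- The maximal dyadic cubes of level at least `j₀` with the property `Bad`. -/
def Stop (j₀ : ℤ) (Bad : DIdx n → Prop) : Set (DIdx n) :=
  {p | j₀ ≤ p.1 ∧ Bad p ∧ ∀ x ∈ dq p, ∀ i, j₀ ≤ i → i < p.1 → ¬ Bad (cb i x)}

lemma pairwiseDisjoint_stop (j₀ : ℤ) (Bad : DIdx n → Prop) :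
    (Stop j₀ Bad).PairwiseDisjoint dq := by
  intro p hp q hq hne
  rw [Function.onFun, Set.disjoint_left]
  intro x hx hx'
  rcases lt_trichotomy p.1 q.1 with h | h | h
  · exact hq.2.2 x hx' _ hp.1 h (by rw [mem_dq_iff.1 hx]; exact hp.2.1)
  · exact Set.disjoint_left.1 (dq_disjoint_of_level h hne) hx hx'
  · exact hp.2.2 x hx _ hq.1 h (by rw [mem_dq_iff.1 hx']; exact hq.2.1)

lemma exists_mem_stop {j₀ j : ℤ} {Bad : DIdx n → Prop} {x : Rn n} (hj : j₀ ≤ j)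
    (h : Bad (cb j x)) : ∃ p ∈ Stop j₀ Bad, x ∈ dq p ∧ p.1 ≤ j := by
  obtain ⟨i, ⟨hi1, hi2⟩, hi3⟩ := Int.exists_least_of_bdd (P := fun i => j₀ ≤ i ∧ Bad (cb i x))
    ⟨j₀, fun z hz => hz.1⟩ ⟨j, hj, h⟩
  refine ⟨cb i x, ⟨hi1, hi2, fun y hy k hk1 hk2 hb => ?_⟩, mem_dq_cb _ _, hi3 _ ⟨hj, h⟩⟩
  have hy' : idx i y = idx i x := hy
  have : cb k y = cb k x := Prod.ext rfl (idx_congr_of_le (le_of_lt hk2) hy')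
  rw [this] at hb
  exact absurd (hi3 k ⟨hk1, hb⟩) (not_le.2 hk2)

lemma level_lt_of_mem_stop {j₀ : ℤ} {Bad : DIdx n → Prop} (h0 : ∀ p : DIdx n, p.1 = j₀ → ¬ Bad p)
    {p : DIdx n} (hp : p ∈ Stop j₀ Bad) : j₀ < p.1 :=
  lt_of_le_of_ne hp.1 fun h => h0 p h.symm hp.2.1

lemma not_bad_parent_of_mem_stop {j₀ : ℤ} {Bad : DIdx n → Prop}
    (h0 : ∀ p : DIdx n, p.1 = j₀ → ¬ Bad p) {p : DIdx n} (hp : p ∈ Stop j₀ Bad) {x : Rn n}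
    (hx : x ∈ dq p) : ¬ Bad (cb (p.1 - 1) x) :=
  hp.2.2 x hx _ (by have := level_lt_of_mem_stop h0 hp; omega) (by omega)

lemma measure_biUnion_dq {S : Set (DIdx n)} (hd : S.PairwiseDisjoint dq) (ν : Measure (Rn n)) :
    ν (⋃ p ∈ S, dq p) = ∑' p : S, ν (dq (p : DIdx n)) :=
  measure_biUnion S.to_countable hd fun p _ => measurableSet_dq p

lemma measurableSet_biUnion_dq (S : Set (DIdx n)) : MeasurableSet (⋃ p ∈ S, dq p) :=
  MeasurableSet.biUnion S.to_countable fun p _ => measurableSet_dq p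

lemma measure_biUnion_dq_le {S : Set (DIdx n)} (hd : S.PairwiseDisjoint dq)
    {ν ρ : Measure (Rn n)} (h : ∀ p ∈ S, ν (dq p) ≤ ρ (dq p)) :
    ν (⋃ p ∈ S, dq p) ≤ ρ (⋃ p ∈ S, dq p) := by
  rw [measure_biUnion_dq hd, measure_biUnion_dq hd]
  exact ENNReal.tsum_le_tsum fun p => h p p.2

/-- All sufficiently large dyadic cubes have large volume. -/
lemma exists_level_le_mul_volume (hn : 1 ≤ n) {A t : ℝ≥0∞} (hA : A ≠ ∞) (ht : t ≠ 0) :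
    ∃ j₀ : ℤ, ∀ p : DIdx n, p.1 ≤ j₀ → A ≤ t * volume (dq p) := by
  obtain ⟨N, hN⟩ := ENNReal.exists_nat_gt (ENNReal.div_ne_top hA ht)
  refine ⟨-N, fun p hp => ?_⟩
  have h1 : (N : ℝ≥0∞) ≤ volume (dq p) := by
    have h2 : ((2 ^ N : ℕ) : ℝ) ≤ side p := by
      unfold side
      push_cast
      rw [← zpow_natCast]
      exact zpow_le_zpow_right₀ (by norm_num) (by omega)
    have h3 : ((2 ^ N : ℕ) : ℝ≥0∞) ≤ ENNReal.ofReal (side p) := by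
      rw [← ENNReal.ofReal_natCast]; exact ENNReal.ofReal_le_ofReal h2
    have h4 : (1 : ℝ≥0∞) ≤ ENNReal.ofReal (side p) := le_trans (by
      exact_mod_cast Nat.one_le_two_pow) h3
    rw [volume_dq]
    calc (N : ℝ≥0∞) ≤ ((2 ^ N : ℕ) : ℝ≥0∞) := by exact_mod_cast Nat.lt_two_pow_self.le
      _ ≤ ENNReal.ofReal (side p) ^ 1 := by rwa [pow_one]
      _ ≤ _ := pow_le_pow_right₀ h4 hn
  have h5 : A / t ≤ volume (dq p) := hN.le.trans h1
  rw [mul_comm]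
  exact (ENNReal.div_le_iff_le_mul (Or.inr (volume_dq_ne_top p))
    (Or.inr (volume_dq_ne_zero p))).1 h5

/-! ### The maximal function over dilated dyadic cubes -/

/-- The dilate of a dyadic cube by a factor that exceeds twice its diameter. -/
def star (p : DIdx n) : Set (Rn n) := dil (2 * n + 1) p

/-- The ratio of the volumes of `star p` and `dq p`. -/
def starC (n : ℕ) : ℝ≥0∞ := (2 * ((2 * n + 1 : ℕ) : ℝ≥0∞) + 1) ^ n

lemma starC_ne_top : starC n ≠ ∞ := by unfold starC; finiteness

lemma one_le_starC : 1 ≤ starC n := one_le_pow₀ (by simp)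

lemma starC_ne_zero : starC n ≠ 0 := (zero_lt_one.trans_le one_le_starC).ne'

lemma measurableSet_star (p : DIdx n) : MeasurableSet (star p) := measurableSet_dil _ p

lemma volume_star (p : DIdx n) : volume (star p) = starC n * volume (dq p) :=
  volume_dil_eq_mul _ _

lemma volume_star_ne_zero (p : DIdx n) : volume (star p) ≠ 0 := volume_dil_ne_zero _ p

lemma volume_star_ne_top (p : DIdx n) : volume (star p) ≠ ∞ := volume_dil_ne_top _ p

lemma dq_subset_star (p : DIdx n) : dq p ⊆ star p := dq_subset_dil _ p

lemma star_subset_cb {p : DIdx n} {x : Rn n} (hx : x ∈ dq p) {i : ℤ} (hi : i ≤ p.1) :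
    star p ⊆ star (cb i x) := dil_subset_cb hx hi

lemma star_subset_star {p q : DIdx n} (hn : 1 ≤ n) (h : dq q ⊆ dq p) : star q ⊆ star p := by
  obtain ⟨x, hx⟩ := dq_nonempty q
  have := star_subset_cb hx (level_le_of_dq_subset hn h)
  rwa [mem_dq_iff.1 (h hx)] at this

/-- The average of `H` over `star p`. -/
def avg (p : DIdx n) (H : Rn n → ℝ≥0∞) : ℝ≥0∞ := (volume (star p))⁻¹ * ∫⁻ y in star p, H y

lemma volume_mul_avg (p : DIdx n) (H : Rn n → ℝ≥0∞) :
    volume (star p) * avg p H = ∫⁻ y in star p, H y := by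
  rw [avg, ← mul_assoc, ENNReal.mul_inv_cancel (volume_star_ne_zero p) (volume_star_ne_top p),
    one_mul]

lemma avg_le_iff {p : DIdx n} {H : Rn n → ℝ≥0∞} {t : ℝ≥0∞} :
    avg p H ≤ t ↔ ∫⁻ y in star p, H y ≤ t * volume (star p) := by
  rw [avg, mul_comm, ← div_eq_mul_inv]
  exact ENNReal.div_le_iff (volume_star_ne_zero p) (volume_star_ne_top p)

/-- The maximal function over the dilates of the dyadic cubes containing a point. -/
def Mstar (H : Rn n → ℝ≥0∞) (x : Rn n) : ℝ≥0∞ := ⨆ j : ℤ, avg (cb j x) H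

lemma avg_le_Mstar {p : DIdx n} {H : Rn n → ℝ≥0∞} {x : Rn n} (hx : x ∈ dq p) :
    avg p H ≤ Mstar H x := by
  rw [← mem_dq_iff.1 hx]
  exact le_iSup (fun j => avg (cb j x) H) p.1

/-- The weak type `(1,1)` bound for the maximal function. -/
lemma mul_volume_Mstar_gt_le (hn : 1 ≤ n) (H : Rn n → ℝ≥0∞) (t : ℝ≥0∞) :
    t * volume {x | t < Mstar H x} ≤ starC n * ∫⁻ y, H y := by
  rcases eq_or_ne t 0 with rfl | ht0
  · simp
  rcases eq_or_ne t ∞ with rfl | htt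
  · simp
  by_cases hH : ∫⁻ y, H y = ∞
  · rw [hH, ENNReal.mul_top starC_ne_zero]; exact le_top
  set ν := volume.withDensity H
  have hν : ∀ s, ν s = ∫⁻ y in s, H y := fun s => withDensity_apply' H s
  have hνu : ν Set.univ = ∫⁻ y, H y := by rw [hν]; simp
  set Bad : DIdx n → Prop := fun p => t * volume (dq p) < ν (dq p)
  obtain ⟨j₀, hj₀⟩ := exists_level_le_mul_volume hn hH ht0
  have hnb : ∀ p : DIdx n, p.1 ≤ j₀ → ¬ Bad p := fun p hp hb =>
    absurd ((hj₀ p hp).trans_lt hb) (not_lt.2 (hνu ▸ measure_mono (Set.subset_univ _)))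
  set S := Stop j₀ Bad
  have hd : S.PairwiseDisjoint dq := pairwiseDisjoint_stop j₀ Bad
  have hsub : {x | t < Mstar H x} ⊆ ⋃ p ∈ S, star p := by
    intro x hx
    obtain ⟨j, hj⟩ := lt_iSup_iff.1 (show t < ⨆ j : ℤ, avg (cb j x) H from hx)
    set p := cb j x
    have h1 : t * volume (star p) < ν (star p) := by
      rw [hν]; by_contra hcon
      exact absurd (avg_le_iff.2 (not_lt.1 hcon)) (not_le.2 hj)
    have h2 : ∃ q ∈ nbr (2 * n + 1) p, Bad q := by
      by_contra hcon
      push Not at hcon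
      refine absurd h1 (not_lt.2 ?_)
      rw [star, volume_dil_eq_sum, volume_dil_eq_sum, Finset.mul_sum]
      exact Finset.sum_le_sum fun q hq => not_lt.1 (hcon q hq)
    obtain ⟨q, hq, hqb⟩ := h2
    have hq1 : q.1 = j := (mem_nbr.1 hq).1
    obtain ⟨y, hy⟩ := dq_nonempty q
    have hle : j₀ ≤ q.1 := by
      by_contra hcon
      exact hnb q (by omega) hqb
    obtain ⟨r, hr, hyr, hrq⟩ := exists_mem_stop (x := y) (Bad := Bad) hle (by rwa [mem_dq_iff.1 hy])
    refine Set.mem_biUnion hr ?_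
    have hxq : x ∈ star q := by
      intro i
      have h3 := (mem_nbr.1 hq).2 i
      rw [hq1]
      simp only [p, cb] at h3
      constructor <;> linarith [h3.1, h3.2]
    have := star_subset_cb hy hrq hxq
    rwa [mem_dq_iff.1 hyr] at this
  calc t * volume {x | t < Mstar H x} ≤ t * ∑' p : S, volume (star (p : DIdx n)) := by
        gcongr
        exact (measure_mono hsub).trans (measure_biUnion_le _ S.to_countable _)
    _ = starC n * (t * volume (⋃ p ∈ S, dq p)) := by
        simp only [volume_star]
        rw [measure_biUnion_dq hd, ENNReal.tsum_mul_left]; ring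
    _ ≤ starC n * ν (⋃ p ∈ S, dq p) := by
        gcongr
        have := measure_biUnion_dq_le hd (ν := t • volume) (ρ := ν) fun p hp => by
          simpa using hp.2.1.le
        simpa using this
    _ ≤ starC n * ∫⁻ y, H y := by
        gcongr
        rw [← hνu]; exact measure_mono (Set.subset_univ _)

end CZ

end

noncomputable section

namespace CZ

variable {n : ℕ}

/-! ### Kernel estimates -/

lemma side_cb_sub (p : DIdx n) (x : Rn n) (d : ℕ) : side (cb (p.1 - d) x) = 2 ^ d * side p := by
  unfold side cb
  rw [show -(p.1 - (d : ℤ)) = (d : ℤ) + -p.1 by ring, zpow_add₀ (by norm_num), zpow_natCast]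

lemma rpow_div_rpow_le {ε s r : ℝ} (hε : 0 < ε) (hs : 0 < s) {d : ℕ} (hr : 2 ^ d * s ≤ r) :
    s ^ ε / r ^ ((n : ℝ) + ε) ≤ 2 ^ n * ((2 : ℝ) ^ (-ε)) ^ d * ((2 ^ (d + 1) * s) ^ n)⁻¹ := by
  have h1 : (2 ^ d * s) ^ ((n : ℝ) + ε) ≤ r ^ ((n : ℝ) + ε) :=
    Real.rpow_le_rpow (by positivity) hr (by positivity)
  calc s ^ ε / r ^ ((n : ℝ) + ε) ≤ s ^ ε / (2 ^ d * s) ^ ((n : ℝ) + ε) := by gcongr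
    _ = _ := by
      rw [Real.rpow_add (by positivity), Real.rpow_natCast, Real.mul_rpow (by positivity) hs.le,
        Real.rpow_neg (by norm_num), inv_pow, ← Real.rpow_natCast _ d, ← Real.rpow_natCast _ d,
        ← Real.rpow_mul (by norm_num), ← Real.rpow_mul (by norm_num), mul_comm (d : ℝ) ε,
        pow_succ, mul_pow, mul_pow, mul_pow, Real.rpow_natCast]
      have : (0 : ℝ) < s ^ ε := by positivity
      have : (0 : ℝ) < 2 ^ (ε * d) := by positivity
      field_simp

/-- The integral of the decaying part of a standard kernel against `H` is controlled by the maximal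
function of `H`. -/
lemma exists_lintegral_decay_le {ε : ℝ} (hε : 0 < ε) :
    ∃ C : ℝ≥0∞, C ≠ ∞ ∧ ∀ (p : DIdx n) (x x' : Rn n), x ∈ dq p → x' ∈ dq p →
      ∀ H : Rn n → ℝ≥0∞, ∫⁻ y in (star p)ᶜ,
        ENNReal.ofReal (side p ^ ε / ‖x - y‖ ^ ((n : ℝ) + ε)) * H y ≤ C * Mstar H x' := by
  set ρ : ℝ≥0∞ := ENNReal.ofReal ((2 : ℝ) ^ (-ε))
  have hρ : ρ < 1 := by
    rw [← ENNReal.ofReal_one]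
    refine (ENNReal.ofReal_lt_ofReal_iff one_pos).2 ?_
    exact Real.rpow_lt_one_of_one_lt_of_neg (by norm_num) (by linarith)
  refine ⟨∑' d : ℕ, ENNReal.ofReal (2 ^ n) * ρ ^ d * starC n, ?_, ?_⟩
  · rw [ENNReal.tsum_mul_right, ENNReal.tsum_mul_left, ENNReal.tsum_geometric]
    refine ENNReal.mul_ne_top (ENNReal.mul_ne_top ENNReal.ofReal_ne_top ?_) starC_ne_top
    exact ENNReal.inv_ne_top.2 (tsub_pos_iff_lt.2 hρ).ne'
  intro p x x' hx hx' H
  set q : ℕ → DIdx n := fun d => cb (p.1 - d) x with hq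
  have hq0 : q 0 = p := by simp only [hq, Nat.cast_zero, sub_zero]; exact mem_dq_iff.1 hx
  have hcover : (star p)ᶜ ⊆ ⋃ d : ℕ, star (q (d + 1)) \ star (q d) := by
    intro y hy
    classical
    have hex : ∃ d, y ∈ star (q d) := exists_level_mem_dil (by omega) x y p.1
    have h0 : Nat.find hex ≠ 0 := by
      intro h0
      have := Nat.find_spec hex
      rw [h0, hq0] at this
      exact hy this
    obtain ⟨d, hd⟩ := Nat.exists_eq_succ_of_ne_zero h0
    refine Set.mem_iUnion.2 ⟨d, ?_, ?_⟩
    · have := Nat.find_spec hex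
      rwa [hd] at this
    · exact Nat.find_min hex (by omega)
  calc _ ≤ ∫⁻ y in ⋃ d : ℕ, star (q (d + 1)) \ star (q d),
        ENNReal.ofReal (side p ^ ε / ‖x - y‖ ^ ((n : ℝ) + ε)) * H y := lintegral_mono_set hcover
    _ ≤ ∑' d : ℕ, ∫⁻ y in star (q (d + 1)) \ star (q d),
        ENNReal.ofReal (side p ^ ε / ‖x - y‖ ^ ((n : ℝ) + ε)) * H y := lintegral_iUnion_le _ _
    _ ≤ ∑' d : ℕ, ENNReal.ofReal (2 ^ n) * ρ ^ d * starC n * Mstar H x' := by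
      refine ENNReal.tsum_le_tsum fun d => ?_
      have hxq : ∀ d, x ∈ dq (q d) := fun d => mem_dq_cb _ _
      have hx'q : x' ∈ dq (q (d + 1)) := dq_subset_cb hx (by omega) hx'
      set A : ℝ≥0∞ := ENNReal.ofReal (2 ^ n) * ρ ^ d * (volume (dq (q (d + 1))))⁻¹
      have hA : A ≠ ∞ := by
        refine ENNReal.mul_ne_top (ENNReal.mul_ne_top ENNReal.ofReal_ne_top ?_) ?_
        · exact ENNReal.pow_ne_top ENNReal.ofReal_ne_top
        · exact ENNReal.inv_ne_top.2 (volume_dq_ne_zero _)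
      calc _ ≤ ∫⁻ y in star (q (d + 1)) \ star (q d), A * H y := by
            refine setLIntegral_mono' ((measurableSet_star _).diff (measurableSet_star _)) ?_
            intro y hy
            gcongr
            have h1 := le_norm_sub_of_notMem_dil (hxq d) hy.2
            have h2 : 2 ^ d * side p ≤ ‖x - y‖ := by
              refine le_trans ?_ h1
              rw [side_cb_sub]
              have : (0 : ℝ) < 2 ^ d * side p := mul_pos (by positivity) (side_pos p)
              have h3 : (1 : ℝ) ≤ ((2 * n + 1 : ℕ) : ℝ) := by
                exact_mod_cast Nat.le_add_left 1 (2 * n)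
              nlinarith
            refine (ENNReal.ofReal_le_ofReal (rpow_div_rpow_le hε (side_pos p) h2)).trans
              (le_of_eq ?_)
            have hs := side_pos p
            simp only [A, ρ]
            rw [ENNReal.ofReal_mul (by positivity), ENNReal.ofReal_mul (by positivity),
              ENNReal.ofReal_inv_of_pos (by positivity), volume_dq, side_cb_sub,
              ENNReal.ofReal_pow (p := (2 : ℝ) ^ (-ε)) (by positivity),
              ENNReal.ofReal_pow (p := 2 ^ (d + 1) * side p) (by positivity)]
        _ ≤ ∫⁻ y in star (q (d + 1)), A * H y := lintegral_mono_set Set.sdiff_subset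
        _ = A * ∫⁻ y in star (q (d + 1)), H y := lintegral_const_mul' _ _ hA
        _ = ENNReal.ofReal (2 ^ n) * ρ ^ d * starC n * avg (q (d + 1)) H *
            ((volume (dq (q (d + 1))))⁻¹ * volume (dq (q (d + 1)))) := by
          rw [← volume_mul_avg, volume_star]
          simp only [A]; ring
        _ ≤ _ := by
          rw [ENNReal.inv_mul_cancel (volume_dq_ne_zero _) (volume_dq_ne_top _), mul_one]
          gcongr
          exact avg_le_Mstar hx'q
    _ = _ := by rw [ENNReal.tsum_mul_right]

lemma Mstar_one_le (x : Rn n) : Mstar (fun _ => 1) x ≤ 1 := by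
  refine iSup_le fun j => ?_
  rw [avg_le_iff]
  simp

variable {𝕜 : Type*} [RCLike 𝕜]

/-! ### The operator as a map on functions -/

/-- The values of `T` on functions in `L²`. -/
def Top (T : Lp 𝕜 2 (volume : Measure (Rn n)) →L[𝕜] Lp 𝕜 2 (volume : Measure (Rn n)))
    (h : Rn n → 𝕜) : Rn n → 𝕜 := by
  classical
  exact if hm : MemLp h 2 volume then T (hm.toLp h) else 0

section Top

variable {T : Lp 𝕜 2 (volume : Measure (Rn n)) →L[𝕜] Lp 𝕜 2 (volume : Measure (Rn n))}
  {h h₁ h₂ : Rn n → 𝕜}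

lemma Top_eq (hm : MemLp h 2 volume) : Top T h = T (hm.toLp h) := by
  unfold Top; rw [dif_pos hm]

lemma Top_congr (hm : MemLp h₁ 2 volume) (he : h₁ =ᵐ[volume] h₂) : Top T h₁ = Top T h₂ := by
  have hm2 : MemLp h₂ 2 volume := hm.ae_eq he
  rw [Top_eq hm, Top_eq hm2, (MemLp.toLp_eq_toLp_iff hm hm2).2 he]

lemma Top_add (hm₁ : MemLp h₁ 2 volume) (hm₂ : MemLp h₂ 2 volume) :
    Top T (fun x => h₁ x + h₂ x) =ᵐ[volume] fun x => Top T h₁ x + Top T h₂ x := by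
  rw [show (fun x => h₁ x + h₂ x) = h₁ + h₂ from rfl, Top_eq (hm₁.add hm₂), Top_eq hm₁, Top_eq hm₂,
    MemLp.toLp_add, map_add]
  exact Lp.coeFn_add _ _

lemma Top_const_mul (c : 𝕜) (hm : MemLp h 2 volume) :
    Top T (fun x => c * h x) =ᵐ[volume] fun x => c * Top T h x := by
  rw [show (fun x => c * h x) = c • h from rfl, Top_eq (hm.const_smul c), Top_eq hm,
    MemLp.toLp_const_smul, map_smul]
  exact Lp.coeFn_smul _ _

lemma Top_sub (hm₁ : MemLp h₁ 2 volume) (hm₂ : MemLp h₂ 2 volume) :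
    Top T (fun x => h₁ x - h₂ x) =ᵐ[volume] fun x => Top T h₁ x - Top T h₂ x := by
  rw [show (fun x => h₁ x - h₂ x) = h₁ - h₂ from rfl, Top_eq (hm₁.sub hm₂), Top_eq hm₁, Top_eq hm₂,
    MemLp.toLp_sub, map_sub]
  exact Lp.coeFn_sub _ _

lemma memLp_Top (T : Lp 𝕜 2 (volume : Measure (Rn n)) →L[𝕜] Lp 𝕜 2 (volume : Measure (Rn n)))
    (hm : MemLp h 2 volume) : MemLp (Top T h) 2 volume := by
  rw [Top_eq hm]; exact Lp.memLp _

lemma eLpNorm_Top_le (hm : MemLp h 2 volume) :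
    eLpNorm (Top T h) 2 volume ≤ ‖T‖ₑ * eLpNorm h 2 volume := by
  rw [Top_eq hm, ← Lp.enorm_def, ← Lp.enorm_toLp hm]
  exact T.le_opENorm _

end Top

/-- `K` represents `T` off the support, on test functions. -/
def Represents (K : Rn n → Rn n → 𝕜)
    (T : Lp 𝕜 2 (volume : Measure (Rn n)) →L[𝕜] Lp 𝕜 2 (volume : Measure (Rn n))) : Prop :=
  ∀ (f : Rn n → 𝕜) (hf : MemLp f 2 volume), ContDiff ℝ (⊤ : ℕ∞) f → HasCompactSupport f →
    ∀ᵐ x ∂volume, x ∉ tsupport f → T (hf.toLp f) x = ∫ y, K x y * f y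

section Kernel

variable {K : Rn n → Rn n → 𝕜}

lemma IsStandardKernel.continuousOn (hK : IsStandardKernel K) (x : Rn n) :
    ContinuousOn (K x) {x}ᶜ := by
  obtain ⟨c, ε, hε, h⟩ := hK.regularity
  intro y hy
  have hxy : 0 < ‖y - x‖ := norm_pos_iff.2 (sub_ne_zero.2 hy)
  apply ContinuousAt.continuousWithinAt
  rw [ContinuousAt, tendsto_iff_norm_sub_tendsto_zero]
  have hlim : Filter.Tendsto (fun z : Rn n => c * (‖y - z‖ ^ ε / ‖y - x‖ ^ ((n : ℝ) + ε)))
      (nhds y) (nhds 0) := by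
    have h1 : Continuous fun z : Rn n => c * (‖y - z‖ ^ ε / ‖y - x‖ ^ ((n : ℝ) + ε)) :=
      continuous_const.mul ((Continuous.rpow_const (by fun_prop) fun _ => Or.inr hε.le).div_const _)
    have h2 := h1.tendsto y
    simpa [Real.zero_rpow hε.ne'] using h2
  refine squeeze_zero' (Filter.Eventually.of_forall fun _ => norm_nonneg _) ?_ hlim
  have : ∀ᶠ z in nhds y, ‖y - z‖ < ‖y - x‖ / 2 := by
    have h3 : Continuous fun z : Rn n => ‖y - z‖ := by fun_prop
    refine h3.continuousAt.eventually_lt_const ?_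
    simp only [sub_self, norm_zero]; linarith
  filter_upwards [this] with z hz
  have h4 := h y x z (by linarith)
  rw [norm_sub_rev]
  linarith [norm_nonneg (K y x - K z x)]

/-- On a bounded set away from `x`, the kernel `K x` is in `L²`. -/
lemma IsStandardKernel.memLp_indicator (hK : IsStandardKernel K) {A : Set (Rn n)}
    (hA : IsCompact A) {x : Rn n} (hx : x ∉ A) :
    MemLp (A.indicator (K x)) 2 volume := by
  have hc : ContinuousOn (K x) A := (hK.continuousOn x).mono fun y hy => by
    rintro rfl; exact hx hy
  rw [memLp_indicator_iff_restrict hA.measurableSet]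
  obtain ⟨M, hM⟩ := hA.exists_bound_of_continuousOn hc
  have : IsFiniteMeasure (volume.restrict A) := ⟨by simpa using hA.measure_lt_top⟩
  exact MemLp.of_bound (hc.aestronglyMeasurable hA.measurableSet) M
    ((ae_restrict_iff' hA.measurableSet).2 (Filter.Eventually.of_forall hM))

lemma IsStandardKernel.integrable_mul (hK : IsStandardKernel K) {A : Set (Rn n)}
    (hA : IsCompact A) {x : Rn n} (hx : x ∉ A) {h : Rn n → 𝕜} (hh : MemLp h 2 volume)
    (h0 : ∀ y, y ∉ A → h y = 0) : Integrable (fun y => K x y * h y) volume := by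
  have := (hK.memLp_indicator hA hx).integrable_mul hh
  refine this.congr (Filter.Eventually.of_forall fun y => ?_)
  by_cases hy : y ∈ A
  · simp [hy]
  · simp [h0 y hy]

lemma exists_smooth_cutoff {k : Set (Rn n)} (hk : IsCompact k) {δ : ℝ} (hδ : 0 < δ) :
    ∃ χ : Rn n → ℝ, ContDiff ℝ (⊤ : ℕ∞) χ ∧ (∀ x ∈ k, χ x = 1) ∧
      (∀ x ∉ Metric.thickening δ k, χ x = 0) ∧ ∀ x, |χ x| ≤ 1 := by
  obtain ⟨f, h0, h1, h2⟩ := exists_contMDiffMap_zero_one_of_isClosed (n := ⊤)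
    (modelWithCornersSelf ℝ (Rn n))
    (Metric.isOpen_thickening (δ := δ) (E := k)).isClosed_compl hk.isClosed
    (Set.disjoint_left.2 fun x hx hx' => hx (Metric.self_subset_thickening hδ k hx'))
  refine ⟨f, f.contMDiff.contDiff, fun x hx => h1 hx, fun x hx => h0 hx, fun x => ?_⟩
  rw [abs_le]
  constructor <;> linarith [(h2 x).1, (h2 x).2]

variable {T : Lp 𝕜 2 (volume : Measure (Rn n)) →L[𝕜] Lp 𝕜 2 (volume : Measure (Rn n))}

lemma lintegral_enorm_mul_le_eLpNorm {f g : Rn n → 𝕜} (hf : AEStronglyMeasurable f volume)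
    (hg : AEStronglyMeasurable g volume) :
    ∫⁻ x, ‖f x * g x‖ₑ ≤ eLpNorm f 2 volume * eLpNorm g 2 volume := by
  have := eLpNorm_smul_le_mul_eLpNorm (p := 2) (q := 2) (r := 1) hg hf
  rw [eLpNorm_one_eq_lintegral_enorm] at this
  exact this

/-- The kernel representation for `L²` functions with bounded support. -/
lemma Represents.ae_eq_integral (hr : Represents K T) (hK : IsStandardKernel K)
    {h : Rn n → 𝕜} (hh : MemLp h 2 volume) {s : Set (Rn n)} (hs : Bornology.IsBounded s)
    (h0 : ∀ x, x ∉ s → h x = 0) :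
    ∀ᵐ x ∂volume, x ∉ closure s → Top T h x = ∫ y, K x y * h y := by
  set k := closure s
  have hk : IsCompact k := hs.isCompact_closure
  have h0k : ∀ x, x ∉ k → h x = 0 := fun x hx => h0 x fun hx' => hx (subset_closure hx')
  suffices hmain : ∀ m : ℕ, ∀ᵐ x ∂(volume : Measure (Rn n)),
      x ∉ Metric.cthickening (1 / ((m : ℝ) + 1)) k → Top T h x = ∫ y, K x y * h y by
    filter_upwards [ae_all_iff.2 hmain] with x hx hxk
    obtain ⟨m, hm⟩ : ∃ m : ℕ, x ∉ Metric.cthickening (1 / ((m : ℝ) + 1)) k := by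
      by_contra hcon
      push Not at hcon
      apply hxk
      rw [← hk.isClosed.closure_eq, Metric.closure_eq_iInter_cthickening' k
        (Set.range fun m : ℕ => 1 / ((m : ℝ) + 1))]
      · simpa using hcon
      · intro ε hε
        obtain ⟨m, hm⟩ := exists_nat_one_div_lt hε
        exact ⟨_, ⟨m, rfl⟩, by positivity, hm.le⟩
    exact hx m hm
  intro m
  set δ : ℝ := 1 / ((m : ℝ) + 1)
  have hδ : 0 < δ := by positivity
  set A := Metric.cthickening δ k
  have hA : IsCompact A := hk.cthickening
  obtain ⟨χ, hχ, hχ1, hχ0, hχb⟩ := exists_smooth_cutoff hk hδ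
  have happ : ∀ i : ℕ, ∃ g : Rn n → 𝕜, HasCompactSupport g ∧ ContDiff ℝ (⊤ : ℕ∞) g ∧
      eLpNorm (h - g) 2 volume ≤ ENNReal.ofReal (1 / ((i : ℝ) + 1)) := fun i =>
    hh.exist_eLpNorm_sub_le (by norm_num) (by norm_num) (by positivity)
  choose g hg1 hg2 hg3 using happ
  set u : ℕ → Rn n → 𝕜 := fun i y => χ y • g i y with hu
  have hu2 : ∀ i, ContDiff ℝ (⊤ : ℕ∞) (u i) := fun i => hχ.smul (hg2 i)
  have hsubA : Metric.thickening δ k ⊆ A := Metric.thickening_subset_cthickening δ k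
  have hu0 : ∀ i y, y ∉ A → u i y = 0 := fun i y hy => by
    simp only [hu, hχ0 y fun hy' => hy (hsubA hy'), zero_smul]
  have hus : ∀ i, tsupport (u i) ⊆ A := fun i => by
    refine closure_minimal (fun y hy => ?_) hA.isClosed
    by_contra hy'
    exact hy (hu0 i y hy')
  have hu1 : ∀ i, HasCompactSupport (u i) := fun i =>
    hA.of_isClosed_subset (isClosed_tsupport _) (hus i)
  have hum : ∀ i, MemLp (u i) 2 volume := fun i =>
    (hu2 i).continuous.memLp_of_hasCompactSupport (hu1 i)
  have hdiff : ∀ i, eLpNorm (u i - h) 2 volume ≤ ENNReal.ofReal (1 / ((i : ℝ) + 1)) := by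
    intro i
    refine le_trans (eLpNorm_mono fun y => ?_) (hg3 i)
    have h1 : (u i - h) y = χ y • (g i y - h y) := by
      simp only [Pi.sub_apply, hu, smul_sub]
      by_cases hy : y ∈ k
      · rw [hχ1 y hy]; simp
      · rw [h0k y hy]; simp
    rw [h1, norm_smul, Pi.sub_apply, norm_sub_rev]
    exact mul_le_of_le_one_left (norm_nonneg _) (by simpa using hχb y)
  have hlim0 : Filter.Tendsto (fun i : ℕ => ENNReal.ofReal (1 / ((i : ℝ) + 1))) Filter.atTop
      (nhds 0) := by
    simpa [Function.comp_def] using (ENNReal.continuous_ofReal.tendsto 0).comp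
      (tendsto_one_div_add_atTop_nhds_zero_nat (𝕜 := ℝ))
  have hlim : Filter.Tendsto (fun i => eLpNorm (u i - h) 2 volume) Filter.atTop (nhds 0) :=
    tendsto_of_tendsto_of_tendsto_of_le_of_le tendsto_const_nhds hlim0 (fun _ => zero_le) hdiff
  have hTlim : Filter.Tendsto (fun i => eLpNorm (Top T (u i) - Top T h) 2 volume) Filter.atTop
      (nhds 0) := by
    have h2 := ENNReal.Tendsto.const_mul hlim (a := ‖T‖ₑ) (Or.inr enorm_ne_top)
    rw [mul_zero] at h2
    refine tendsto_of_tendsto_of_tendsto_of_le_of_le tendsto_const_nhds h2 (fun _ => zero_le) ?_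
    intro i
    have h3 := eLpNorm_Top_le (T := T) ((hum i).sub hh)
    have h4 := eLpNorm_congr_ae (p := 2) (Top_sub (T := T) (hum i) hh)
    exact h4.symm.trans_le h3
  obtain ⟨φ, hφ, hφlim⟩ := (tendstoInMeasure_of_tendsto_eLpNorm (by norm_num)
    (fun i => (memLp_Top T (hum i)).aestronglyMeasurable)
    (memLp_Top T hh).aestronglyMeasurable hTlim).exists_seq_tendsto_ae
  have hrep : ∀ i, ∀ᵐ x ∂(volume : Measure (Rn n)), x ∉ tsupport (u i) →
      Top T (u i) x = ∫ y, K x y * u i y := fun i => by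
    rw [Top_eq (hum i)]
    exact hr (u i) (hum i) (hu2 i) (hu1 i)
  filter_upwards [hφlim, ae_all_iff.2 hrep] with x hx hx2 hxA
  have hKm := hK.memLp_indicator hA hxA
  have hint : Filter.Tendsto (fun i => ∫ y, K x y * u i y) Filter.atTop
      (nhds (∫ y, K x y * h y)) := by
    have h0A : ∀ y, y ∉ A → h y = 0 := fun y hy =>
      h0k y fun hy' => hy (Metric.self_subset_cthickening k hy')
    refine tendsto_integral_of_L1 _ (hK.integrable_mul hA hxA hh h0A).aestronglyMeasurable
      (Filter.Eventually.of_forall fun i => hK.integrable_mul hA hxA (hum i) (hu0 i)) ?_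
    have h2 := ENNReal.Tendsto.const_mul hlim (a := eLpNorm (A.indicator (K x)) 2 volume)
      (Or.inr hKm.eLpNorm_lt_top.ne)
    rw [mul_zero] at h2
    refine tendsto_of_tendsto_of_tendsto_of_le_of_le tendsto_const_nhds h2 (fun _ => zero_le) ?_
    intro i
    refine le_trans (le_of_eq (lintegral_congr fun y => ?_))
      (lintegral_enorm_mul_le_eLpNorm hKm.aestronglyMeasurable
        ((hum i).sub hh).aestronglyMeasurable)
    by_cases hy : y ∈ A
    · simp [hy, mul_sub]
    · simp [h0A y hy, hu0 i y hy]
  refine tendsto_nhds_unique hx ?_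
  refine Filter.Tendsto.congr (fun i => ?_) (hint.comp hφ.tendsto_atTop)
  exact (hx2 (φ i) fun hx' => hxA (hus _ hx')).symm

end Kernel

end CZ

end

noncomputable section

namespace CZ

variable {n : ℕ} {𝕜 : Type*} [RCLike 𝕜]

section Kernel

variable {K : Rn n → Rn n → 𝕜}
  {T : Lp 𝕜 2 (volume : Measure (Rn n)) →L[𝕜] Lp 𝕜 2 (volume : Measure (Rn n))}

lemma lt_norm_sub_of_notMem_star {p : DIdx n} {x y z : Rn n} (hx : x ∈ dq p) (hz : z ∈ dq p)
    (hy : y ∉ star p) : 2 * ‖x - z‖ < ‖x - y‖ := by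
  have h1 := norm_sub_le_of_mem_dq hx hz
  have h2 := le_norm_sub_of_notMem_dil hx hy
  push_cast at h2
  nlinarith [side_pos p]

/-- The smoothness of a standard kernel on a dyadic cube. -/
lemma IsStandardKernel.exists_enorm_sub_le (hK : IsStandardKernel K) :
    ∃ (C : ℝ≥0∞) (ε : ℝ), C ≠ ∞ ∧ 0 < ε ∧ ∀ (p : DIdx n) (x z y : Rn n), x ∈ dq p → z ∈ dq p →
      y ∉ star p →
      ‖K x y - K z y‖ₑ ≤ C * ENNReal.ofReal (side p ^ ε / ‖x - y‖ ^ ((n : ℝ) + ε)) ∧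
      ‖K y x - K y z‖ₑ ≤ C * ENNReal.ofReal (side p ^ ε / ‖x - y‖ ^ ((n : ℝ) + ε)) := by
  obtain ⟨c, ε, hε, h⟩ := hK.regularity
  refine ⟨ENNReal.ofReal (|c| * (n : ℝ) ^ ε), ε, ENNReal.ofReal_ne_top, hε, ?_⟩
  intro p x z y hx hz hy
  have h1 := h x y z (lt_norm_sub_of_notMem_star hx hz hy)
  have h2 : c * (‖x - z‖ ^ ε / ‖x - y‖ ^ ((n : ℝ) + ε)) ≤
      |c| * (n : ℝ) ^ ε * (side p ^ ε / ‖x - y‖ ^ ((n : ℝ) + ε)) := by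
    calc c * (‖x - z‖ ^ ε / ‖x - y‖ ^ ((n : ℝ) + ε))
        ≤ |c| * ((n * side p) ^ ε / ‖x - y‖ ^ ((n : ℝ) + ε)) := by
          gcongr
          · exact le_abs_self c
          · exact norm_sub_le_of_mem_dq hx hz
      _ = _ := by rw [Real.mul_rpow (by positivity) (side_pos p).le]; ring
  rw [← ENNReal.ofReal_mul (by positivity)]
  constructor
  · rw [← ofReal_norm]
    exact ENNReal.ofReal_le_ofReal (by linarith [norm_nonneg (K y x - K y z)])
  · rw [← ofReal_norm]
    exact ENNReal.ofReal_le_ofReal (by linarith [norm_nonneg (K x y - K z y)])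

lemma notMem_closure_of_mem_dq {p : DIdx n} {x : Rn n} (hx : x ∈ dq p) {s : Set (Rn n)}
    (hs : s ⊆ (star p)ᶜ) : x ∉ closure s := by
  intro h
  have hp := side_pos p
  obtain ⟨y, hy, hxy⟩ := Metric.mem_closure_iff.1 h (((2 * n + 1 : ℕ) : ℝ) * side p)
    (by positivity)
  rw [dist_eq_norm] at hxy
  exact absurd hxy (not_lt.2 (le_norm_sub_of_notMem_dil hx (hs hy)))

lemma notMem_closure_dq {p : DIdx n} {x : Rn n} (hx : x ∉ star p) : x ∉ closure (dq p) := by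
  intro h
  have hp := side_pos p
  obtain ⟨y, hy, hxy⟩ := Metric.mem_closure_iff.1 h (((2 * n + 1 : ℕ) : ℝ) * side p)
    (by positivity)
  rw [dist_comm, dist_eq_norm] at hxy
  exact absurd hxy (not_lt.2 (le_norm_sub_of_notMem_dil hy hx))

/-- The oscillation over a cube of `T h`, for `h` vanishing near that cube. -/
lemma Represents.exists_oscillation_le (hr : Represents K T) (hK : IsStandardKernel K) :
    ∃ C : ℝ≥0∞, C ≠ ∞ ∧ ∀ (p : DIdx n) (s : Set (Rn n)) (h : Rn n → 𝕜), MemLp h 2 volume →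
      Bornology.IsBounded s → (∀ x, x ∉ s → h x = 0) → (∀ x ∈ star p, h x = 0) →
      ∃ G : Rn n → 𝕜, (∀ᵐ x ∂volume, x ∈ dq p → Top T h x = G x) ∧
        ∀ x ∈ dq p, ∀ x' ∈ dq p, ‖G x - G x'‖ₑ ≤ C * Mstar (fun y => ‖h y‖ₑ) x' := by
  obtain ⟨C₀, ε, hC₀, hε, hreg⟩ := hK.exists_enorm_sub_le
  obtain ⟨C₁, hC₁, hdec⟩ := exists_lintegral_decay_le (n := n) hε
  refine ⟨C₀ * C₁, ENNReal.mul_ne_top hC₀ hC₁, ?_⟩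
  intro p s h hh hs h0 hstar
  set s' := s \ star p
  have hs' : Bornology.IsBounded s' := hs.subset Set.sdiff_subset
  have h0' : ∀ x, x ∉ s' → h x = 0 := by
    intro x hx
    by_cases hxs : x ∈ star p
    · exact hstar x hxs
    · exact h0 x fun hx' => hx ⟨hx', hxs⟩
  have hcl : ∀ x ∈ dq p, x ∉ closure s' := fun x hx =>
    notMem_closure_of_mem_dq hx fun y hy => hy.2
  refine ⟨fun x => ∫ y, K x y * h y, ?_, ?_⟩
  · filter_upwards [hr.ae_eq_integral hK hh hs' h0'] with x hx hxp
    exact hx (hcl x hxp)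
  intro x hx x' hx'
  have hint : ∀ x ∈ dq p, Integrable (fun y => K x y * h y) volume := fun x hx =>
    hK.integrable_mul hs'.isCompact_closure (hcl x hx) hh
      fun y hy => h0' y fun hy' => hy (subset_closure hy')
  rw [← integral_sub (hint x hx) (hint x' hx')]
  calc _ ≤ ∫⁻ y, ‖K x y * h y - K x' y * h y‖ₑ := enorm_integral_le_lintegral_enorm _
    _ = ∫⁻ y in (star p)ᶜ, ‖K x y * h y - K x' y * h y‖ₑ := by
      rw [setLIntegral_eq_of_support_subset]
      intro y hy hy'
      apply hy
      simp [hstar y hy']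
    _ ≤ ∫⁻ y in (star p)ᶜ, C₀ *
        (ENNReal.ofReal (side p ^ ε / ‖x - y‖ ^ ((n : ℝ) + ε)) * ‖h y‖ₑ) := by
      refine setLIntegral_mono' (measurableSet_star p).compl fun y hy => ?_
      rw [← sub_mul, enorm_mul, ← mul_assoc]
      gcongr
      exact (hreg p x x' y hx hx' hy).1
    _ = C₀ * ∫⁻ y in (star p)ᶜ,
        ENNReal.ofReal (side p ^ ε / ‖x - y‖ ^ ((n : ℝ) + ε)) * ‖h y‖ₑ :=
      lintegral_const_mul' _ _ hC₀
    _ ≤ C₀ * (C₁ * Mstar (fun y => ‖h y‖ₑ) x') := by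
      gcongr
      exact hdec p x x' hx hx' _
    _ = _ := by rw [mul_assoc]

lemma integrable_of_memLp_two {h : Rn n → 𝕜} (hh : MemLp h 2 volume) {s : Set (Rn n)}
    (hs : volume s ≠ ∞) (h0 : ∀ x, x ∉ s → h x = 0) : Integrable h volume := by
  have : IsFiniteMeasure (volume.restrict s) := ⟨by simpa using hs.lt_top⟩
  have h1 : IntegrableOn h s volume := (hh.restrict s).integrable (by norm_num)
  exact (integrableOn_iff_integrable_of_support_subset fun x hx => by
    by_contra hx'; exact hx (h0 x hx')).1 h1

/-- The integral away from a cube of `T h`, for `h` of mean zero supported in that cube. -/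
lemma Represents.exists_lintegral_compl_star_le (hr : Represents K T) (hK : IsStandardKernel K) :
    ∃ C : ℝ≥0∞, C ≠ ∞ ∧ ∀ (p : DIdx n) (h : Rn n → 𝕜), MemLp h 2 volume →
      (∀ x, x ∉ dq p → h x = 0) → ∫ x, h x = 0 →
      ∫⁻ x in (star p)ᶜ, ‖Top T h x‖ₑ ≤ C * ∫⁻ x, ‖h x‖ₑ := by
  obtain ⟨C₀, ε, hC₀, hε, hreg⟩ := hK.exists_enorm_sub_le
  obtain ⟨C₁, hC₁, hdec⟩ := exists_lintegral_decay_le (n := n) hε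
  refine ⟨C₀ * C₁, ENNReal.mul_ne_top hC₀ hC₁, ?_⟩
  intro p h hh h0 hmean
  obtain ⟨c, hc⟩ := dq_nonempty p
  have hbd : Bornology.IsBounded (dq p) := by rw [dq_eq_dil]; exact isBounded_dil 0 p
  have hhi : Integrable h volume := integrable_of_memLp_two hh (volume_dq_ne_top p) h0
  have hpt : ∀ᵐ x ∂(volume : Measure (Rn n)), x ∈ (star p)ᶜ → ‖Top T h x‖ₑ ≤
      C₀ * ((∫⁻ y, ‖h y‖ₑ) *
        (ENNReal.ofReal (side p ^ ε / ‖c - x‖ ^ ((n : ℝ) + ε)) * 1)) := by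
    filter_upwards [hr.ae_eq_integral hK hh hbd h0] with x hx hxs
    rw [hx (notMem_closure_dq hxs)]
    have hi := hK.integrable_mul hbd.isCompact_closure (notMem_closure_dq hxs) hh
      fun y hy => h0 y fun hy' => hy (subset_closure hy')
    have h1 : ∫ y, K x y * h y = ∫ y, (K x y * h y - K x c * h y) := by
      rw [integral_sub hi (hhi.const_mul _), integral_const_mul, hmean, mul_zero, sub_zero]
    rw [h1]
    calc _ ≤ ∫⁻ y, ‖K x y * h y - K x c * h y‖ₑ := enorm_integral_le_lintegral_enorm _
      _ ≤ ∫⁻ y, C₀ * ENNReal.ofReal (side p ^ ε / ‖c - x‖ ^ ((n : ℝ) + ε)) * ‖h y‖ₑ := by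
        refine lintegral_mono fun y => ?_
        rw [← sub_mul, enorm_mul]
        by_cases hy : y ∈ dq p
        · gcongr
          rw [enorm_sub_rev]
          exact (hreg p c y x hc hy hxs).2
        · simp [h0 y hy]
      _ = C₀ * ENNReal.ofReal (side p ^ ε / ‖c - x‖ ^ ((n : ℝ) + ε)) * ∫⁻ y, ‖h y‖ₑ :=
        lintegral_const_mul' _ _ (ENNReal.mul_ne_top hC₀ ENNReal.ofReal_ne_top)
      _ = _ := by ring
  have hfin : (∫⁻ y, ‖h y‖ₑ) ≠ ∞ := hhi.hasFiniteIntegral.ne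
  calc _ ≤ ∫⁻ x in (star p)ᶜ, C₀ * ((∫⁻ y, ‖h y‖ₑ) *
        (ENNReal.ofReal (side p ^ ε / ‖c - x‖ ^ ((n : ℝ) + ε)) * 1)) :=
        setLIntegral_mono_ae' (measurableSet_star p).compl hpt
    _ = C₀ * ((∫⁻ y, ‖h y‖ₑ) * ∫⁻ x in (star p)ᶜ,
        ENNReal.ofReal (side p ^ ε / ‖c - x‖ ^ ((n : ℝ) + ε)) * 1) := by
      rw [lintegral_const_mul' _ _ hC₀, lintegral_const_mul' _ _ hfin]
    _ ≤ C₀ * ((∫⁻ y, ‖h y‖ₑ) * (C₁ * 1)) := by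
      gcongr
      exact (hdec p c c hc hc _).trans (by gcongr; exact Mstar_one_le c)
    _ = _ := by ring

/-! ### The weak type `(1,1)` bound -/

lemma eLpNorm_two_sq {h : Rn n → 𝕜} :
    eLpNorm h 2 volume ^ 2 = ∫⁻ x, ‖h x‖ₑ ^ 2 := by
  have := eLpNorm_nnreal_pow_eq_lintegral (f := h) (μ := (volume : Measure (Rn n)))
    (p := 2) (by norm_num)
  simpa using this

lemma lintegral_Top_sq_le {h : Rn n → 𝕜} (hh : MemLp h 2 volume) :
    ∫⁻ x, ‖Top T h x‖ₑ ^ 2 ≤ ‖T‖ₑ ^ 2 * ∫⁻ x, ‖h x‖ₑ ^ 2 := by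
  rw [← eLpNorm_two_sq, ← eLpNorm_two_sq, ← mul_pow]
  gcongr
  exact eLpNorm_Top_le hh

/-- Chebyshev's inequality for `T`. -/
lemma sq_mul_volume_Top_gt_le {h : Rn n → 𝕜} (hh : MemLp h 2 volume) (t : ℝ≥0∞) :
    t ^ 2 * volume {x | t < ‖Top T h x‖ₑ} ≤ ‖T‖ₑ ^ 2 * ∫⁻ x, ‖h x‖ₑ ^ 2 := by
  refine le_trans ?_ (lintegral_Top_sq_le hh)
  refine le_trans ?_ (mul_meas_ge_le_lintegral₀
    ((memLp_Top T hh).aestronglyMeasurable.enorm.pow_const 2) (t ^ 2))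
  refine mul_le_mul_right (measure_mono fun x hx => ?_) _
  exact pow_le_pow_left' (show t < ‖Top T h x‖ₑ from hx).le 2

lemma enorm_setAverage_mul_le (g : Rn n → 𝕜) {s : Set (Rn n)} (h0 : volume s ≠ 0)
    (ht : volume s ≠ ∞) : ‖⨍ x in s, g x‖ₑ * volume s ≤ ∫⁻ x in s, ‖g x‖ₑ := by
  rw [setAverage_eq, enorm_smul]
  have h1 : ‖(volume.real s)⁻¹‖ₑ = (volume s)⁻¹ := by
    rw [Real.enorm_eq_ofReal (by positivity), Measure.real, ENNReal.ofReal_inv_of_pos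
      (ENNReal.toReal_pos h0 ht), ENNReal.ofReal_toReal ht]
  rw [h1, mul_comm, ← mul_assoc, ENNReal.mul_inv_cancel h0 ht, one_mul]
  exact enorm_integral_le_lintegral_enorm _

end Kernel

end CZ

end

noncomputable section

namespace CZ

variable {n : ℕ} {𝕜 : Type*} [RCLike 𝕜]

section Weak

variable {K : Rn n → Rn n → 𝕜}
  {T : Lp 𝕜 2 (volume : Measure (Rn n)) →L[𝕜] Lp 𝕜 2 (volume : Measure (Rn n))}

lemma Top_finset_sum {ι : Type*} (F : Finset ι) {h : ι → Rn n → 𝕜}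
    (hh : ∀ i, MemLp (h i) 2 volume) :
    Top T (fun x => ∑ i ∈ F, h i x) =ᵐ[volume] fun x => ∑ i ∈ F, Top T (h i) x := by
  classical
  induction F using Finset.induction_on with
  | empty =>
    have h0 : MemLp (fun _ : Rn n => (0 : 𝕜)) 2 volume := MemLp.zero'
    have := Top_const_mul (T := T) (0 : 𝕜) h0
    simpa using this
  | insert a F ha ih =>
    have h1 : MemLp (fun x => ∑ i ∈ F, h i x) 2 volume := memLp_finsetSum F fun i _ => hh i
    simp only [Finset.sum_insert ha]
    filter_upwards [Top_add (T := T) (hh a) h1, ih] with x hx1 hx2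
    rw [hx1, hx2]

/-- The part of a function on a cube that has mean zero. -/
def badPart (g : Rn n → 𝕜) (p : DIdx n) : Rn n → 𝕜 :=
  (dq p).indicator fun x => g x - ⨍ y in dq p, g y

lemma memLp_indicator_dq_const (p : DIdx n) (c : 𝕜) :
    MemLp ((dq p).indicator fun _ => c) 2 volume :=
  memLp_indicator_const 2 (measurableSet_dq p) c (Or.inr (volume_dq_ne_top p))

lemma memLp_badPart {g : Rn n → 𝕜} (hg : MemLp g 2 volume) (p : DIdx n) :
    MemLp (badPart g p) 2 volume := by
  unfold badPart
  rw [Set.indicator_sub]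
  exact (hg.indicator (measurableSet_dq p)).sub (memLp_indicator_dq_const p _)

lemma integral_badPart {g : Rn n → 𝕜} (hg : Integrable g volume) (p : DIdx n) :
    ∫ x, badPart g p x = 0 := by
  unfold badPart
  rw [integral_indicator (measurableSet_dq p),
    integral_sub hg.integrableOn (integrableOn_const (hs := volume_dq_ne_top p)),
    setIntegral_const, setAverage_eq, smul_smul]
  rw [Measure.real, mul_inv_cancel₀
    (ENNReal.toReal_ne_zero.2 ⟨volume_dq_ne_zero p, volume_dq_ne_top p⟩),
    one_smul, sub_self]

lemma lintegral_badPart_le (g : Rn n → 𝕜) (p : DIdx n) :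
    ∫⁻ x, ‖badPart g p x‖ₑ ≤ 2 * ∫⁻ x in dq p, ‖g x‖ₑ := by
  unfold badPart
  simp only [enorm_indicator_eq_indicator_enorm]
  rw [lintegral_indicator (measurableSet_dq p)]
  calc ∫⁻ x in dq p, ‖g x - ⨍ y in dq p, g y‖ₑ
      ≤ ∫⁻ x in dq p, (‖g x‖ₑ + ‖⨍ y in dq p, g y‖ₑ) := lintegral_mono fun x => enorm_sub_le
    _ = (∫⁻ x in dq p, ‖g x‖ₑ) + ‖⨍ y in dq p, g y‖ₑ * volume (dq p) := by
      rw [lintegral_add_right _ measurable_const, setLIntegral_const]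
    _ ≤ _ := by
      rw [two_mul]
      gcongr
      exact enorm_setAverage_mul_le g (volume_dq_ne_zero p) (volume_dq_ne_top p)

set_option maxHeartbeats 1000000 in
/-- The weak type `(1,1)` bound for a Calderón–Zygmund operator. -/
theorem Represents.exists_weak_type (hn : 1 ≤ n) (hr : Represents K T) (hK : IsStandardKernel K) :
    ∃ C : ℝ≥0∞, C ≠ ∞ ∧ ∀ g : Rn n → 𝕜, MemLp g 2 volume → ∀ t : ℝ≥0∞,
      t * volume {x | t < ‖Top T g x‖ₑ} ≤ C * ∫⁻ x, ‖g x‖ₑ := by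
  obtain ⟨C₁, hC₁, hfar⟩ := hr.exists_lintegral_compl_star_le hK
  refine ⟨9 * 2 ^ n * ‖T‖ₑ ^ 2 + starC n + 6 * C₁, by
    have := starC_ne_top (n := n); have : ‖T‖ₑ ≠ ∞ := enorm_ne_top; finiteness, ?_⟩
  intro g hg t
  rcases eq_or_ne t 0 with rfl | ht0
  · simp
  rcases eq_or_ne t ∞ with rfl | htt
  · simp
  by_cases hgi : ∫⁻ x, ‖g x‖ₑ = ∞
  · rw [hgi, ENNReal.mul_top]
    · exact le_top
    · intro h
      simp only [add_eq_zero] at h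
      exact starC_ne_zero h.1.2
  have hgint : Integrable g volume := ⟨hg.aestronglyMeasurable, lt_top_iff_ne_top.2 hgi⟩
  set I := ∫⁻ x, ‖g x‖ₑ
  set ν := (volume : Measure (Rn n)).withDensity fun x => ‖g x‖ₑ
  have hν : ∀ s, ν s = ∫⁻ y in s, ‖g y‖ₑ := fun s => withDensity_apply' _ s
  have hνu : ν Set.univ = I := by rw [hν]; simp [I]
  set Bad : DIdx n → Prop := fun p => t * volume (dq p) < ν (dq p)
  obtain ⟨j₀, hj₀⟩ := exists_level_le_mul_volume hn hgi ht0
  have hnb : ∀ p : DIdx n, p.1 ≤ j₀ → ¬ Bad p := fun p hp hb =>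
    absurd ((hj₀ p hp).trans_lt hb) (not_lt.2 (hνu ▸ measure_mono (Set.subset_univ _)))
  set S := Stop j₀ Bad
  have hd : S.PairwiseDisjoint dq := pairwiseDisjoint_stop j₀ Bad
  set Ω := ⋃ p ∈ S, dq p
  have hΩ : MeasurableSet Ω := measurableSet_biUnion_dq S
  have hΩν : t * volume Ω ≤ ν Ω := by
    have := measure_biUnion_dq_le hd (ν := t • volume) (ρ := ν) fun p hp => by
      simpa using hp.2.1.le
    simpa using this
  have hup : ∀ p ∈ S, ν (dq p) ≤ 2 ^ n * t * volume (dq p) := by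
    intro p hp
    obtain ⟨x, hx⟩ := dq_nonempty p
    have h1 := not_bad_parent_of_mem_stop (fun p h => hnb p h.le) hp hx
    calc ν (dq p) ≤ ν (dq (cb (p.1 - 1) x)) := measure_mono (dq_subset_cb hx (by omega))
      _ ≤ t * volume (dq (cb (p.1 - 1) x)) := not_lt.1 h1
      _ = _ := by rw [volume_cb_pred]; ring
  have hoff : ∀ᵐ x ∂(volume : Measure (Rn n)), x ∉ Ω → ‖g x‖ₑ ≤ t := by
    filter_upwards [ae_enorm_le_of_dyadic_average_le hgint.locallyIntegrable] with x hx hxΩ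
    refine hx t j₀ fun j hj => ?_
    rw [← hν]
    by_contra hcon
    obtain ⟨p, hp, hxp, -⟩ := exists_mem_stop (Bad := Bad) hj (not_le.1 hcon)
    exact hxΩ (Set.mem_biUnion hp hxp)
  refine ENNReal.le_of_forall_pos_le_add fun η hη _ => ?_
  -- choose finitely many cubes that carry almost all of the square integral
  set σ := (volume : Measure (Rn n)).withDensity fun x => ‖g x‖ₑ ^ 2
  have hσ : ∀ s, σ s = ∫⁻ y in s, ‖g y‖ₑ ^ 2 := fun s => withDensity_apply' _ s
  have hσfin : σ Ω ≠ ∞ := by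
    refine ne_top_of_le_ne_top ?_ (measure_mono (Set.subset_univ Ω))
    rw [hσ, setLIntegral_univ, ← eLpNorm_two_sq]
    exact ENNReal.pow_ne_top hg.eLpNorm_lt_top.ne
  set δ : ℝ≥0∞ := η * (t * (9 * (‖T‖ₑ ^ 2 + 1))⁻¹)
  have hTT : 9 * (‖T‖ₑ ^ 2 + 1) ≠ ∞ := by have : ‖T‖ₑ ≠ ∞ := enorm_ne_top; finiteness
  have hTT0 : 9 * (‖T‖ₑ ^ 2 + 1) ≠ 0 := by simp
  have hδ : 0 < δ := by
    refine ENNReal.mul_pos (by exact_mod_cast hη.ne') ?_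
    exact (ENNReal.mul_pos ht0 (ENNReal.inv_ne_zero.2 hTT)).ne'
  obtain ⟨F, hF⟩ : ∃ F : Finset S, σ (Ω \ ⋃ p ∈ F, dq (p : DIdx n)) ≤ δ := by
    have hsum : ∑' p : S, σ (dq (p : DIdx n)) ≠ ∞ := by
      rw [← measure_biUnion_dq hd]; exact hσfin
    have h1 := (ENNReal.tendsto_tsum_compl_atTop_zero hsum).eventually (gt_mem_nhds hδ)
    obtain ⟨F, hF⟩ := h1.exists
    refine ⟨F, le_trans ?_ hF.le⟩
    refine le_trans (measure_mono (t := ⋃ p : {p : S // p ∉ F}, dq ((p : S) : DIdx n)) ?_)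
      (measure_iUnion_le _)
    rintro x ⟨hx1, hx2⟩
    obtain ⟨p, hp, hxp⟩ := Set.mem_iUnion₂.1 hx1
    refine Set.mem_iUnion.2 ⟨⟨⟨p, hp⟩, fun hpF => hx2 (Set.mem_biUnion hpF hxp)⟩, hxp⟩
  set UF := ⋃ p ∈ F, dq (p : DIdx n)
  have hUF : MeasurableSet UF := Finset.measurableSet_biUnion F fun p _ => measurableSet_dq _
  have hUFΩ : UF ⊆ Ω := Set.iUnion₂_subset fun p _ => Set.subset_biUnion_of_mem
    (u := fun p : DIdx n => dq p) p.2
  obtain ⟨c, hc⟩ : ∃ c : DIdx n → 𝕜, ∀ p, c p = ⨍ y in dq p, g y := ⟨_, fun _ => rfl⟩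
  obtain ⟨r₁, hr₁⟩ : ∃ r : Rn n → 𝕜, r = fun x => Ωᶜ.indicator g x +
    ∑ p ∈ F, (dq (p : DIdx n)).indicator (fun _ => c p) x := ⟨_, rfl⟩
  obtain ⟨r₂, hr₂⟩ : ∃ r : Rn n → 𝕜, r = (Ω \ UF).indicator g := ⟨_, rfl⟩
  obtain ⟨r₃, hr₃⟩ : ∃ r : Rn n → 𝕜, r = fun x => ∑ p ∈ F, badPart g (p : DIdx n) x := ⟨_, rfl⟩
  have hm₁ : MemLp r₁ 2 volume := by
    rw [hr₁]
    exact MemLp.add (hg.indicator hΩ.compl)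
      (memLp_finsetSum F fun p _ => memLp_indicator_dq_const _ _)
  have hm₂ : MemLp r₂ 2 volume := by rw [hr₂]; exact hg.indicator (hΩ.diff hUF)
  have hm₃ : MemLp r₃ 2 volume := by
    rw [hr₃]; exact memLp_finsetSum F fun p _ => memLp_badPart hg _
  have hFsum : ∀ (x : Rn n) (q : S), q ∈ F → x ∈ dq (q : DIdx n) →
      ∀ u : DIdx n → Rn n → 𝕜, ∑ p ∈ F, (dq (p : DIdx n)).indicator (u p) x = u q x := by
    intro x q hq hxq u
    rw [Finset.sum_eq_single q]
    · exact Set.indicator_of_mem hxq _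
    · intro p _ hne
      refine Set.indicator_of_notMem (fun hxp => ?_) _
      exact Set.disjoint_left.1 (hd p.2 q.2 fun h => hne (Subtype.ext h)) hxp hxq
    · intro h; exact absurd hq h
  have hFsum0 : ∀ x, x ∉ UF → ∀ u : DIdx n → Rn n → 𝕜,
      ∑ p ∈ F, (dq (p : DIdx n)).indicator (u p) x = 0 := by
    intro x hx u
    refine Finset.sum_eq_zero fun p hp => Set.indicator_of_notMem (fun hxp => hx ?_) _
    exact Set.mem_biUnion hp hxp
  have hdec : ∀ x, g x = (r₁ x + r₂ x) + r₃ x := by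
    intro x
    by_cases hxF : x ∈ UF
    · obtain ⟨q, hq, hxq⟩ := Set.mem_iUnion₂.1 hxF
      simp only [hr₁, hr₂, hr₃, badPart]
      rw [hFsum x q hq hxq fun p _ => c p, hFsum x q hq hxq fun p x => g x - ⨍ y in dq p, g y,
        Set.indicator_of_notMem (show x ∉ Ωᶜ from fun h => h (hUFΩ hxF)),
        Set.indicator_of_notMem (show x ∉ Ω \ UF from fun h => h.2 hxF)]
      simp [hc]
    · simp only [hr₁, hr₂, hr₃, badPart]
      rw [hFsum0 x hxF fun p _ => c p, hFsum0 x hxF fun p x => g x - ⨍ y in dq p, g y]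
      by_cases hxΩ : x ∈ Ω
      · simp [hxΩ, hxF]
      · simp [hxΩ]
  have hTdec : ∀ᵐ x ∂(volume : Measure (Rn n)),
      Top T g x = (Top T r₁ x + Top T r₂ x) + Top T r₃ x := by
    have h1 : g = fun x => (r₁ x + r₂ x) + r₃ x := funext hdec
    filter_upwards [Top_add (T := T) (hm₁.add hm₂) hm₃, Top_add (T := T) hm₁ hm₂] with x h2 h3
    rw [h1]
    rw [show (fun x => r₁ x + r₂ x + r₃ x) = fun x => (r₁ + r₂) x + r₃ x from rfl, h2]
    rw [show r₁ + r₂ = fun x => r₁ x + r₂ x from rfl, h3]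
  -- the good part
  have hcb : ∀ p ∈ S, ‖c p‖ₑ ≤ 2 ^ n * t := by
    intro p hp
    rw [hc]
    have h1 := (enorm_setAverage_mul_le g (volume_dq_ne_zero p) (volume_dq_ne_top p)).trans
      ((hν (dq p)).symm.le.trans (hup p hp))
    exact (ENNReal.mul_le_mul_iff_left (volume_dq_ne_zero p) (volume_dq_ne_top p)).1 h1
  have hr₁b : ∀ᵐ x ∂(volume : Measure (Rn n)), ‖r₁ x‖ₑ ≤ 2 ^ n * t := by
    filter_upwards [hoff] with x hx
    by_cases hxF : x ∈ UF
    · obtain ⟨q, hq, hxq⟩ := Set.mem_iUnion₂.1 hxF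
      simp only [hr₁]
      rw [hFsum x q hq hxq fun p _ => c p, Set.indicator_of_notMem
        (show x ∉ Ωᶜ from fun h => h (hUFΩ hxF)), zero_add]
      exact hcb q q.2
    · simp only [hr₁]
      rw [hFsum0 x hxF fun p _ => c p, add_zero]
      by_cases hxΩ : x ∈ Ω
      · rw [Set.indicator_of_notMem (show x ∉ Ωᶜ from fun h => h hxΩ)]; simp
      · rw [Set.indicator_of_mem (show x ∈ Ωᶜ from hxΩ)]
        refine (hx hxΩ).trans (le_mul_of_one_le_left zero_le (one_le_pow₀ (by norm_num)))
  have hFd : (F : Set S).PairwiseDisjoint fun p => dq (p : DIdx n) := by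
    intro p _ q _ hne
    exact hd p.2 q.2 fun h => hne (Subtype.ext h)
  have hFν : ∑ p ∈ F, ν (dq (p : DIdx n)) = ν UF :=
    (measure_biUnion_finset hFd fun p _ => measurableSet_dq _).symm
  have hr₁i : ∫⁻ x, ‖r₁ x‖ₑ ≤ I := by
    calc ∫⁻ x, ‖r₁ x‖ₑ ≤ ∫⁻ x, (Ωᶜ.indicator (fun x => ‖g x‖ₑ) x +
          ∑ p ∈ F, (dq (p : DIdx n)).indicator (fun _ => ‖c p‖ₑ) x) := by
          refine lintegral_mono fun x => ?_
          simp only [hr₁]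
          refine (enorm_add_le _ _).trans ?_
          gcongr
          · rw [enorm_indicator_eq_indicator_enorm]
          · refine (enorm_sum_le _ _).trans (le_of_eq ?_)
            simp only [enorm_indicator_eq_indicator_enorm]
      _ = ν Ωᶜ + ∑ p ∈ F, ‖c p‖ₑ * volume (dq (p : DIdx n)) := by
          rw [lintegral_add_right _ (Finset.measurable_sum _ fun p _ =>
            measurable_const.indicator (measurableSet_dq _)),
            lintegral_finsetSum _ fun p _ => measurable_const.indicator (measurableSet_dq _),
            lintegral_indicator hΩ.compl, hν]
          congr 1
          refine Finset.sum_congr rfl fun p _ => ?_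
          rw [lintegral_indicator (measurableSet_dq _), setLIntegral_const]
      _ ≤ ν Ωᶜ + ∑ p ∈ F, ν (dq (p : DIdx n)) := by
          gcongr with p hp
          rw [hν, hc]
          exact enorm_setAverage_mul_le g (volume_dq_ne_zero _) (volume_dq_ne_top _)
      _ ≤ ν Ωᶜ + ν Ω := by rw [hFν]; gcongr
      _ = I := by rw [add_comm, measure_add_measure_compl hΩ, hνu]
  have hr₁sq : ∫⁻ x, ‖r₁ x‖ₑ ^ 2 ≤ 2 ^ n * t * I := by
    calc ∫⁻ x, ‖r₁ x‖ₑ ^ 2 ≤ ∫⁻ x, 2 ^ n * t * ‖r₁ x‖ₑ := by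
          refine lintegral_mono_ae ?_
          filter_upwards [hr₁b] with x hx
          rw [sq]; gcongr
      _ = 2 ^ n * t * ∫⁻ x, ‖r₁ x‖ₑ := lintegral_const_mul' _ _ (by finiteness)
      _ ≤ _ := by gcongr
  have e₁ : t * volume {x | t / 3 < ‖Top T r₁ x‖ₑ} ≤ 9 * 2 ^ n * ‖T‖ₑ ^ 2 * I := by
    have h1 := (sq_mul_volume_Top_gt_le (T := T) hm₁ (t / 3)).trans
      (mul_le_mul_right hr₁sq _)
    have h2 : t * (t * volume {x | t / 3 < ‖Top T r₁ x‖ₑ}) ≤ t * (9 * 2 ^ n * ‖T‖ₑ ^ 2 * I) := by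
      calc _ = 9 * ((t / 3) ^ 2 * volume {x | t / 3 < ‖Top T r₁ x‖ₑ}) := by
            have h3 : t = 3 * (t / 3) := (ENNReal.mul_div_cancel (by norm_num) (by norm_num)).symm
            rw [← mul_assoc]
            nth_rewrite 1 [h3]; nth_rewrite 2 [h3]; ring
        _ ≤ 9 * (‖T‖ₑ ^ 2 * (2 ^ n * t * I)) := by gcongr
        _ = _ := by ring
    exact (ENNReal.mul_le_mul_iff_right ht0 htt).1 h2
  have e₂ : t * volume {x | t / 3 < ‖Top T r₂ x‖ₑ} ≤ η := by
    have h0 : ∫⁻ x, ‖r₂ x‖ₑ ^ 2 ≤ δ := by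
      refine le_trans (le_of_eq ?_) hF
      rw [hσ, ← lintegral_indicator (hΩ.diff hUF)]
      refine lintegral_congr fun x => ?_
      simp only [hr₂]
      by_cases hx : x ∈ Ω \ UF
      · rw [Set.indicator_of_mem hx, Set.indicator_of_mem hx]
      · rw [Set.indicator_of_notMem hx, Set.indicator_of_notMem hx]; simp
    have h1 := (sq_mul_volume_Top_gt_le (T := T) hm₂ (t / 3)).trans (mul_le_mul_right h0 _)
    have h2 : t * (t * volume {x | t / 3 < ‖Top T r₂ x‖ₑ}) ≤ t * η := by
      calc _ = 9 * ((t / 3) ^ 2 * volume {x | t / 3 < ‖Top T r₂ x‖ₑ}) := by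
            have h3 : t = 3 * (t / 3) := (ENNReal.mul_div_cancel (by norm_num) (by norm_num)).symm
            rw [← mul_assoc]
            nth_rewrite 1 [h3]; nth_rewrite 2 [h3]; ring
        _ ≤ 9 * ((‖T‖ₑ ^ 2 + 1) * δ) := by
            exact mul_le_mul_right (h1.trans (mul_le_mul_left le_self_add δ)) 9
        _ = t * η * ((9 * (‖T‖ₑ ^ 2 + 1)) * (9 * (‖T‖ₑ ^ 2 + 1))⁻¹) := by simp only [δ]; ring
        _ = t * η := by rw [ENNReal.mul_inv_cancel hTT0 hTT, mul_one]
    exact (ENNReal.mul_le_mul_iff_right ht0 htt).1 h2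
  -- the bad part
  set Ωs := ⋃ p ∈ S, star p
  have hΩs : MeasurableSet Ωs :=
    MeasurableSet.biUnion S.to_countable fun p _ => measurableSet_star p
  have e₃ : t * volume Ωs ≤ starC n * I := by
    calc t * volume Ωs ≤ t * ∑' p : S, volume (star (p : DIdx n)) := by
          gcongr; exact measure_biUnion_le _ S.to_countable _
      _ = starC n * (t * volume Ω) := by
          simp only [volume_star]
          rw [measure_biUnion_dq hd, ENNReal.tsum_mul_left]; ring
      _ ≤ starC n * I := by
          gcongr
          rw [← hνu]
          exact hΩν.trans (measure_mono (Set.subset_univ _))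
  have e₄ : t * volume {x | x ∉ Ωs ∧ t / 3 < ‖Top T r₃ x‖ₑ} ≤ 6 * C₁ * I := by
    have h1 : ∫⁻ x in Ωsᶜ, ‖Top T r₃ x‖ₑ ≤ 2 * C₁ * I := by
      calc ∫⁻ x in Ωsᶜ, ‖Top T r₃ x‖ₑ
          ≤ ∫⁻ x in Ωsᶜ, ∑ p ∈ F, ‖Top T (badPart g (p : DIdx n)) x‖ₑ := by
            refine lintegral_mono_ae (ae_restrict_of_ae ?_)
            filter_upwards [Top_finset_sum (T := T) F
              (h := fun p : S => badPart g (p : DIdx n)) fun p => memLp_badPart hg p] with x hx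
            rw [hr₃, hx]; exact enorm_sum_le _ _
        _ = ∑ p ∈ F, ∫⁻ x in Ωsᶜ, ‖Top T (badPart g (p : DIdx n)) x‖ₑ := by
            refine lintegral_finsetSum' _ fun p _ => ?_
            exact (memLp_Top T (memLp_badPart hg _)).aestronglyMeasurable.enorm.restrict
        _ ≤ ∑ p ∈ F, C₁ * (2 * ν (dq (p : DIdx n))) := by
            refine Finset.sum_le_sum fun p hp => ?_
            calc _ ≤ ∫⁻ x in (star (p : DIdx n))ᶜ, ‖Top T (badPart g (p : DIdx n)) x‖ₑ :=
                  lintegral_mono_set (Set.compl_subset_compl.2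
                    (Set.subset_biUnion_of_mem (u := fun p : DIdx n => star p) p.2))
              _ ≤ C₁ * ∫⁻ x, ‖badPart g (p : DIdx n) x‖ₑ :=
                  hfar p _ (memLp_badPart hg _) (fun x hx => Set.indicator_of_notMem hx _)
                    (integral_badPart hgint _)
              _ ≤ _ := by gcongr; rw [hν]; exact lintegral_badPart_le g _
        _ = 2 * C₁ * ν UF := by
            rw [← Finset.mul_sum, ← Finset.mul_sum, hFν]; ring
        _ ≤ 2 * C₁ * I := by
            gcongr; rw [← hνu]; exact measure_mono (Set.subset_univ _)
    have h2 : (t / 3) * volume {x | x ∉ Ωs ∧ t / 3 < ‖Top T r₃ x‖ₑ} ≤ 2 * C₁ * I := by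
      refine le_trans ?_ h1
      have h4 := mul_meas_ge_le_lintegral₀ (μ := volume.restrict Ωsᶜ)
        (memLp_Top T hm₃).aestronglyMeasurable.enorm.restrict (t / 3)
      refine le_trans ?_ h4
      refine mul_le_mul_right ?_ _
      rw [Measure.restrict_apply' hΩs.compl]
      refine measure_mono fun x hx => ⟨hx.2.le, hx.1⟩
    calc _ = 3 * ((t / 3) * volume {x | x ∉ Ωs ∧ t / 3 < ‖Top T r₃ x‖ₑ}) := by
          rw [← mul_assoc, ENNReal.mul_div_cancel (by norm_num) (by norm_num)]
      _ ≤ 3 * (2 * C₁ * I) := by gcongr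
      _ = _ := by ring
  have hsub : {x | t < ‖Top T g x‖ₑ} ≤ᵐ[volume] ((({x | t / 3 < ‖Top T r₁ x‖ₑ} ∪
      {x | t / 3 < ‖Top T r₂ x‖ₑ}) ∪ Ωs) ∪ {x | x ∉ Ωs ∧ t / 3 < ‖Top T r₃ x‖ₑ} : Set (Rn n)) := by
    filter_upwards [hTdec] with x hx hxt
    by_contra hcon
    have hcon' : ¬ (((t / 3 < ‖Top T r₁ x‖ₑ ∨ t / 3 < ‖Top T r₂ x‖ₑ) ∨ x ∈ Ωs) ∨
      (x ∉ Ωs ∧ t / 3 < ‖Top T r₃ x‖ₑ)) := hcon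
    push Not at hcon'
    obtain ⟨⟨⟨h1, h2⟩, h3⟩, h4⟩ := hcon'
    refine absurd (show t < ‖Top T g x‖ₑ from hxt) (not_lt.2 ?_)
    rw [hx]
    calc _ ≤ ‖Top T r₁ x‖ₑ + ‖Top T r₂ x‖ₑ + ‖Top T r₃ x‖ₑ :=
          (enorm_add_le _ _).trans (add_le_add_left (enorm_add_le _ _) _)
      _ ≤ t / 3 + t / 3 + t / 3 := add_le_add (add_le_add h1 h2) (h4 h3)
      _ = t := ENNReal.add_thirds t
  calc t * volume {x | t < ‖Top T g x‖ₑ}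
      ≤ t * (((volume {x | t / 3 < ‖Top T r₁ x‖ₑ} + volume {x | t / 3 < ‖Top T r₂ x‖ₑ}) +
        volume Ωs) + volume {x | x ∉ Ωs ∧ t / 3 < ‖Top T r₃ x‖ₑ}) := by
        gcongr
        refine (measure_mono_ae hsub).trans ((measure_union_le _ _).trans ?_)
        gcongr
        refine (measure_union_le _ _).trans ?_
        gcongr
        exact measure_union_le _ _
    _ ≤ 9 * 2 ^ n * ‖T‖ₑ ^ 2 * I + η + starC n * I + 6 * C₁ * I := by
        rw [mul_add, mul_add, mul_add]
        gcongr
    _ = _ := by ring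

end Weak

end CZ

end

noncomputable section

namespace CZ

variable {n : ℕ} {𝕜 : Type*} [RCLike 𝕜]

/-! ### Functions of bounded mean oscillation -/

/-- A dyadic form of `‖b‖_{BMO} ≤ B`. -/
structure BMOBound (b : Rn n → 𝕜) (B : ℝ) : Prop where
  locallyIntegrable : LocallyIntegrable b volume
  pos : 0 < B
  le : ∀ (κ : ℕ) (p : DIdx n), ∫⁻ y in dil κ p, ‖b y - ⨍ z in dil κ p, b z‖ₑ ≤
    ENNReal.ofReal B * volume (dil κ p)

lemma MemBMO.bmoBound {b : Rn n → 𝕜} (hb : MemBMO b) : BMOBound b ((bmoNorm b).toReal + 1) := by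
  refine ⟨hb.locallyIntegrable, by positivity, fun κ p => ?_⟩
  have hae := dil_ae_eq_cube κ p
  have h1 : ⨍ z in dil κ p, b z = ⨍ z in cube (corner κ p) (side p * (2 * κ + 1)), b z :=
    setAverage_congr hae
  rw [h1, setLIntegral_congr hae, measure_congr hae]
  set a := corner κ p
  set l := side p * (2 * κ + 1)
  have hl : 0 < l := mul_pos (side_pos p) (by positivity)
  have h2 : (volume (cube a l))⁻¹ * ∫⁻ y in cube a l, ‖b y - ⨍ z in cube a l, b z‖ₑ ≤
      bmoNorm b := by
    unfold bmoNorm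
    exact le_iSup_of_le a (le_iSup_of_le l (le_iSup_of_le hl le_rfl))
  have hv0 : volume (cube a l) ≠ 0 := by
    rw [← measure_congr hae]; exact volume_dil_ne_zero κ p
  have hvt : volume (cube a l) ≠ ∞ := by
    rw [← measure_congr hae]; exact volume_dil_ne_top κ p
  rw [mul_comm, ← div_eq_mul_inv, ENNReal.div_le_iff hv0 hvt] at h2
  refine h2.trans ?_
  gcongr
  calc bmoNorm b = ENNReal.ofReal (bmoNorm b).toReal :=
        (ENNReal.ofReal_toReal hb.bmoNorm_lt_top.ne).symm
    _ ≤ _ := ENNReal.ofReal_le_ofReal (by linarith)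

section BMO

variable {b : Rn n → 𝕜} {B : ℝ}

lemma isBounded_dq (p : DIdx n) : Bornology.IsBounded (dq p) := by
  rw [dq_eq_dil]; exact isBounded_dil 0 p

lemma integrableOn_of_isBounded (hb : LocallyIntegrable b volume) {s : Set (Rn n)}
    (hs : Bornology.IsBounded s) : IntegrableOn b s volume :=
  (hb.integrableOn_isCompact hs.isCompact_closure).mono_set subset_closure

/-- A small oscillation about `c` controls the distance from `c` to the average. -/
lemma enorm_setAverage_sub_mul_le (hb : LocallyIntegrable b volume) {s : Set (Rn n)}
    (hs : Bornology.IsBounded s) (h0 : volume s ≠ 0) (c : 𝕜) :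
    ‖(⨍ x in s, b x) - c‖ₑ * volume s ≤ ∫⁻ x in s, ‖b x - c‖ₑ := by
  have ht : volume s ≠ ∞ := hs.measure_lt_top.ne
  have h1 : (⨍ x in s, b x) - c = ⨍ x in s, (b x - c) := by
    rw [setAverage_eq, setAverage_eq, integral_sub (integrableOn_of_isBounded hb hs)
      (integrableOn_const (hs := ht)), smul_sub, setIntegral_const, smul_smul, Measure.real,
      inv_mul_cancel₀ (ENNReal.toReal_ne_zero.2 ⟨h0, ht⟩), one_smul]
  rw [h1]
  exact enorm_setAverage_mul_le _ h0 ht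

lemma dq_cb_subset {p : DIdx n} {x : Rn n} (hx : x ∈ dq p) {j : ℤ} (hj : p.1 ≤ j) :
    dq (cb j x) ⊆ dq p := by
  have := dq_subset_cb (mem_dq_cb j x) (i := p.1) hj
  rwa [mem_dq_iff.1 hx] at this

/-- The John–Nirenberg inequality on dyadic cubes. -/
lemma BMOBound.john_nirenberg (hb : BMOBound b B) (m : ℕ) : ∀ p : DIdx n,
    volume {x ∈ dq p | m * ENNReal.ofReal (2 ^ (n + 1) * B) < ‖b x - ⨍ z in dq p, b z‖ₑ} ≤
      2⁻¹ ^ m * volume (dq p) := by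
  have hB0 : ENNReal.ofReal B ≠ 0 := (ENNReal.ofReal_pos.2 hb.pos).ne'
  have hK : ENNReal.ofReal (2 ^ (n + 1) * B) = 2 ^ n * (2 * ENNReal.ofReal B) := by
    rw [ENNReal.ofReal_mul (by positivity), ENNReal.ofReal_pow (by norm_num)]
    simp [pow_succ, mul_assoc]
  induction m with
  | zero => intro p; simpa using measure_mono (Set.sep_subset _ _)
  | succ m ih =>
    intro p
    set c := ⨍ z in dq p, b z with hc
    set t : ℝ≥0∞ := 2 * ENNReal.ofReal B with ht
    have ht0 : t ≠ 0 := by simp [ht, hb.pos]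
    have htt : t ≠ ∞ := by simp [ht, ENNReal.mul_eq_top]
    have hle : ∫⁻ y in dq p, ‖b y - c‖ₑ ≤ ENNReal.ofReal B * volume (dq p) := by
      have := hb.le 0 p
      rwa [← dq_eq_dil, ← hc] at this
    set ν := (volume : Measure (Rn n)).withDensity fun x => ‖b x - c‖ₑ
    have hν : ∀ s, ν s = ∫⁻ y in s, ‖b y - c‖ₑ := fun s => withDensity_apply' _ s
    set Bad : DIdx n → Prop := fun q => dq q ⊆ dq p ∧ t * volume (dq q) < ν (dq q)
    have hnb : ∀ q : DIdx n, q.1 = p.1 → ¬ Bad q := by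
      rintro q hq ⟨h1, h2⟩
      obtain ⟨x, hx⟩ := dq_nonempty q
      obtain rfl : q = p := by rw [← mem_dq_iff.1 hx, ← mem_dq_iff.1 (h1 hx), hq]
      refine absurd h2 (not_lt.2 ?_)
      rw [hν]
      refine hle.trans ?_
      gcongr
      rw [ht, two_mul]; exact le_self_add
    set S := Stop p.1 Bad
    have hd : S.PairwiseDisjoint dq := pairwiseDisjoint_stop _ _
    have hSp : ⋃ q ∈ S, dq q ⊆ dq p := Set.iUnion₂_subset fun q hq => hq.2.1.1
    have hhalf : volume (⋃ q ∈ S, dq q) ≤ 2⁻¹ * volume (dq p) := by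
      have h1 : t * volume (⋃ q ∈ S, dq q) ≤ ν (⋃ q ∈ S, dq q) := by
        have := measure_biUnion_dq_le hd (ν := t • volume) (ρ := ν) fun q hq => by
          simpa using hq.2.1.2.le
        simpa using this
      have h2 : t * volume (⋃ q ∈ S, dq q) ≤ t * (2⁻¹ * volume (dq p)) := by
        refine h1.trans ((measure_mono hSp).trans ?_)
        rw [hν]
        refine hle.trans (le_of_eq ?_)
        rw [ht, ← mul_assoc, mul_right_comm 2, ENNReal.mul_inv_cancel (by norm_num) (by norm_num),
          one_mul]
      exact (ENNReal.mul_le_mul_iff_right ht0 htt).1 h2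
    have hoff : ∀ᵐ x ∂(volume : Measure (Rn n)), x ∈ dq p → x ∉ ⋃ q ∈ S, dq q →
        ‖b x - c‖ₑ ≤ t := by
      filter_upwards [ae_enorm_le_of_dyadic_average_le
        (hb.locallyIntegrable.sub (locallyIntegrable_const c))] with x hx hxp hxS
      refine hx t p.1 fun j hj => ?_
      have h1 := hν (dq (cb j x))
      simp only [Pi.sub_apply]
      rw [← h1]
      by_contra hcon
      obtain ⟨q, hq, hxq, -⟩ := exists_mem_stop (Bad := Bad) (x := x) hj
        ⟨dq_cb_subset hxp hj, not_le.1 hcon⟩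
      exact hxS (Set.mem_biUnion hq hxq)
    have havg : ∀ q ∈ S, ‖(⨍ z in dq q, b z) - c‖ₑ ≤ ENNReal.ofReal (2 ^ (n + 1) * B) := by
      intro q hq
      obtain ⟨x, hx⟩ := dq_nonempty q
      have hlt := level_lt_of_mem_stop hnb hq
      have h1 := not_bad_parent_of_mem_stop hnb hq hx
      have h2 : ν (dq (cb (q.1 - 1) x)) ≤ t * volume (dq (cb (q.1 - 1) x)) := by
        by_contra hcon
        exact h1 ⟨dq_cb_subset (hq.2.1.1 hx) (by omega), not_le.1 hcon⟩
      rw [hK]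
      refine (ENNReal.mul_le_mul_iff_left (volume_dq_ne_zero q) (volume_dq_ne_top q)).1 ?_
      calc _ ≤ ν (dq q) := by
            rw [hν]
            exact enorm_setAverage_sub_mul_le hb.locallyIntegrable (isBounded_dq q)
              (volume_dq_ne_zero q) c
        _ ≤ ν (dq (cb (q.1 - 1) x)) := measure_mono (dq_subset_cb hx (by omega))
        _ ≤ _ := h2.trans (le_of_eq (by rw [volume_cb_pred]; ring))
    set K := ENNReal.ofReal (2 ^ (n + 1) * B)
    have hsub : ({x ∈ dq p | ((m + 1 : ℕ) : ℝ≥0∞) * K < ‖b x - c‖ₑ} : Set (Rn n)) ≤ᵐ[volume]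
        ((⋃ q ∈ S, {x ∈ dq q | (m : ℝ≥0∞) * K < ‖b x - ⨍ z in dq q, b z‖ₑ}) : Set (Rn n)) := by
      filter_upwards [hoff] with x hx hxm
      obtain ⟨hxp, hxK⟩ : x ∈ dq p ∧ ((m + 1 : ℕ) : ℝ≥0∞) * K < ‖b x - c‖ₑ := hxm
      have hxS : x ∈ ⋃ q ∈ S, dq q := by
        by_contra hcon
        refine absurd (hx hxp hcon) (not_le.2 (lt_of_le_of_lt ?_ hxK))
        calc t ≤ 2 ^ n * t := le_mul_of_one_le_left zero_le (one_le_pow₀ (by norm_num))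
          _ = 1 * K := by rw [hK, one_mul]
          _ ≤ _ := by gcongr; push_cast; exact le_add_self
      obtain ⟨q, hq, hxq⟩ := Set.mem_iUnion₂.1 hxS
      refine Set.mem_biUnion hq ⟨hxq, ?_⟩
      by_contra hcon
      refine absurd hxK (not_lt.2 ?_)
      calc ‖b x - c‖ₑ = ‖(b x - ⨍ z in dq q, b z) + ((⨍ z in dq q, b z) - c)‖ₑ := by
            congr 1; ring
        _ ≤ _ := enorm_add_le _ _
        _ ≤ m * K + K := add_le_add (not_lt.1 hcon) (havg q hq)
        _ = _ := by push_cast; ring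
    calc _ ≤ _ := measure_mono_ae hsub
      _ ≤ ∑' q : S, volume {x ∈ dq (q : DIdx n) | (m : ℝ≥0∞) * K <
          ‖b x - ⨍ z in dq (q : DIdx n), b z‖ₑ} := measure_biUnion_le _ S.to_countable _
      _ ≤ ∑' q : S, 2⁻¹ ^ m * volume (dq (q : DIdx n)) := ENNReal.tsum_le_tsum fun q => ih q
      _ = 2⁻¹ ^ m * volume (⋃ q ∈ S, dq q) := by
          rw [ENNReal.tsum_mul_left, measure_biUnion_dq hd]
      _ ≤ 2⁻¹ ^ m * (2⁻¹ * volume (dq p)) := by gcongr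
      _ = _ := by rw [pow_succ, mul_assoc]

lemma exp_quarter_lt_two : Real.exp (1 / 4) < 2 := by
  rw [← Real.lt_log_iff_exp_lt (by norm_num)]
  linarith [Real.log_two_gt_d9]

/-- The constant in the exponential integrability of `BMO` functions. -/
def expC : ℝ≥0∞ := 1 + ∑' m : ℕ, ENNReal.ofReal (Real.exp ((m + 1) / 4)) * 2⁻¹ ^ m

lemma expC_ne_top : expC ≠ ∞ := by
  unfold expC
  refine ENNReal.add_ne_top.2 ⟨by norm_num, ?_⟩
  have : ∀ m : ℕ, ENNReal.ofReal (Real.exp ((m + 1) / 4)) * 2⁻¹ ^ m =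
      ENNReal.ofReal (Real.exp (1 / 4)) * (ENNReal.ofReal (Real.exp (1 / 4)) * 2⁻¹) ^ m := by
    intro m
    rw [mul_pow, ← mul_assoc, ← ENNReal.ofReal_pow (Real.exp_pos _).le, ← Real.exp_nat_mul,
      ← ENNReal.ofReal_mul (Real.exp_pos _).le, ← Real.exp_add]
    congr 3; ring
  simp only [this]
  rw [ENNReal.tsum_mul_left, ENNReal.tsum_geometric]
  refine ENNReal.mul_ne_top ENNReal.ofReal_ne_top (ENNReal.inv_ne_top.2 ?_)
  refine (tsub_pos_iff_lt.2 ?_).ne'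
  rw [← div_eq_mul_inv]
  refine (ENNReal.div_lt_iff (by norm_num) (by norm_num)).2 ?_
  rw [one_mul, show (2 : ℝ≥0∞) = ENNReal.ofReal 2 by simp]
  exact (ENNReal.ofReal_lt_ofReal_iff (by norm_num)).2 exp_quarter_lt_two

lemma ofReal_exp_le_tsum {v k : ℝ} (hk : 0 < k) (hv : 0 ≤ v) :
    ENNReal.ofReal (Real.exp (v / (4 * k))) ≤ 1 + ∑' m : ℕ,
      (if (m : ℝ≥0∞) * ENNReal.ofReal k < ENNReal.ofReal v then
        ENNReal.ofReal (Real.exp ((m + 1) / 4)) else 0) := by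
  rcases hv.eq_or_lt with rfl | hv
  · simp
  have hpos : 0 < v / k := by positivity
  have hceil : 0 < ⌈v / k⌉₊ := Nat.ceil_pos.2 hpos
  obtain ⟨m, hm⟩ := Nat.exists_eq_succ_of_ne_zero hceil.ne'
  have h1 : (m : ℝ) < v / k := by
    rw [← Nat.lt_ceil]; omega
  have h2 : v / k ≤ m + 1 := by
    have := Nat.le_ceil (v / k)
    rw [hm] at this
    exact_mod_cast this
  refine le_add_left (le_trans ?_ (ENNReal.le_tsum m))
  rw [if_pos]
  · refine ENNReal.ofReal_le_ofReal (Real.exp_le_exp.2 ?_)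
    calc v / (4 * k) = (v / k) / 4 := by field_simp
      _ ≤ _ := by gcongr
  · rw [← ENNReal.ofReal_natCast, ← ENNReal.ofReal_mul (by positivity)]
    refine (ENNReal.ofReal_lt_ofReal_iff hv).2 ?_
    rwa [lt_div_iff₀ hk] at h1

lemma BMOBound.lintegral_exp_dq_le (hb : BMOBound b B) (p : DIdx n) :
    ∫⁻ x in dq p, ENNReal.ofReal
      (Real.exp (‖b x - ⨍ z in dq p, b z‖ / (4 * (2 ^ (n + 1) * B)))) ≤ expC * volume (dq p) := by
  have hB := hb.pos
  set k := 2 ^ (n + 1) * B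
  set c := ⨍ z in dq p, b z
  have hmeas : AEStronglyMeasurable (fun x => b x - c) (volume.restrict (dq p)) :=
    (hb.locallyIntegrable.aestronglyMeasurable.sub aestronglyMeasurable_const).restrict
  have hns : ∀ m : ℕ, NullMeasurableSet {x | (m : ℝ≥0∞) * ENNReal.ofReal k < ‖b x - c‖ₑ}
      (volume.restrict (dq p)) := fun m =>
    nullMeasurableSet_lt aemeasurable_const hmeas.enorm
  calc _ ≤ ∫⁻ x in dq p, (1 + ∑' m : ℕ, {x | (m : ℝ≥0∞) * ENNReal.ofReal k < ‖b x - c‖ₑ}.indicator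
        (fun _ => ENNReal.ofReal (Real.exp ((m + 1) / 4))) x) := by
        refine lintegral_mono fun x => ?_
        refine (ofReal_exp_le_tsum (by positivity) (norm_nonneg _)).trans ?_
        simp only [ofReal_norm]
        gcongr with m
        simp only [Set.indicator_apply]
        rfl
    _ = volume (dq p) + ∑' m : ℕ, ENNReal.ofReal (Real.exp ((m + 1) / 4)) *
        volume {x ∈ dq p | m * ENNReal.ofReal k < ‖b x - c‖ₑ} := by
      rw [lintegral_add_left measurable_const, setLIntegral_one, lintegral_tsum]
      · congr 1
        refine tsum_congr fun m => ?_
        rw [lintegral_indicator_const₀ (hns m), Measure.restrict_apply' (measurableSet_dq p)]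
        congr 2
        ext x
        exact and_comm
      · exact fun m => (aemeasurable_const.indicator₀ (hns m))
    _ ≤ volume (dq p) + ∑' m : ℕ, ENNReal.ofReal (Real.exp ((m + 1) / 4)) *
        (2⁻¹ ^ m * volume (dq p)) := by
      gcongr with m
      exact hb.john_nirenberg m p
    _ = _ := by
      unfold expC
      rw [add_mul, one_mul, ← ENNReal.tsum_mul_right]
      simp only [mul_assoc]

end BMO

end CZ

end

noncomputable section

namespace CZ

variable {n : ℕ} {𝕜 : Type*} [RCLike 𝕜]

section BMO

variable {b : Rn n → 𝕜} {B : ℝ}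

/-- The average of `b` over the dilated cube. -/
def bstar (b : Rn n → 𝕜) (p : DIdx n) : 𝕜 := ⨍ z in star p, b z

lemma isBounded_star (p : DIdx n) : Bornology.IsBounded (star p) := isBounded_dil _ p

lemma BMOBound.lintegral_star_le (hb : BMOBound b B) (p : DIdx n) :
    ∫⁻ y in star p, ‖b y - bstar b p‖ₑ ≤ ENNReal.ofReal B * volume (star p) :=
  hb.le _ p

lemma star_eq_biUnion (p : DIdx n) : star p = ⋃ q ∈ nbr (2 * n + 1) p, dq q :=
  dil_eq_biUnion _ p

lemma dq_subset_star_of_mem_nbr {p q : DIdx n} (hq : q ∈ nbr (2 * n + 1) p) : dq q ⊆ star p := by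
  rw [star_eq_biUnion]
  exact Set.subset_biUnion_of_mem (u := fun q : DIdx n => dq q) hq

/-- Exponential integrability on the dilated cubes. -/
lemma BMOBound.lintegral_exp_star_le (hb : BMOBound b B) (p : DIdx n) :
    ∫⁻ x in star p, ENNReal.ofReal
      (Real.exp (‖b x - bstar b p‖ / (4 * (2 ^ (n + 1) * B)))) ≤
        ENNReal.ofReal (Real.exp (starC n).toReal) * expC * volume (star p) := by
  have hB := hb.pos
  set k := 2 ^ (n + 1) * B with hk
  have hkpos : 0 < k := by positivity
  have hdist : ∀ q ∈ nbr (2 * n + 1) p,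
      ‖(⨍ z in dq q, b z) - bstar b p‖ ≤ B * (starC n).toReal := by
    intro q hq
    have h1 : ‖(⨍ z in dq q, b z) - bstar b p‖ₑ * volume (dq q) ≤
        ENNReal.ofReal (B * (starC n).toReal) * volume (dq q) := by
      calc _ ≤ ∫⁻ x in dq q, ‖b x - bstar b p‖ₑ :=
            enorm_setAverage_sub_mul_le hb.locallyIntegrable (isBounded_dq q)
              (volume_dq_ne_zero q) _
        _ ≤ ∫⁻ x in star p, ‖b x - bstar b p‖ₑ :=
            lintegral_mono_set (dq_subset_star_of_mem_nbr hq)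
        _ ≤ ENNReal.ofReal B * volume (star p) := hb.lintegral_star_le p
        _ = _ := by
            rw [volume_star, ENNReal.ofReal_mul hB.le, ENNReal.ofReal_toReal starC_ne_top,
              volume_dq_congr (mem_nbr.1 hq).1, mul_assoc]
    have h2 := (ENNReal.mul_le_mul_iff_left (volume_dq_ne_zero q) (volume_dq_ne_top q)).1 h1
    rw [← ofReal_norm] at h2
    exact (ENNReal.ofReal_le_ofReal_iff (by positivity)).1 h2
  calc _ = ∑ q ∈ nbr (2 * n + 1) p, ∫⁻ x in dq q,
          ENNReal.ofReal (Real.exp (‖b x - bstar b p‖ / (4 * k))) := by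
        have := volume_dil_eq_sum (2 * n + 1) p (volume.withDensity fun x =>
          ENNReal.ofReal (Real.exp (‖b x - bstar b p‖ / (4 * k))))
        simp only [withDensity_apply'] at this
        exact this
    _ ≤ ∑ q ∈ nbr (2 * n + 1) p, ENNReal.ofReal (Real.exp (starC n).toReal) *
        (expC * volume (dq q)) := by
      refine Finset.sum_le_sum fun q hq => ?_
      calc _ ≤ ∫⁻ x in dq q, ENNReal.ofReal (Real.exp (starC n).toReal) * ENNReal.ofReal
              (Real.exp (‖b x - ⨍ z in dq q, b z‖ / (4 * k))) := by
            refine lintegral_mono fun x => ?_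
            rw [← ENNReal.ofReal_mul (Real.exp_pos _).le, ← Real.exp_add]
            refine ENNReal.ofReal_le_ofReal (Real.exp_le_exp.2 ?_)
            have h1 : ‖b x - bstar b p‖ ≤ ‖b x - ⨍ z in dq q, b z‖ + B * (starC n).toReal := by
              calc ‖b x - bstar b p‖ = ‖(b x - ⨍ z in dq q, b z) +
                    ((⨍ z in dq q, b z) - bstar b p)‖ := by congr 1; ring
                _ ≤ _ := norm_add_le _ _
                _ ≤ _ := by gcongr; exact hdist q hq
            have h2 : B * (starC n).toReal / (4 * k) ≤ (starC n).toReal := by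
              rw [div_le_iff₀ (by positivity), hk]
              have : (1 : ℝ) ≤ 2 ^ (n + 1) := one_le_pow₀ (by norm_num)
              have h3 : (0 : ℝ) ≤ (starC n).toReal := ENNReal.toReal_nonneg
              have h4 : (0 : ℝ) ≤ B * (starC n).toReal := by positivity
              nlinarith
            calc _ ≤ (‖b x - ⨍ z in dq q, b z‖ + B * (starC n).toReal) / (4 * k) := by gcongr
              _ = B * (starC n).toReal / (4 * k) + ‖b x - ⨍ z in dq q, b z‖ / (4 * k) := by ring
              _ ≤ _ := by gcongr
        _ = ENNReal.ofReal (Real.exp (starC n).toReal) * ∫⁻ x in dq q, ENNReal.ofReal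
              (Real.exp (‖b x - ⨍ z in dq q, b z‖ / (4 * k))) :=
            lintegral_const_mul' _ _ ENNReal.ofReal_ne_top
        _ ≤ _ := by gcongr; exact hb.lintegral_exp_dq_le q
    _ = _ := by
      rw [← Finset.mul_sum, ← Finset.mul_sum, star, ← volume_dil_eq_sum, mul_assoc]

lemma BMOBound.aestronglyMeasurable_sub (hb : BMOBound b B) (c : 𝕜) :
    AEStronglyMeasurable (fun x => b x - c) volume :=
  hb.locallyIntegrable.aestronglyMeasurable.sub aestronglyMeasurable_const

lemma BMOBound.memLp_indicator_star (hb : BMOBound b B) (p : DIdx n) :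
    MemLp ((star p).indicator fun x => b x - bstar b p) 2 volume := by
  have hB := hb.pos
  refine ⟨(hb.aestronglyMeasurable_sub _).indicator (measurableSet_star p), ?_⟩
  have h0 : eLpNorm ((star p).indicator fun x => b x - bstar b p) 2 volume ^ 2 < ∞ := by
    rw [eLpNorm_two_sq]
    have h1 : ∀ x, ‖(star p).indicator (fun x => b x - bstar b p) x‖ₑ ^ 2 =
        (star p).indicator (fun x => ‖b x - bstar b p‖ₑ ^ 2) x := by
      intro x
      by_cases hx : x ∈ star p <;> simp [hx]
    simp only [h1]
    rw [lintegral_indicator (measurableSet_star p)]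
    set k := 4 * (2 ^ (n + 1) * B)
    have hk : 0 < k := by positivity
    calc _ ≤ ∫⁻ x in star p, ENNReal.ofReal (2 * k ^ 2) *
          ENNReal.ofReal (Real.exp (‖b x - bstar b p‖ / k)) := by
          refine lintegral_mono fun x => ?_
          rw [← ofReal_norm, ← ENNReal.ofReal_pow (norm_nonneg _),
            ← ENNReal.ofReal_mul (by positivity)]
          refine ENNReal.ofReal_le_ofReal ?_
          have h2 := Real.quadratic_le_exp_of_nonneg (x := ‖b x - bstar b p‖ / k) (by positivity)
          have h3 : (‖b x - bstar b p‖ / k) ^ 2 ≤ 2 * Real.exp (‖b x - bstar b p‖ / k) := by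
            have : 0 ≤ ‖b x - bstar b p‖ / k := by positivity
            nlinarith
          calc ‖b x - bstar b p‖ ^ 2 = k ^ 2 * (‖b x - bstar b p‖ / k) ^ 2 := by field_simp
            _ ≤ k ^ 2 * (2 * Real.exp (‖b x - bstar b p‖ / k)) := by gcongr
            _ = _ := by ring
      _ = ENNReal.ofReal (2 * k ^ 2) * ∫⁻ x in star p,
          ENNReal.ofReal (Real.exp (‖b x - bstar b p‖ / k)) :=
          lintegral_const_mul' _ _ ENNReal.ofReal_ne_top
      _ ≤ ENNReal.ofReal (2 * k ^ 2) *
          (ENNReal.ofReal (Real.exp (starC n).toReal) * expC * volume (star p)) := by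
          gcongr
          exact hb.lintegral_exp_star_le p
      _ < ∞ := by
          have := expC_ne_top
          have := volume_star_ne_top p
          refine lt_top_iff_ne_top.2 ?_
          finiteness
  exact (ENNReal.pow_lt_top_iff.1 h0).resolve_right (by norm_num)

/-- The product of a `BMO` function with a bounded function supported in a dilated cube. -/
lemma BMOBound.memLp_mul (hb : BMOBound b B) {f : Rn n → 𝕜} (hf : MemLp f ∞ volume)
    (hf2 : MemLp f 2 volume) {p : DIdx n} (h0 : ∀ x, x ∉ star p → f x = 0) :
    MemLp (fun x => b x * f x) 2 volume := by
  have h1 : MemLp (fun x => (star p).indicator (fun x => b x - bstar b p) x * f x) 2 volume :=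
    hf.mul' (hb.memLp_indicator_star p)
  refine (h1.add (hf2.const_mul (bstar b p))).ae_eq (Filter.Eventually.of_forall fun x => ?_)
  by_cases hx : x ∈ star p
  · simp [hx]; ring
  · simp [h0 x hx]

end BMO

/-! ### The function `Φ` -/

lemma Phi_nonneg {t : ℝ} (ht : 0 ≤ t) : 0 ≤ Phi t :=
  mul_nonneg ht (by have := Real.posLog_nonneg (x := t); linarith)

lemma le_Phi {t : ℝ} (ht : 0 ≤ t) : t ≤ Phi t := by
  unfold Phi
  nlinarith [Real.posLog_nonneg (x := t), mul_nonneg ht (Real.posLog_nonneg (x := t))]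

lemma measurable_Phi : Measurable Phi := by
  have : Continuous Phi := by unfold Phi; fun_prop
  exact this.measurable

lemma Phi_mul_le {s t : ℝ} (hs : 0 ≤ s) (ht : 0 ≤ t) :
    Phi (s * t) ≤ s * (1 + Real.posLog s) * Phi t := by
  unfold Phi
  have h1 := Real.posLog_mul (x := s) (y := t)
  have h2 := Real.posLog_nonneg (x := s)
  have h3 := Real.posLog_nonneg (x := t)
  have h4 : 1 + Real.posLog (s * t) ≤ (1 + Real.posLog s) * (1 + Real.posLog t) := by nlinarith
  calc s * t * (1 + Real.posLog (s * t))
      ≤ s * t * ((1 + Real.posLog s) * (1 + Real.posLog t)) := by gcongr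
    _ = _ := by ring

lemma mul_le_Phi_add_exp {u v : ℝ} (hu : 0 ≤ u) : u * v ≤ Phi u + Real.exp v := by
  rcases hu.eq_or_lt with rfl | hu
  · simp [Phi, (Real.exp_pos v).le]
  have h1 := Real.add_one_le_exp (v - Real.log u)
  rw [Real.exp_sub, Real.exp_log hu, le_div_iff₀ hu] at h1
  have h2 : Real.log u ≤ Real.posLog u := le_max_right _ _
  unfold Phi
  nlinarith [mul_le_mul_of_nonneg_left h2 hu.le]

section BMO

variable {b : Rn n → 𝕜} {B : ℝ}

/-- The coefficient of the cube `p` in the sparse bound for the commutator. -/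
def coef (b f : Rn n → 𝕜) (p : DIdx n) : ℝ≥0∞ :=
  avg p (fun x => ‖f x‖ₑ) + avg p (fun x => ‖(b x - bstar b p) * f x‖ₑ)

/-- The generalized Hölder inequality for `BMO` and `L log L`. -/
lemma BMOBound.exists_coef_le (n : ℕ) {B : ℝ} (hB : 0 < B) :
    ∃ H : ℝ, 0 < H ∧ ∀ (b : Rn n → 𝕜), BMOBound b B → ∀ f : Rn n → 𝕜,
      ∀ (s : ℝ), 0 < s → ∀ p : DIdx n,
        avg p (fun x => ENNReal.ofReal (Phi (s * ‖f x‖))) ≤ 1 →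
        ENNReal.ofReal s * coef b f p ≤ ENNReal.ofReal H := by
  set k := 4 * (2 ^ (n + 1) * B)
  have hk : 0 < k := by positivity
  set E : ℝ≥0∞ := ENNReal.ofReal (Real.exp (starC n).toReal) * expC
  have hE : E ≠ ∞ := by have := expC_ne_top; finiteness
  refine ⟨1 + k * (1 + E.toReal), by positivity, ?_⟩
  intro b hb f s hs p h1
  have hV0 := volume_star_ne_zero p
  have hVt := volume_star_ne_top p
  have e1 : ENNReal.ofReal s * avg p (fun x => ‖f x‖ₑ) ≤ 1 := by
    refine le_trans ?_ h1
    unfold avg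
    rw [mul_left_comm, ← lintegral_const_mul' _ _ ENNReal.ofReal_ne_top]
    gcongr with x
    rw [← ofReal_norm, ← ENNReal.ofReal_mul hs.le]
    exact ENNReal.ofReal_le_ofReal (le_Phi (by positivity))
  have e2 : ENNReal.ofReal s * avg p (fun x => ‖(b x - bstar b p) * f x‖ₑ) ≤
      ENNReal.ofReal k * (1 + E) := by
    have h2 : ENNReal.ofReal s * ∫⁻ x in star p, ‖(b x - bstar b p) * f x‖ₑ ≤
        ENNReal.ofReal k * ((∫⁻ x in star p, ENNReal.ofReal (Phi (s * ‖f x‖))) +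
          ∫⁻ x in star p, ENNReal.ofReal (Real.exp (‖b x - bstar b p‖ / k))) := by
      rw [← lintegral_const_mul' _ _ ENNReal.ofReal_ne_top, ← lintegral_add_right',
        ← lintegral_const_mul' _ _ ENNReal.ofReal_ne_top]
      · refine lintegral_mono fun x => ?_
        rw [← ofReal_norm, ← ENNReal.ofReal_mul hs.le, norm_mul,
          ← ENNReal.ofReal_add (Phi_nonneg (by positivity)) (Real.exp_pos _).le,
          ← ENNReal.ofReal_mul hk.le]
        refine ENNReal.ofReal_le_ofReal ?_
        have h3 := mul_le_Phi_add_exp (u := s * ‖f x‖) (v := ‖b x - bstar b p‖ / k)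
          (by positivity)
        calc s * (‖b x - bstar b p‖ * ‖f x‖) = k * (s * ‖f x‖ * (‖b x - bstar b p‖ / k)) := by
              field_simp
          _ ≤ _ := by gcongr
      · refine AEMeasurable.ennreal_ofReal ?_
        refine Real.measurable_exp.comp_aemeasurable ?_
        exact ((hb.aestronglyMeasurable_sub (bstar b p)).restrict.norm.aemeasurable.div_const k)
    unfold avg
    rw [mul_left_comm]
    calc _ ≤ (volume (star p))⁻¹ * (ENNReal.ofReal k * (1 * volume (star p) +
          E * volume (star p))) := by
          refine mul_le_mul_right (h2.trans ?_) _
          gcongr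
          · exact avg_le_iff.1 h1
          · exact hb.lintegral_exp_star_le p
      _ = ENNReal.ofReal k * (1 + E) * ((volume (star p))⁻¹ * volume (star p)) := by ring
      _ = _ := by rw [ENNReal.inv_mul_cancel hV0 hVt, mul_one]
  unfold coef
  rw [mul_add]
  refine (add_le_add e1 e2).trans (le_of_eq ?_)
  rw [ENNReal.ofReal_add (by norm_num) (by positivity), ENNReal.ofReal_mul hk.le,
    ENNReal.ofReal_add (by norm_num) (by positivity), ENNReal.ofReal_toReal hE, ENNReal.ofReal_one]

end BMO

end CZ

end

noncomputable section

namespace CZ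

variable {n : ℕ} {𝕜 : Type*} [RCLike 𝕜]

/-! ### Exceptional sets -/

section Local

variable {K : Rn n → Rn n → 𝕜}
  {T : Lp 𝕜 2 (volume : Measure (Rn n)) →L[𝕜] Lp 𝕜 2 (volume : Measure (Rn n))}

lemma Top_ae_eq_zero {h : Rn n → 𝕜} (he : h =ᵐ[volume] fun _ => 0) :
    Top T h =ᵐ[volume] fun _ => 0 := by
  have h0 : MemLp (fun _ : Rn n => (0 : 𝕜)) 2 volume := MemLp.zero'
  rw [← Top_congr h0 he.symm]
  simpa using Top_const_mul (T := T) (0 : 𝕜) h0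

lemma lintegral_enorm_indicator (g : Rn n → 𝕜) {s : Set (Rn n)} (hs : MeasurableSet s) :
    ∫⁻ x, ‖s.indicator g x‖ₑ = ∫⁻ x in s, ‖g x‖ₑ := by
  simp only [enorm_indicator_eq_indicator_enorm]
  exact lintegral_indicator hs _

lemma volume_le_of_mul_le {α η m C : ℝ≥0∞} {p : DIdx n} {A : Set (Rn n)} (hm0 : m ≠ 0)
    (hmt : m ≠ ∞) (hη : η ≠ 0) (hηt : η ≠ ∞) (hα : α = (C + 1) * starC n * η⁻¹) (hC : C ≠ ∞)
    (h : α * m * volume A ≤ C * (volume (star p) * m)) : volume A ≤ η * volume (dq p) := by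
  have hc0 : (C + 1) * starC n * m ≠ 0 :=
    mul_ne_zero (mul_ne_zero (by simp) starC_ne_zero) hm0
  have hct : (C + 1) * starC n * m ≠ ∞ := by
    have := starC_ne_top (n := n); finiteness
  refine (ENNReal.mul_le_mul_iff_right hc0 hct).1 ?_
  calc (C + 1) * starC n * m * volume A
      = η * (α * m * volume A) := by
        rw [hα]
        calc _ = (η * η⁻¹) * ((C + 1) * starC n * m * volume A) := by
              rw [ENNReal.mul_inv_cancel hη hηt, one_mul]
          _ = _ := by ring
    _ ≤ η * (C * (volume (star p) * m)) := by gcongr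
    _ ≤ η * ((C + 1) * (volume (star p) * m)) := by gcongr; exact le_self_add
    _ = _ := by rw [volume_star]; ring

lemma exists_Mstar_exceptional (hn : 1 ≤ n) {η : ℝ≥0∞} (hη : η ≠ 0) (hηt : η ≠ ∞) :
    ∃ α : ℝ≥0∞, α ≠ ∞ ∧ ∀ (p : DIdx n) (H : Rn n → ℝ≥0∞),
      volume {x | α * avg p H < Mstar ((star p).indicator H) x} ≤ η * volume (dq p) := by
  refine ⟨(starC n + 1) * starC n * η⁻¹, ?_, fun p H => ?_⟩
  · have := starC_ne_top (n := n)
    have := ENNReal.inv_ne_top.2 hη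
    finiteness
  set α := (starC n + 1) * starC n * η⁻¹ with hα
  have hα0 : α ≠ 0 := mul_ne_zero (mul_ne_zero (by simp) starC_ne_zero) (ENNReal.inv_ne_zero.2 hηt)
  have hint : ∫⁻ x, (star p).indicator H x = volume (star p) * avg p H := by
    rw [lintegral_indicator (measurableSet_star p), volume_mul_avg]
  rcases eq_or_ne (avg p H) 0 with h0 | h0
  · have : {x | α * avg p H < Mstar ((star p).indicator H) x} = ∅ := by
      ext x
      simp only [Set.mem_ofPred_eq, Set.mem_empty_iff_false, iff_false, not_lt]
      refine iSup_le fun j => ?_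
      rw [avg_le_iff]
      calc _ ≤ ∫⁻ x, (star p).indicator H x := setLIntegral_le_lintegral _ _
        _ = 0 := by rw [hint, h0, mul_zero]
        _ ≤ _ := zero_le
    rw [this]; simp
  rcases eq_or_ne (avg p H) ∞ with ht | ht
  · have : {x | α * avg p H < Mstar ((star p).indicator H) x} = ∅ := by
      rw [ht, ENNReal.mul_top hα0]; simp
    rw [this]; simp
  refine volume_le_of_mul_le h0 ht hη hηt hα starC_ne_top ?_
  rw [← hint]
  exact mul_volume_Mstar_gt_le hn _ _

lemma Represents.exists_exceptional (hn : 1 ≤ n) (hr : Represents K T) (hK : IsStandardKernel K)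
    {η : ℝ≥0∞} (hη : η ≠ 0) (hηt : η ≠ ∞) :
    ∃ α : ℝ≥0∞, α ≠ ∞ ∧ ∀ (p : DIdx n) (g : Rn n → 𝕜), MemLp g 2 volume →
      volume {x | α * avg p (fun x => ‖g x‖ₑ) < ‖Top T ((star p).indicator g) x‖ₑ} ≤
        η * volume (dq p) := by
  obtain ⟨C, hC, hw⟩ := hr.exists_weak_type hn hK
  refine ⟨(C + 1) * starC n * η⁻¹, ?_, fun p g hg => ?_⟩
  · have := starC_ne_top (n := n)
    have := ENNReal.inv_ne_top.2 hη
    finiteness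
  set α := (C + 1) * starC n * η⁻¹ with hα
  have hα0 : α ≠ 0 := mul_ne_zero (mul_ne_zero (by simp) starC_ne_zero) (ENNReal.inv_ne_zero.2 hηt)
  have hint : ∫⁻ x, ‖(star p).indicator g x‖ₑ = volume (star p) * avg p (fun x => ‖g x‖ₑ) := by
    rw [lintegral_enorm_indicator g (measurableSet_star p), volume_mul_avg]
  have hgi : MemLp ((star p).indicator g) 2 volume := hg.indicator (measurableSet_star p)
  rcases eq_or_ne (avg p (fun x => ‖g x‖ₑ)) 0 with h0 | h0
  · rw [h0, mul_zero] at hint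
    have h1 := (lintegral_eq_zero_iff' hgi.aestronglyMeasurable.enorm).1 hint
    have h2 : (star p).indicator g =ᵐ[volume] fun _ => 0 := by
      filter_upwards [h1] with x hx
      simpa using hx
    have h3 : volume {x | α * avg p (fun x => ‖g x‖ₑ) < ‖Top T ((star p).indicator g) x‖ₑ} = 0 := by
      rw [h0, mul_zero]
      refine measure_mono_null ?_ (ae_iff.1 (Top_ae_eq_zero (T := T) h2))
      intro x hx h
      have hx' : 0 < ‖Top T ((star p).indicator g) x‖ₑ := hx
      rw [h, enorm_zero] at hx'
      exact lt_irrefl _ hx'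
    rw [h3]; exact zero_le
  rcases eq_or_ne (avg p (fun x => ‖g x‖ₑ)) ∞ with ht | ht
  · have : {x | α * avg p (fun x => ‖g x‖ₑ) < ‖Top T ((star p).indicator g) x‖ₑ} = ∅ := by
      rw [ht, ENNReal.mul_top hα0]; simp
    rw [this]; simp
  refine volume_le_of_mul_le h0 ht hη hηt hα hC ?_
  rw [← hint]
  exact hw _ hgi _

lemma exists_notMem_of_volume_lt {p : DIdx n} {s : Set (Rn n)}
    (h : volume (dq p ∩ s) < volume (dq p)) : ∃ x ∈ dq p, x ∉ s := by
  by_contra hcon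
  push Not at hcon
  rw [Set.inter_eq_left.2 hcon] at h
  exact lt_irrefl _ h

/-- Localization of `T`: away from a small exceptional set, and relative to subcubes that are mostly
outside that set, `T` is controlled by the average over the dilated cube. -/
lemma Represents.exists_localization (hn : 1 ≤ n) (hr : Represents K T) (hK : IsStandardKernel K)
    {η : ℝ≥0∞} (hη : η ≠ 0) (hηt : η ≠ ∞) :
    ∃ C : ℝ≥0∞, C ≠ ∞ ∧ ∀ (p : DIdx n) (g : Rn n → 𝕜), MemLp g 2 volume →
      ∃ E : Set (Rn n), MeasurableSet E ∧ volume E ≤ η * volume (dq p) ∧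
        (∀ x, x ∉ E → ‖Top T ((star p).indicator g) x‖ₑ ≤ C * avg p fun x => ‖g x‖ₑ) ∧
        ∀ q : DIdx n, dq q ⊆ dq p → volume (dq q ∩ E) ≤ 4⁻¹ * volume (dq q) →
          ∀ᵐ x ∂volume, x ∈ dq q →
            ‖Top T ((star p \ star q).indicator g) x‖ₑ ≤ C * avg p fun x => ‖g x‖ₑ := by
  obtain ⟨α₁, hα₁, h₁⟩ := hr.exists_exceptional hn hK (η := η / 2)
    (ENNReal.div_ne_zero.2 ⟨hη, by norm_num⟩) (ENNReal.div_ne_top hηt (by norm_num))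
  obtain ⟨α₂, hα₂, h₂⟩ := exists_Mstar_exceptional hn (η := η / 2)
    (ENNReal.div_ne_zero.2 ⟨hη, by norm_num⟩) (ENNReal.div_ne_top hηt (by norm_num))
  obtain ⟨α₃, hα₃, h₃⟩ := hr.exists_exceptional hn hK (η := 4⁻¹) (by norm_num) (by norm_num)
  obtain ⟨C₀, hC₀, hosc⟩ := hr.exists_oscillation_le hK
  refine ⟨α₁ + α₃ * α₂ + C₀ * α₂, by finiteness, ?_⟩
  intro p g hg
  set m := avg p fun x => ‖g x‖ₑ with hm
  set H : Rn n → ℝ≥0∞ := (star p).indicator fun x => ‖g x‖ₑ with hH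
  set E := toMeasurable volume ({x | α₁ * m < ‖Top T ((star p).indicator g) x‖ₑ} ∪
    {x | α₂ * m < Mstar H x})
  have hE1 : ∀ x, x ∉ E → ‖Top T ((star p).indicator g) x‖ₑ ≤ α₁ * m := fun x hx =>
    not_lt.1 fun h => hx (subset_toMeasurable _ _ (Or.inl h))
  have hE2 : ∀ x, x ∉ E → Mstar H x ≤ α₂ * m := fun x hx =>
    not_lt.1 fun h => hx (subset_toMeasurable _ _ (Or.inr h))
  refine ⟨E, measurableSet_toMeasurable _ _, ?_, fun x hx => (hE1 x hx).trans ?_, ?_⟩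
  · rw [measure_toMeasurable]
    calc _ ≤ _ := measure_union_le _ _
      _ ≤ η / 2 * volume (dq p) + η / 2 * volume (dq p) := add_le_add (h₁ p g hg) (h₂ p _)
      _ = _ := by rw [← add_mul, ENNReal.add_halves]
  · gcongr
    rw [add_assoc]; exact le_self_add
  intro q hqp hqE
  have hss : star q ⊆ star p := star_subset_star hn hqp
  have hmd : MeasurableSet (star p \ star q) := (measurableSet_star p).diff (measurableSet_star q)
  set h := (star p \ star q).indicator g with hh
  have hhm : MemLp h 2 volume := hg.indicator hmd
  obtain ⟨G, hG1, hG2⟩ := hosc q (star p) h hhm (isBounded_star p)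
    (fun x hx => Set.indicator_of_notMem (fun h => hx h.1) _)
    (fun x hx => Set.indicator_of_notMem (fun h => h.2 hx) _)
  have hdec : (star p).indicator g = fun x => h x + (star q).indicator g x := by
    funext x
    by_cases hxq : x ∈ star q
    · simp [hh, hxq, hss hxq]
    · by_cases hxp : x ∈ star p <;> simp [hh, hxq, hxp]
  have hTdec := Top_add (T := T) hhm (hg.indicator (measurableSet_star q))
  rw [← hdec] at hTdec
  set A := {x | α₃ * avg q (fun x => ‖g x‖ₑ) < ‖Top T ((star q).indicator g) x‖ₑ}
  set N := {x | ¬ ((x ∈ dq q → Top T h x = G x) ∧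
    Top T ((star p).indicator g) x = Top T h x + Top T ((star q).indicator g) x)}
  have hN : volume N = 0 := ae_iff.1 (hG1.and hTdec)
  obtain ⟨x', hx'q, hx'⟩ : ∃ x ∈ dq q, x ∉ E ∪ A ∪ N := by
    refine exists_notMem_of_volume_lt ?_
    have hv : volume (dq q ∩ (E ∪ A ∪ N)) ≤ 2⁻¹ * volume (dq q) := by
      calc _ ≤ volume ((dq q ∩ E ∪ A) ∪ N) := by
            refine measure_mono ?_
            rintro x ⟨hx, (hx1 | hx1) | hx1⟩
            · exact Or.inl (Or.inl ⟨hx, hx1⟩)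
            · exact Or.inl (Or.inr hx1)
            · exact Or.inr hx1
        _ ≤ volume (dq q ∩ E) + volume A + volume N :=
            (measure_union_le _ _).trans (by gcongr; exact measure_union_le _ _)
        _ ≤ 4⁻¹ * volume (dq q) + 4⁻¹ * volume (dq q) + 0 := by
            gcongr
            · exact h₃ q g hg
            · exact hN.le
        _ = 2⁻¹ * volume (dq q) := by
            rw [add_zero, ← add_mul]
            congr 1
            rw [← two_mul, show (4 : ℝ≥0∞) = 2 * 2 by norm_num,
              ENNReal.mul_inv (by norm_num) (by norm_num), ← mul_assoc,
              ENNReal.mul_inv_cancel (by norm_num) (by norm_num), one_mul]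
    refine hv.trans_lt ?_
    calc 2⁻¹ * volume (dq q) < 1 * volume (dq q) := by
          refine ENNReal.mul_lt_mul_left (volume_dq_ne_zero q) (volume_dq_ne_top q) ?_
          exact ENNReal.inv_lt_one.2 (by norm_num)
      _ = _ := one_mul _
  have hxE : x' ∉ E := fun h => hx' (Or.inl (Or.inl h))
  have hxA : ‖Top T ((star q).indicator g) x'‖ₑ ≤ α₃ * avg q (fun x => ‖g x‖ₑ) :=
    not_lt.1 fun h => hx' (Or.inl (Or.inr h))
  have hxN : (x' ∈ dq q → Top T h x' = G x') ∧
      Top T ((star p).indicator g) x' = Top T h x' + Top T ((star q).indicator g) x' := by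
    by_contra hcon; exact hx' (Or.inr hcon)
  have havg : avg q (fun x => ‖g x‖ₑ) ≤ α₂ * m := by
    refine le_trans ?_ (hE2 x' hxE)
    refine le_trans (le_of_eq ?_) (avg_le_Mstar hx'q)
    unfold avg
    congr 1
    refine setLIntegral_congr_fun (measurableSet_star q) fun x hx => ?_
    simp [hH, hss hx]
  have hMh : Mstar (fun y => ‖h y‖ₑ) x' ≤ α₂ * m := by
    refine le_trans (iSup_mono fun j => ?_) (hE2 x' hxE)
    unfold avg
    gcongr with y
    simp only [hh, hH, enorm_indicator_eq_indicator_enorm]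
    exact Set.indicator_le_indicator_of_subset Set.sdiff_subset (fun _ => zero_le) y
  have hGx' : ‖G x'‖ₑ ≤ α₁ * m + α₃ * (α₂ * m) := by
    have h1 : G x' = Top T ((star p).indicator g) x' - Top T ((star q).indicator g) x' := by
      rw [hxN.2, ← hxN.1 hx'q]; ring
    rw [h1]
    refine enorm_sub_le.trans (add_le_add (hE1 x' hxE) (hxA.trans ?_))
    gcongr
  filter_upwards [hG1] with x hx hxq
  rw [hx hxq]
  calc ‖G x‖ₑ = ‖G x' + (G x - G x')‖ₑ := by congr 1; ring
    _ ≤ ‖G x'‖ₑ + ‖G x - G x'‖ₑ := enorm_add_le _ _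
    _ ≤ (α₁ * m + α₃ * (α₂ * m)) + C₀ * (α₂ * m) := by
      refine add_le_add hGx' ((hG2 x hxq x' hx'q).trans ?_)
      gcongr
    _ = _ := by ring

end Local

end CZ

end

noncomputable section

namespace CZ

variable {n : ℕ} {𝕜 : Type*} [RCLike 𝕜]

/-! ### One step of the sparse domination -/

section Local

variable {K : Rn n → Rn n → 𝕜}
  {T : Lp 𝕜 2 (volume : Measure (Rn n)) →L[𝕜] Lp 𝕜 2 (volume : Measure (Rn n))}
  {b : Rn n → 𝕜} {B : ℝ}

/-- Localization of a `BMO` function. -/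
lemma BMOBound.exists_localization (hn : 1 ≤ n) {B : ℝ} {η : ℝ≥0∞} (hη : η ≠ 0) (hηt : η ≠ ∞) :
    ∃ C : ℝ≥0∞, C ≠ ∞ ∧ ∀ (b : Rn n → 𝕜), BMOBound b B → ∀ p : DIdx n,
      ∃ E : Set (Rn n), MeasurableSet E ∧ volume E ≤ η * volume (dq p) ∧
        (∀ᵐ x ∂volume, x ∈ dq p → x ∉ E → ‖b x - bstar b p‖ₑ ≤ C) ∧
        ∀ q : DIdx n, dq q ⊆ dq p → volume (dq q ∩ E) ≤ 4⁻¹ * volume (dq q) →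
          ‖bstar b q - bstar b p‖ₑ ≤ C := by
  obtain ⟨α, hα, h⟩ := exists_Mstar_exceptional hn hη hηt
  have hsC := starC_ne_top (n := n)
  refine ⟨α * ENNReal.ofReal B * starC n, by finiteness, ?_⟩
  intro b hb p
  set H : Rn n → ℝ≥0∞ := (star p).indicator fun x => ‖b x - bstar b p‖ₑ with hH
  set E := toMeasurable volume {x | α * avg p (fun x => ‖b x - bstar b p‖ₑ) < Mstar H x}
  have hM : ∀ x, x ∉ E → Mstar H x ≤ α * ENNReal.ofReal B := by
    intro x hx
    have h1 : Mstar H x ≤ α * avg p (fun x => ‖b x - bstar b p‖ₑ) :=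
      not_lt.1 fun h => hx (subset_toMeasurable _ _ h)
    refine h1.trans ?_
    gcongr
    exact avg_le_iff.2 (hb.lintegral_star_le p)
  have hint : ∀ (q : DIdx n) (x : Rn n), star q ⊆ star p → x ∈ dq q → x ∉ E →
      ∫⁻ y in star q, ‖b y - bstar b p‖ₑ ≤ α * ENNReal.ofReal B * volume (star q) := by
    intro q x hq hx hxE
    have h1 := avg_le_iff.1 ((avg_le_Mstar hx).trans (hM x hxE))
    refine le_trans (le_of_eq ?_) h1
    refine setLIntegral_congr_fun (measurableSet_star q) fun y hy => ?_
    simp [hH, hq hy]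
  refine ⟨E, measurableSet_toMeasurable _ _, ?_, ?_, ?_⟩
  · rw [measure_toMeasurable]; exact h p _
  · filter_upwards [ae_enorm_le_of_dyadic_average_le
      (hb.locallyIntegrable.sub (locallyIntegrable_const (bstar b p)))] with x hx hxp hxE
    refine hx _ p.1 fun j hj => ?_
    have hsub := star_subset_star hn (dq_cb_subset hxp hj)
    calc _ ≤ ∫⁻ y in star (cb j x), ‖b y - bstar b p‖ₑ := lintegral_mono_set (dq_subset_star _)
      _ ≤ α * ENNReal.ofReal B * volume (star (cb j x)) := hint _ x hsub (mem_dq_cb _ _) hxE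
      _ = _ := by rw [volume_star]; ring
  · intro q hqp hqE
    obtain ⟨x, hxq, hxE⟩ : ∃ x ∈ dq q, x ∉ E := by
      refine exists_notMem_of_volume_lt (hqE.trans_lt ?_)
      calc 4⁻¹ * volume (dq q) < 1 * volume (dq q) := by
            refine ENNReal.mul_lt_mul_left (volume_dq_ne_zero q) (volume_dq_ne_top q) ?_
            exact ENNReal.inv_lt_one.2 (by norm_num)
        _ = _ := one_mul _
    have h1 := (enorm_setAverage_sub_mul_le hb.locallyIntegrable (isBounded_star q)
      (volume_star_ne_zero q) (bstar b p)).trans (hint q x (star_subset_star hn hqp) hxq hxE)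
    have h2 := (ENNReal.mul_le_mul_iff_left (volume_star_ne_zero q) (volume_star_ne_top q)).1 h1
    refine h2.trans ?_
    exact le_mul_of_one_le_right zero_le one_le_starC

/-- The commutator of `T` with `b` applied to the restriction of `f` to `star p`. -/
def locComm (T : Lp 𝕜 2 (volume : Measure (Rn n)) →L[𝕜] Lp 𝕜 2 (volume : Measure (Rn n)))
    (b f : Rn n → 𝕜) (p : DIdx n) (x : Rn n) : 𝕜 :=
  b x * Top T ((star p).indicator f) x - Top T ((star p).indicator fun x => b x * f x) x

lemma Top_indicator_sub_const {f : Rn n → 𝕜} (hf : MemLp f 2 volume)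
    (hbf : MemLp (fun x => b x * f x) 2 volume) (c : 𝕜) {s : Set (Rn n)} (hs : MeasurableSet s) :
    ∀ᵐ x ∂volume, b x * Top T (s.indicator f) x - Top T (s.indicator fun x => b x * f x) x =
      (b x - c) * Top T (s.indicator f) x - Top T (s.indicator fun x => (b x - c) * f x) x := by
  have h1 : MemLp (fun x => (b x - c) * f x) 2 volume := by
    refine (hbf.sub (hf.const_mul c)).ae_eq (Filter.Eventually.of_forall fun x => ?_)
    simp [sub_mul]
  have h2 : (s.indicator fun x => b x * f x) =
      fun x => s.indicator (fun x => (b x - c) * f x) x + c * s.indicator f x := by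
    funext x
    by_cases hx : x ∈ s
    · simp [hx]; ring
    · simp [hx]
  have h3 := Top_add (T := T) (h1.indicator hs) ((hf.indicator hs).const_mul c)
  filter_upwards [h3, Top_const_mul (T := T) c (hf.indicator hs)] with x hx1 hx2
  rw [h2, hx1, hx2]
  ring

/-- One step of the sparse domination of the commutator. -/
lemma Represents.exists_children (hn : 1 ≤ n) (hr : Represents K T) (hK : IsStandardKernel K)
    (B : ℝ) : ∃ C : ℝ≥0∞, C ≠ ∞ ∧ ∀ (b f : Rn n → 𝕜), BMOBound b B → MemLp f 2 volume →
      MemLp (fun x => b x * f x) 2 volume → ∀ p : DIdx n, ∃ ch : Set (DIdx n),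
        (∀ q ∈ ch, dq q ⊆ dq p) ∧ ch.PairwiseDisjoint dq ∧
        volume (⋃ q ∈ ch, dq q) ≤ 2⁻¹ * volume (dq p) ∧
        (∀ᵐ x ∂volume, x ∈ dq p → x ∉ ⋃ q ∈ ch, dq q →
          ‖locComm T b f p x‖ₑ ≤ C * coef b f p ∧ ‖b x - bstar b p‖ₑ ≤ C) ∧
        ∀ q ∈ ch, ‖bstar b q - bstar b p‖ₑ ≤ C ∧ ∀ᵐ x ∂volume, x ∈ dq q →
          ‖locComm T b f p x‖ₑ ≤
            ‖locComm T b f q x‖ₑ + C * (1 + ‖b x - bstar b p‖ₑ) * coef b f p := by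
  set θ : ℝ≥0∞ := (2 ^ (n + 2))⁻¹ with hθ
  have h2n : (2 : ℝ≥0∞) ^ (n + 2) ≠ 0 := by positivity
  have h2nt : (2 : ℝ≥0∞) ^ (n + 2) ≠ ∞ := by finiteness
  have hθ0 : θ ≠ 0 := ENNReal.inv_ne_zero.2 h2nt
  have hθt : θ ≠ ∞ := ENNReal.inv_ne_top.2 h2n
  have hη : θ / 8 ≠ 0 := ENNReal.div_ne_zero.2 ⟨hθ0, by norm_num⟩
  have hηt : θ / 8 ≠ ∞ := ENNReal.div_ne_top hθt (by norm_num)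
  obtain ⟨C₁, hC₁, hloc⟩ := hr.exists_localization hn hK hη hηt
  obtain ⟨C₂, hC₂, hbloc⟩ := BMOBound.exists_localization (𝕜 := 𝕜) hn (B := B) hη hηt
  refine ⟨(C₂ + 1) * (C₁ + 1), by finiteness, ?_⟩
  have hCC₂ : C₂ ≤ (C₂ + 1) * (C₁ + 1) :=
    le_self_add.trans (le_mul_of_one_le_right zero_le le_add_self)
  have hCC₁ : C₁ ≤ (C₂ + 1) * (C₁ + 1) :=
    le_self_add.trans (le_mul_of_one_le_left zero_le le_add_self)
  intro b f hb hf hbf p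
  set β := bstar b p with hβ
  have hg : MemLp (fun x => (b x - β) * f x) 2 volume := by
    refine (hbf.sub (hf.const_mul β)).ae_eq (Filter.Eventually.of_forall fun x => ?_)
    simp [sub_mul]
  obtain ⟨E₁, hE₁m, hE₁v, hE₁a, hE₁b⟩ := hloc p f hf
  obtain ⟨E₂, hE₂m, hE₂v, hE₂a, hE₂b⟩ := hloc p _ hg
  obtain ⟨E₃, hE₃m, hE₃v, hE₃a, hE₃b⟩ := hbloc b hb p
  set E := E₁ ∪ E₂ ∪ E₃
  have hEm : MeasurableSet E := (hE₁m.union hE₂m).union hE₃m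
  have hEv : volume E ≤ θ / 2 * volume (dq p) := by
    calc volume E ≤ volume E₁ + volume E₂ + volume E₃ :=
          (measure_union_le _ _).trans (by gcongr; exact measure_union_le _ _)
      _ ≤ θ / 8 * volume (dq p) + θ / 8 * volume (dq p) + θ / 8 * volume (dq p) := by gcongr
      _ ≤ θ / 8 * volume (dq p) + θ / 8 * volume (dq p) + θ / 8 * volume (dq p) +
          θ / 8 * volume (dq p) := le_self_add
      _ = 4 * (θ / 8) * volume (dq p) := by ring
      _ = θ / 2 * volume (dq p) := by
          congr 1
          rw [show (8 : ℝ≥0∞) = 4 * 2 by norm_num, ← ENNReal.mul_div_mul_left θ 2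
            (show (4 : ℝ≥0∞) ≠ 0 by norm_num) (by norm_num), mul_div_assoc]
  set Bad : DIdx n → Prop := fun q => dq q ⊆ dq p ∧ θ * volume (dq q) < volume (dq q ∩ E)
  have hnb : ∀ q : DIdx n, q.1 = p.1 → ¬ Bad q := by
    rintro q hq ⟨h1, h2⟩
    obtain ⟨x, hx⟩ := dq_nonempty q
    obtain rfl : q = p := by rw [← mem_dq_iff.1 hx, ← mem_dq_iff.1 (h1 hx), hq]
    refine absurd h2 (not_lt.2 ?_)
    refine (measure_mono Set.inter_subset_right).trans (hEv.trans ?_)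
    gcongr
    exact ENNReal.half_le_self
  set S := Stop p.1 Bad
  have hd : S.PairwiseDisjoint dq := pairwiseDisjoint_stop _ _
  have hSE : ∀ q ∈ S, ∀ E' ⊆ E, volume (dq q ∩ E') ≤ 4⁻¹ * volume (dq q) := by
    intro q hq E' hE'
    obtain ⟨x, hx⟩ := dq_nonempty q
    have hlt := level_lt_of_mem_stop hnb hq
    have h1 := not_bad_parent_of_mem_stop hnb hq hx
    have h2 : volume (dq (cb (q.1 - 1) x) ∩ E) ≤ θ * volume (dq (cb (q.1 - 1) x)) := by
      by_contra hcon
      exact h1 ⟨dq_cb_subset (hq.2.1.1 hx) (by omega), not_le.1 hcon⟩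
    calc volume (dq q ∩ E') ≤ volume (dq (cb (q.1 - 1) x) ∩ E) :=
          measure_mono (Set.inter_subset_inter (dq_subset_cb hx (by omega)) hE')
      _ ≤ θ * (2 ^ n * volume (dq q)) := by rw [← volume_cb_pred q x]; exact h2
      _ = 4⁻¹ * volume (dq q) := by
          rw [← mul_assoc]
          congr 1
          rw [hθ, pow_add, ENNReal.mul_inv (by simp) (by simp), mul_right_comm,
            ENNReal.inv_mul_cancel (by positivity) (by finiteness), one_mul]
          norm_num
  refine ⟨S, fun q hq => hq.2.1.1, hd, ?_, ?_, ?_⟩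
  · have h1 : θ * volume (⋃ q ∈ S, dq q) ≤ volume E := by
      have := measure_biUnion_dq_le hd (ν := θ • volume) (ρ := volume.restrict E) fun q hq => by
        rw [Measure.restrict_apply (measurableSet_dq q)]
        simpa using hq.2.1.2.le
      rw [Measure.restrict_apply (measurableSet_biUnion_dq S)] at this
      exact le_trans (by simpa using this) (measure_mono Set.inter_subset_right)
    refine (ENNReal.mul_le_mul_iff_right hθ0 hθt).1 (h1.trans (hEv.trans (le_of_eq ?_)))
    rw [← mul_assoc, div_eq_mul_inv]
  · have hEint : LocallyIntegrable (E.indicator fun _ => (1 : ℝ)) volume := by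
      refine Integrable.locallyIntegrable ?_
      rw [integrable_indicator_iff hEm]
      refine integrableOn_const ?_
      have := volume_dq_ne_top p
      exact ne_top_of_le_ne_top (by finiteness) hEv
    have hES : ∀ᵐ x ∂(volume : Measure (Rn n)), x ∈ dq p → x ∉ ⋃ q ∈ S, dq q → x ∉ E := by
      filter_upwards [ae_enorm_le_of_dyadic_average_le hEint] with x hx hxp hxS hxE
      have h1 : ‖E.indicator (fun _ => (1 : ℝ)) x‖ₑ ≤ θ := by
        refine hx θ p.1 fun j hj => ?_
        by_contra hcon
        have h2 : ∫⁻ y in dq (cb j x), ‖E.indicator (fun _ => (1 : ℝ)) y‖ₑ =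
            volume (dq (cb j x) ∩ E) := by
          simp only [enorm_indicator_eq_indicator_enorm, enorm_one]
          rw [lintegral_indicator_const hEm, one_mul,
            Measure.restrict_apply hEm, Set.inter_comm]
        rw [h2] at hcon
        obtain ⟨q, hq, hxq, -⟩ := exists_mem_stop (Bad := Bad) (x := x) hj
          ⟨dq_cb_subset hxp hj, not_le.1 hcon⟩
        exact hxS (Set.mem_biUnion hq hxq)
      rw [Set.indicator_of_mem hxE, enorm_one] at h1
      refine absurd h1 (not_le.2 ?_)
      exact ENNReal.inv_lt_one.2 (one_lt_pow₀ (by norm_num) (by omega))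
    filter_upwards [hES, hE₃a, Top_indicator_sub_const (T := T) hf hbf β (measurableSet_star p)]
      with x hx hx3 hxc hxp hxS
    have hxE := hx hxp hxS
    have hb3 := hx3 hxp fun h => hxE (Or.inr h)
    refine ⟨?_, hb3.trans hCC₂⟩
    unfold locComm
    rw [hxc]
    calc _ ≤ ‖b x - β‖ₑ * ‖Top T ((star p).indicator f) x‖ₑ +
          ‖Top T ((star p).indicator fun x => (b x - β) * f x) x‖ₑ := by
          rw [← enorm_mul]; exact enorm_sub_le
      _ ≤ C₂ * (C₁ * avg p fun x => ‖f x‖ₑ) + C₁ * avg p fun x => ‖(b x - β) * f x‖ₑ := by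
          gcongr
          · exact hE₁a x fun h => hxE (Or.inl (Or.inl h))
          · exact hE₂a x fun h => hxE (Or.inl (Or.inr h))
      _ ≤ (C₂ + 1) * (C₁ + 1) * (avg p fun x => ‖f x‖ₑ) +
          (C₂ + 1) * (C₁ + 1) * avg p fun x => ‖(b x - β) * f x‖ₑ := by
          rw [← mul_assoc]
          gcongr <;> exact le_self_add
      _ = _ := by rw [← mul_add]; rfl
  · intro q hq
    have hqp := hq.2.1.1
    refine ⟨(hE₃b q hqp (hSE q hq E₃ Set.subset_union_right)).trans hCC₂, ?_⟩
    have hss : star q ⊆ star p := star_subset_star hn hqp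
    have hmd : MeasurableSet (star p \ star q) := (measurableSet_star p).diff (measurableSet_star q)
    have hsplit : ∀ u : Rn n → 𝕜, (star p).indicator u =
        fun x => (star p \ star q).indicator u x + (star q).indicator u x := by
      intro u
      funext x
      by_cases hxq : x ∈ star q
      · simp [hxq, hss hxq]
      · by_cases hxp : x ∈ star p <;> simp [hxq, hxp]
    have hT1 := Top_add (T := T) (hf.indicator hmd) (hf.indicator (measurableSet_star q))
    have hT2 := Top_add (T := T) (hbf.indicator hmd) (hbf.indicator (measurableSet_star q))
    rw [← hsplit] at hT1 hT2
    filter_upwards [hT1, hT2, Top_indicator_sub_const (T := T) hf hbf β hmd,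
      hE₁b q hqp (hSE q hq E₁ (Set.subset_union_left.trans Set.subset_union_left)),
      hE₂b q hqp (hSE q hq E₂ (Set.subset_union_right.trans Set.subset_union_left))]
      with x h1 h2 h3 h4 h5 hxq
    have hid : locComm T b f p x = locComm T b f q x +
        ((b x - β) * Top T ((star p \ star q).indicator f) x -
          Top T ((star p \ star q).indicator fun x => (b x - β) * f x) x) := by
      rw [← h3]
      unfold locComm
      rw [h1, h2]
      ring
    rw [hid]
    refine (enorm_add_le _ _).trans ?_
    gcongr
    calc _ ≤ ‖b x - β‖ₑ * ‖Top T ((star p \ star q).indicator f) x‖ₑ +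
          ‖Top T ((star p \ star q).indicator fun x => (b x - β) * f x) x‖ₑ := by
          rw [← enorm_mul]; exact enorm_sub_le
      _ ≤ ‖b x - β‖ₑ * (C₁ * avg p fun x => ‖f x‖ₑ) +
          C₁ * avg p fun x => ‖(b x - β) * f x‖ₑ := by
          gcongr
          · exact h4 hxq
          · exact h5 hxq
      _ ≤ (1 + ‖b x - β‖ₑ) * (C₁ * avg p fun x => ‖f x‖ₑ) +
          (1 + ‖b x - β‖ₑ) * (C₁ * avg p fun x => ‖(b x - β) * f x‖ₑ) := by
          exact add_le_add (mul_le_mul_left le_add_self _)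
            (le_mul_of_one_le_left zero_le le_self_add)
      _ = C₁ * (1 + ‖b x - β‖ₑ) * coef b f p := by unfold coef; ring
      _ ≤ _ := by gcongr

end Local

end CZ

end

noncomputable section

namespace CZ

variable {n : ℕ} {𝕜 : Type*} [RCLike 𝕜]

/-! ### Sparse trees of dyadic cubes -/

/-- The union of the cubes of generation `j`. -/
def layer (D : ℕ → Set (DIdx n)) (j : ℕ) : Set (Rn n) := ⋃ p ∈ D j, dq p

/-- Generations of dyadic cubes, each of which refines the preceding one and covers at most half
of each of its cubes. -/
structure SparseTree (D : ℕ → Set (DIdx n)) : Prop where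
  pairwiseDisjoint : ∀ j, (D j).PairwiseDisjoint dq
  exists_parent : ∀ j, ∀ q ∈ D (j + 1), ∃ p ∈ D j, dq q ⊆ dq p
  volume_inter_le : ∀ j, ∀ p ∈ D j, volume (dq p ∩ layer D (j + 1)) ≤ 2⁻¹ * volume (dq p)

/-- The number of generations from the `j`-th on that cover `x`. -/
def overlap (D : ℕ → Set (DIdx n)) (j : ℕ) (x : Rn n) : ℝ≥0∞ :=
  ∑' i, (layer D (j + i)).indicator 1 x

/-- The value of `a` at the cube of generation `j` that contains `x`. -/
def layerVal (D : ℕ → Set (DIdx n)) (a : DIdx n → ℝ≥0∞) (j : ℕ) (x : Rn n) : ℝ≥0∞ :=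
  ∑' p : D j, (dq (p : DIdx n)).indicator (fun _ => a p) x

/-- The part of the sparse operator with coefficients `a` that comes from the generations from the
`j`-th on. -/
def sparseSum (D : ℕ → Set (DIdx n)) (a : DIdx n → ℝ≥0∞) (j : ℕ) (x : Rn n) : ℝ≥0∞ :=
  ∑' i, layerVal D a (j + i) x * overlap D (j + i) x

section Tree

variable {D : ℕ → Set (DIdx n)} {a : DIdx n → ℝ≥0∞}

lemma measurableSet_layer (D : ℕ → Set (DIdx n)) (j : ℕ) : MeasurableSet (layer D j) :=
  measurableSet_biUnion_dq _

lemma dq_subset_layer {j : ℕ} {p : DIdx n} (hp : p ∈ D j) : dq p ⊆ layer D j :=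
  Set.subset_biUnion_of_mem (u := fun q : DIdx n => dq q) hp

lemma mem_layer {j : ℕ} {x : Rn n} : x ∈ layer D j ↔ ∃ p ∈ D j, x ∈ dq p := by simp [layer]

lemma measurable_overlap (D : ℕ → Set (DIdx n)) (j : ℕ) : Measurable (overlap D j) :=
  Measurable.tsum fun i => measurable_one.indicator (measurableSet_layer D (j + i))

lemma measurable_layerVal (D : ℕ → Set (DIdx n)) (a : DIdx n → ℝ≥0∞) (j : ℕ) :
    Measurable (layerVal D a j) :=
  Measurable.tsum fun p => measurable_const.indicator (measurableSet_dq (p : DIdx n))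

lemma measurable_sparseSum (D : ℕ → Set (DIdx n)) (a : DIdx n → ℝ≥0∞) (j : ℕ) :
    Measurable (sparseSum D a j) :=
  Measurable.tsum fun i =>
    (measurable_layerVal D a (j + i)).mul (measurable_overlap D (j + i))

lemma overlap_eq (D : ℕ → Set (DIdx n)) (j : ℕ) (x : Rn n) :
    overlap D j x = (layer D j).indicator 1 x + overlap D (j + 1) x := by
  unfold overlap
  rw [tsum_eq_zero_add' ENNReal.summable]
  congr 2
  funext i
  rw [show j + (i + 1) = j + 1 + i by ring]

lemma sparseSum_eq (D : ℕ → Set (DIdx n)) (a : DIdx n → ℝ≥0∞) (j : ℕ) (x : Rn n) :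
    sparseSum D a j x = layerVal D a j x * overlap D j x + sparseSum D a (j + 1) x := by
  unfold sparseSum
  rw [tsum_eq_zero_add' ENNReal.summable]
  congr 2
  funext i
  rw [show j + (i + 1) = j + 1 + i by ring]

lemma le_layerVal {j : ℕ} {p : DIdx n} (hp : p ∈ D j) {x : Rn n} (hx : x ∈ dq p) :
    a p ≤ layerVal D a j x := by
  have := ENNReal.le_tsum (f := fun p : D j => (dq (p : DIdx n)).indicator (fun _ => a p) x) ⟨p, hp⟩
  simpa [hx, layerVal] using this

namespace SparseTree

lemma eq_of_mem (h : SparseTree D) {j : ℕ} {p q : DIdx n} (hp : p ∈ D j) (hq : q ∈ D j) {x : Rn n}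
    (hxp : x ∈ dq p) (hxq : x ∈ dq q) : p = q := by
  by_contra hne
  exact Set.disjoint_left.1 (h.pairwiseDisjoint j hp hq hne) hxp hxq

lemma layerVal_eq (h : SparseTree D) {j : ℕ} {p : DIdx n} (hp : p ∈ D j) {x : Rn n}
    (hx : x ∈ dq p) : layerVal D a j x = a p := by
  unfold layerVal
  rw [tsum_eq_single (⟨p, hp⟩ : D j)]
  · simp [hx]
  · rintro ⟨q, hq⟩ hne
    refine Set.indicator_of_notMem (fun hxq => hne ?_) _
    exact Subtype.ext (h.eq_of_mem hq hp hxq hx)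

lemma layer_succ_subset (h : SparseTree D) (j : ℕ) : layer D (j + 1) ⊆ layer D j := by
  intro x hx
  obtain ⟨q, hq, hxq⟩ := mem_layer.1 hx
  obtain ⟨p, hp, hqp⟩ := h.exists_parent j q hq
  exact mem_layer.2 ⟨p, hp, hqp hxq⟩

lemma antitone_layer (h : SparseTree D) : Antitone (layer D) :=
  antitone_nat_of_succ_le h.layer_succ_subset

lemma exists_ancestor (h : SparseTree D) (j m : ℕ) {q : DIdx n} (hq : q ∈ D (j + m)) :
    ∃ p ∈ D j, dq q ⊆ dq p := by
  induction m generalizing q with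
  | zero => exact ⟨q, hq, subset_rfl⟩
  | succ m ih =>
    obtain ⟨p, hp, hqp⟩ := h.exists_parent (j + m) q hq
    obtain ⟨p', hp', hpp⟩ := ih hp
    exact ⟨p', hp', hqp.trans hpp⟩

lemma dq_inter_layer (h : SparseTree D) (j m : ℕ) {p : DIdx n} (hp : p ∈ D j) :
    dq p ∩ layer D (j + m) = ⋃ q ∈ {q | q ∈ D (j + m) ∧ dq q ⊆ dq p}, dq q := by
  ext x
  simp only [Set.mem_inter_iff, mem_layer, Set.mem_iUnion, Set.mem_ofPred_eq, exists_prop]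
  constructor
  · rintro ⟨hxp, q, hq, hxq⟩
    obtain ⟨p', hp', hqp⟩ := h.exists_ancestor j m hq
    obtain rfl := h.eq_of_mem hp hp' hxp (hqp hxq)
    exact ⟨q, ⟨hq, hqp⟩, hxq⟩
  · rintro ⟨q, ⟨hq, hqp⟩, hxq⟩
    exact ⟨hqp hxq, q, hq, hxq⟩

/-- Geometric decay of the generations for a measure that charges a fixed proportion of the part
of each cube outside of the next generation. -/
lemma measure_inter_layer_le (h : SparseTree D) {ω : Measure (Rn n)} {θ : ℝ≥0∞}
    (hω : ∀ j, ∀ p ∈ D j, ω (dq p ∩ layer D (j + 1)) ≤ θ * ω (dq p)) (j m : ℕ) {p : DIdx n}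
    (hp : p ∈ D j) : ω (dq p ∩ layer D (j + m)) ≤ θ ^ m * ω (dq p) := by
  induction m with
  | zero => simpa using measure_mono Set.inter_subset_left
  | succ m ih =>
    have hd : {q | q ∈ D (j + m) ∧ dq q ⊆ dq p}.PairwiseDisjoint dq :=
      (h.pairwiseDisjoint (j + m)).subset fun q hq => hq.1
    have h1 := measure_biUnion_dq_le hd (ν := ω.restrict (layer D (j + m + 1))) (ρ := θ • ω)
      fun q hq => by
        rw [Measure.restrict_apply (measurableSet_dq q)]
        simpa using hω (j + m) q hq.1
    rw [← h.dq_inter_layer j m hp, Measure.restrict_apply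
      ((measurableSet_dq p).inter (measurableSet_layer D _))] at h1
    calc ω (dq p ∩ layer D (j + (m + 1)))
        ≤ ω (dq p ∩ layer D (j + m) ∩ layer D (j + m + 1)) :=
          measure_mono fun x hx => ⟨⟨hx.1, h.layer_succ_subset _ hx.2⟩, hx.2⟩
      _ ≤ θ * ω (dq p ∩ layer D (j + m)) := by simpa using h1
      _ ≤ θ * (θ ^ m * ω (dq p)) := by gcongr
      _ = _ := by ring

end SparseTree

end Tree

section Domination

variable {T : Lp 𝕜 2 (volume : Measure (Rn n)) →L[𝕜] Lp 𝕜 2 (volume : Measure (Rn n))}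
  {b f : Rn n → 𝕜}

/-- The generations generated by a choice of children. -/
def generation (ch : DIdx n → Set (DIdx n)) (p : DIdx n) : ℕ → Set (DIdx n)
  | 0 => {p}
  | j + 1 => ⋃ q ∈ generation ch p j, ch q

lemma sparseTree_generation {ch : DIdx n → Set (DIdx n)} (hsub : ∀ p, ∀ q ∈ ch p, dq q ⊆ dq p)
    (hd : ∀ p, (ch p).PairwiseDisjoint dq)
    (hv : ∀ p, volume (⋃ q ∈ ch p, dq q) ≤ 2⁻¹ * volume (dq p)) (p : DIdx n) :
    SparseTree (generation ch p) := by
  have hdis : ∀ j, (generation ch p j).PairwiseDisjoint dq := by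
    intro j
    induction j with
    | zero => exact Set.pairwiseDisjoint_singleton _ _
    | succ j ih =>
      intro q hq q' hq' hne
      obtain ⟨r, hr, hqr⟩ := Set.mem_iUnion₂.1 hq
      obtain ⟨r', hr', hqr'⟩ := Set.mem_iUnion₂.1 hq'
      by_cases hrr : r = r'
      · subst hrr; exact hd r hqr hqr' hne
      · exact (ih hr hr' hrr).mono (hsub r q hqr) (hsub r' q' hqr')
  refine ⟨hdis, ?_, ?_⟩
  · intro j q hq
    obtain ⟨r, hr, hqr⟩ := Set.mem_iUnion₂.1 hq
    exact ⟨r, hr, hsub r q hqr⟩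
  · intro j r hr
    refine le_trans (measure_mono ?_) (hv r)
    rintro x ⟨hxr, hx⟩
    obtain ⟨q, hq, hxq⟩ := mem_layer.1 hx
    obtain ⟨r', hr', hqr⟩ := Set.mem_iUnion₂.1 hq
    have : r = r' := by
      by_contra hne
      exact Set.disjoint_left.1 (hdis j hr hr' hne) hxr (hsub r' q hqr hxq)
    subst this
    exact Set.mem_biUnion hqr hxq

/-- Sparse domination of the commutator. -/
lemma Represents.exists_sparse_domination {K : Rn n → Rn n → 𝕜} (hn : 1 ≤ n)
    (hr : Represents K T) (hK : IsStandardKernel K) (B : ℝ) :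
    ∃ C : ℝ≥0∞, C ≠ ∞ ∧ ∀ (b f : Rn n → 𝕜), BMOBound b B → MemLp f 2 volume →
      MemLp (fun x => b x * f x) 2 volume → ∀ p : DIdx n, ∃ D : ℕ → Set (DIdx n),
        D 0 = {p} ∧ SparseTree D ∧ ∀ᵐ x ∂volume, x ∈ dq p →
          ‖locComm T b f p x‖ₑ ≤ C * sparseSum D (coef b f) 0 x := by
  obtain ⟨C, hC, h⟩ := hr.exists_children hn hK B
  refine ⟨C * (1 + C), by finiteness, fun b f hb hf hbf p₀ => ?_⟩
  choose ch hsub hd hv hout hin using h b f hb hf hbf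
  have htree := sparseTree_generation hsub hd hv p₀
  obtain ⟨D, hD⟩ : ∃ D, D = generation ch p₀ := ⟨_, rfl⟩
  rw [← hD] at htree
  have hmemD : ∀ j q, q ∈ D (j + 1) ↔ ∃ p ∈ D j, q ∈ ch p := by
    intro j q; rw [hD]; simp [generation]
  have hD0 : D 0 = {p₀} := by rw [hD]; rfl
  refine ⟨D, hD0, htree, ?_⟩
  have hnull : volume (⋂ j, layer D j) = 0 := by
    have h1 : ∀ m, volume (⋂ j, layer D j) ≤ 2⁻¹ ^ m * volume (dq p₀) := by
      intro m
      refine le_trans (measure_mono fun x hx => ?_) (htree.measure_inter_layer_le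
        htree.volume_inter_le 0 m (p := p₀) (by simp [hD0]))
      rw [Set.mem_iInter] at hx
      have h0 := hx 0
      simp only [layer, hD0, Set.mem_singleton_iff, Set.iUnion_iUnion_eq_left] at h0
      exact ⟨h0, hx _⟩
    have h2 : Filter.Tendsto (fun m : ℕ => (2⁻¹ : ℝ≥0∞) ^ m * volume (dq p₀)) Filter.atTop
        (nhds (0 * volume (dq p₀))) :=
      ENNReal.Tendsto.mul_const (ENNReal.tendsto_pow_atTop_nhds_zero_of_lt_one
        (ENNReal.inv_lt_one.2 (by norm_num))) (Or.inr (volume_dq_ne_top p₀))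
    rw [zero_mul] at h2
    exact le_antisymm (ge_of_tendsto' h2 h1) zero_le
  have hnull' : ∀ᵐ x ∂(volume : Measure (Rn n)), x ∉ ⋂ j, layer D j :=
    measure_eq_zero_iff_ae_notMem.1 hnull
  have hout' := ae_all_iff.2 hout
  have hin' : ∀ᵐ x ∂(volume : Measure (Rn n)), ∀ p q, q ∈ ch p → x ∈ dq q →
      ‖locComm T b f p x‖ₑ ≤
        ‖locComm T b f q x‖ₑ + C * (1 + ‖b x - bstar b p‖ₑ) * coef b f p := by
    refine ae_all_iff.2 fun p => ae_all_iff.2 fun q => ?_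
    by_cases hq : q ∈ ch p
    · filter_upwards [(hin p q hq).2] with x hx _ using hx
    · exact Filter.Eventually.of_forall fun x h => absurd h hq
  filter_upwards [hnull', hout', hin'] with x hx1 hx2 hx3 hxp₀
  have key : ∀ m j p, p ∈ D j → x ∈ dq p → x ∉ layer D (j + m + 1) →
      ‖b x - bstar b p‖ₑ ≤ C * overlap D j x ∧
      ‖locComm T b f p x‖ₑ ≤ C * (1 + C) * sparseSum D (coef b f) j x := by
    have hbase : ∀ j p, p ∈ D j → x ∈ dq p → x ∉ layer D (j + 1) →
        ‖b x - bstar b p‖ₑ ≤ C * overlap D j x ∧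
        ‖locComm T b f p x‖ₑ ≤ C * (1 + C) * sparseSum D (coef b f) j x := by
      intro j p hp hxp hxm
      have hov : 1 ≤ overlap D j x := by
        rw [overlap_eq, Set.indicator_of_mem (dq_subset_layer hp hxp)]
        exact le_self_add
      have h1 := hx2 p hxp fun hc => by
        obtain ⟨q, hq, hxq⟩ := Set.mem_iUnion₂.1 hc
        exact hxm (mem_layer.2 ⟨q, (hmemD j q).2 ⟨p, hp, hq⟩, hxq⟩)
      refine ⟨h1.2.trans (le_mul_of_one_le_right zero_le hov), h1.1.trans ?_⟩
      rw [sparseSum_eq]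
      calc C * coef b f p ≤ C * (1 + C) * (layerVal D (coef b f) j x * overlap D j x) := by
            refine mul_le_mul' (le_mul_of_one_le_right zero_le le_self_add) ?_
            exact (le_layerVal hp hxp).trans (le_mul_of_one_le_right zero_le hov)
        _ ≤ _ := by gcongr; exact le_self_add
    intro m
    induction m with
    | zero => exact hbase
    | succ m ih =>
      intro j p hp hxp hxm
      by_cases hx : x ∈ layer D (j + 1)
      swap
      · exact hbase j p hp hxp hx
      obtain ⟨q, hq, hxq⟩ := mem_layer.1 hx
      obtain ⟨p', hp', hqp'⟩ := (hmemD j q).1 hq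
      obtain rfl := htree.eq_of_mem hp hp' hxp (hsub p' q hqp' hxq)
      have h1 := ih (j + 1) q hq hxq (by rwa [show j + 1 + m + 1 = j + (m + 1) + 1 by ring])
      have hov : overlap D j x = 1 + overlap D (j + 1) x := by
        rw [overlap_eq, Set.indicator_of_mem (dq_subset_layer hp hxp), Pi.one_apply]
      have hb1 : ‖b x - bstar b p‖ₑ ≤ C * overlap D j x := by
        calc ‖b x - bstar b p‖ₑ = ‖(bstar b q - bstar b p) + (b x - bstar b q)‖ₑ := by
              congr 1; ring
          _ ≤ ‖bstar b q - bstar b p‖ₑ + ‖b x - bstar b q‖ₑ := enorm_add_le _ _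
          _ ≤ C + C * overlap D (j + 1) x := add_le_add (hin p q hqp').1 h1.1
          _ = _ := by rw [hov]; ring
      refine ⟨hb1, (hx3 p q hqp' hxq).trans ?_⟩
      rw [sparseSum_eq, mul_add (C * (1 + C)), add_comm]
      refine add_le_add ?_ h1.2
      rw [mul_assoc, mul_assoc C]
      refine mul_le_mul_right ?_ C
      calc (1 + ‖b x - bstar b p‖ₑ) * coef b f p
          ≤ ((1 + C) * overlap D j x) * layerVal D (coef b f) j x := by
            refine mul_le_mul' ?_ (le_layerVal hp hxp)
            rw [add_mul, one_mul]
            refine add_le_add ?_ hb1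
            rw [hov]; exact le_self_add
        _ = _ := by ring
  rw [Set.mem_iInter, not_forall] at hx1
  obtain ⟨m, hm⟩ := hx1
  exact (key m 0 p₀ (by simp [hD0]) hxp₀ fun h => hm (htree.antitone_layer (by omega) h)).2

end Domination

end CZ

end

noncomputable section

namespace CZ

variable {n : ℕ} {𝕜 : Type*} [RCLike 𝕜]

/-! ### Sparse trees and `A₁` weights -/

/-- The measure with density `w`. -/
def wm (w : Rn n → ℝ) : Measure (Rn n) := volume.withDensity fun x => ENNReal.ofReal (w x)

/-- A measurable weight with the `A₁` condition on the dilated dyadic cubes. -/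
structure StarA1 (w : Rn n → ℝ) (c : ℝ) : Prop where
  measurable : Measurable w
  nonneg : ∀ x, 0 ≤ w x
  locallyIntegrable : LocallyIntegrable w volume
  one_le : 1 ≤ c
  le : ∀ p : DIdx n, ∀ᵐ x ∂volume, x ∈ star p →
    avg p (fun x => ENNReal.ofReal (w x)) ≤ ENNReal.ofReal c * ENNReal.ofReal (w x)

/-- A bound for `w(Q) / w(Q \ E)`, for `E` covering at most half of the cube `Q`. -/
def sparseRatio (n : ℕ) (c : ℝ) : ℝ≥0∞ := 2 * starC n * ENNReal.ofReal c

section Weighted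

variable {D : ℕ → Set (DIdx n)} {w : Rn n → ℝ} {c : ℝ}

lemma wm_apply (w : Rn n → ℝ) {s : Set (Rn n)} (hs : MeasurableSet s) :
    wm w s = ∫⁻ x in s, ENNReal.ofReal (w x) := withDensity_apply _ hs

lemma StarA1.wm_star_ne_top (h : StarA1 w c) (p : DIdx n) : wm w (star p) ≠ ∞ := by
  rw [wm_apply w (measurableSet_star p)]
  have h1 : IntegrableOn w (star p) volume :=
    (h.locallyIntegrable.integrableOn_isCompact (isBounded_star p).isCompact_closure).mono_set
      subset_closure
  exact h1.lintegral_lt_top.ne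

lemma StarA1.wm_dq_ne_top (h : StarA1 w c) (p : DIdx n) : wm w (dq p) ≠ ∞ :=
  ne_top_of_le_ne_top (h.wm_star_ne_top p) (measure_mono (dq_subset_star p))

lemma wm_star_eq (w : Rn n → ℝ) (p : DIdx n) :
    wm w (star p) = starC n * volume (dq p) * avg p (fun x => ENNReal.ofReal (w x)) := by
  rw [wm_apply w (measurableSet_star p), ← volume_mul_avg, volume_star]

lemma StarA1.avg_ne_top (h : StarA1 w c) (p : DIdx n) :
    avg p (fun x => ENNReal.ofReal (w x)) ≠ ∞ := by
  rw [avg, ← wm_apply w (measurableSet_star p)]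
  exact ENNReal.mul_ne_top (ENNReal.inv_ne_top.2 (volume_star_ne_zero p)) (h.wm_star_ne_top p)

lemma sparseRatio_ne_top : sparseRatio n c ≠ ∞ := by
  have := starC_ne_top (n := n)
  unfold sparseRatio
  finiteness

lemma StarA1.one_le_sparseRatio (h : StarA1 w c) : 1 ≤ sparseRatio n c := by
  unfold sparseRatio
  refine one_le_mul (one_le_mul (by norm_num) one_le_starC) ?_
  rw [← ENNReal.ofReal_one]
  exact ENNReal.ofReal_le_ofReal h.one_le

lemma SparseTree.volume_le_sdiff (hD : SparseTree D) {j : ℕ} {p : DIdx n} (hp : p ∈ D j) :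
    volume (dq p) ≤ 2 * volume (dq p \ layer D (j + 1)) := by
  have hLm := measurableSet_layer D (j + 1)
  have h1 := measure_inter_add_sdiff (μ := (volume : Measure (Rn n))) (dq p) hLm
  have h2 := hD.volume_inter_le j p hp
  have h3 : volume (dq p) ≤ 2⁻¹ * volume (dq p) + volume (dq p \ layer D (j + 1)) := by
    calc _ = _ := h1.symm
      _ ≤ _ := by gcongr
  have h4 : 2⁻¹ * volume (dq p) ≤ volume (dq p \ layer D (j + 1)) := by
    have h5 : volume (dq p) = 2⁻¹ * volume (dq p) + 2⁻¹ * volume (dq p) := by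
      rw [← add_mul, ENNReal.inv_two_add_inv_two, one_mul]
    have h6 : 2⁻¹ * volume (dq p) ≠ ∞ := ENNReal.mul_ne_top (by simp) (volume_dq_ne_top p)
    exact (ENNReal.add_le_add_iff_left h6).1 (h5.symm.le.trans h3)
  calc volume (dq p) = 2 * (2⁻¹ * volume (dq p)) := by
        rw [← mul_assoc, ENNReal.mul_inv_cancel (by norm_num) (by norm_num), one_mul]
    _ ≤ _ := by gcongr

lemma SparseTree.wm_inter_layer_le (hD : SparseTree D) (h : StarA1 w c) (j : ℕ) (p : DIdx n)
    (hp : p ∈ D j) :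
    wm w (dq p ∩ layer D (j + 1)) ≤ (1 - (sparseRatio n c)⁻¹) * wm w (dq p) := by
  set A := avg p (fun x => ENNReal.ofReal (w x)) with hA
  set E := dq p \ layer D (j + 1) with hE
  have hLm := measurableSet_layer D (j + 1)
  have hEm : MeasurableSet E := (measurableSet_dq p).diff hLm
  have hfin := h.wm_dq_ne_top p
  have hvol : volume (dq p) ≤ 2 * volume E := hD.volume_le_sdiff hp
  have hAE : A * volume E ≤ ENNReal.ofReal c * wm w E := by
    rw [wm_apply w hEm, ← lintegral_const_mul _ h.measurable.ennreal_ofReal,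
      ← setLIntegral_const]
    refine setLIntegral_mono_ae' hEm ?_
    filter_upwards [h.le p] with x hx hxE using hx (dq_subset_star p hxE.1)
  have h1 : wm w (dq p) ≤ sparseRatio n c * wm w E := by
    calc wm w (dq p) ≤ wm w (star p) := measure_mono (dq_subset_star p)
      _ = starC n * volume (dq p) * A := wm_star_eq w p
      _ ≤ starC n * (2 * volume E) * A := by gcongr
      _ = 2 * starC n * (A * volume E) := by ring
      _ ≤ 2 * starC n * (ENNReal.ofReal c * wm w E) := by gcongr
      _ = _ := by unfold sparseRatio; ring
  have h2 : (sparseRatio n c)⁻¹ * wm w (dq p) ≤ wm w E := by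
    rw [mul_comm, ← div_eq_mul_inv]
    exact ENNReal.div_le_of_le_mul' h1
  have h3 := measure_inter_add_sdiff (μ := wm w) (dq p) hLm
  have hEfin : wm w E ≠ ∞ := ne_top_of_le_ne_top hfin (measure_mono Set.sdiff_subset)
  rw [ENNReal.sub_mul fun _ _ => hfin, one_mul]
  refine ENNReal.le_sub_of_add_le_right (ne_top_of_le_ne_top hEfin h2) ?_
  calc _ ≤ wm w (dq p ∩ layer D (j + 1)) + wm w E := by gcongr
    _ = _ := h3

lemma SparseTree.lintegral_overlap_le (hD : SparseTree D) (h : StarA1 w c) {j : ℕ} (τ : ℕ)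
    {p : DIdx n} (hp : p ∈ D j) :
    ∫⁻ x in dq p ∩ layer D (j + τ), overlap D j x ∂(wm w) ≤
      (1 - (sparseRatio n c)⁻¹) ^ τ * (τ + sparseRatio n c) * wm w (dq p) := by
  set θ := 1 - (sparseRatio n c)⁻¹ with hθ
  have hgeom := hD.measure_inter_layer_le (hD.wm_inter_layer_le h)
  set A := dq p ∩ layer D (j + τ) with hA
  have hAm : MeasurableSet A := (measurableSet_dq p).inter (measurableSet_layer D _)
  have hθsum : ∑' i : ℕ, θ ^ i = sparseRatio n c := by
    rw [ENNReal.tsum_geometric, hθ, ENNReal.sub_sub_cancel ENNReal.one_ne_top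
      (ENNReal.inv_le_one.2 h.one_le_sparseRatio), inv_inv]
  have hi : ∀ i, ∫⁻ x in A, (layer D (j + i)).indicator 1 x ∂(wm w) =
      wm w (A ∩ layer D (j + i)) := by
    intro i
    rw [lintegral_indicator_one (measurableSet_layer D _),
      Measure.restrict_apply (measurableSet_layer D _), Set.inter_comm]
  unfold overlap
  rw [lintegral_tsum fun i =>
    (measurable_one.indicator (measurableSet_layer D (j + i))).aemeasurable]
  simp_rw [hi]
  rw [← ENNReal.summable.sum_add_tsum_nat_add' (k := τ)]
  calc _ ≤ ∑ i ∈ Finset.range τ, θ ^ τ * wm w (dq p) + ∑' i : ℕ, θ ^ (τ + i) * wm w (dq p) := by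
        refine add_le_add (Finset.sum_le_sum fun i _ => ?_) (ENNReal.tsum_le_tsum fun i => ?_)
        · exact (measure_mono Set.inter_subset_left).trans (hgeom j τ hp)
        · refine (measure_mono ?_).trans (hgeom j (τ + i) hp)
          rw [add_comm i τ]
          exact Set.inter_subset_inter_left _ Set.inter_subset_left
    _ = _ := by
        simp_rw [pow_add, mul_assoc]
        rw [ENNReal.tsum_mul_left, ENNReal.tsum_mul_right, hθsum]
        simp only [Finset.sum_const, Finset.card_range, nsmul_eq_mul]
        ring

/-- The Carleson packing property of sparse trees. -/
lemma SparseTree.tsum_volume_le (hD : SparseTree D) {S : Set (ℕ × DIdx n)}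
    (hS : ∀ i ∈ S, i.2 ∈ D i.1) :
    ∑' i : S, volume (dq (i : ℕ × DIdx n).2) ≤ 2 * volume (⋃ i ∈ S, dq i.2) := by
  set E : ℕ × DIdx n → Set (Rn n) := fun i => dq i.2 \ layer D (i.1 + 1) with hE
  have hEm : ∀ i, MeasurableSet (E i) := fun i =>
    (measurableSet_dq i.2).diff (measurableSet_layer D _)
  have hvol : ∀ i ∈ S, volume (dq i.2) ≤ 2 * volume (E i) :=
    fun i hi => hD.volume_le_sdiff (hS i hi)
  have hdis : S.PairwiseDisjoint E := by
    rintro ⟨j, p⟩ hi ⟨k, q⟩ hk hne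
    rw [Function.onFun, Set.disjoint_left]
    rintro x ⟨hx1, hx2⟩ ⟨hx3, hx4⟩
    rcases lt_trichotomy j k with hjk | rfl | hjk
    · exact hx2 (hD.antitone_layer hjk (dq_subset_layer (hS _ hk) hx3))
    · exact hne (Prod.ext rfl (hD.eq_of_mem (hS _ hi) (hS _ hk) hx1 hx3))
    · exact hx4 (hD.antitone_layer hjk (dq_subset_layer (hS _ hi) hx1))
  calc _ ≤ ∑' i : S, 2 * volume (E i) := ENNReal.tsum_le_tsum fun i => hvol i i.2
    _ = 2 * volume (⋃ i ∈ S, E i) := by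
        rw [ENNReal.tsum_mul_left, measure_biUnion S.to_countable hdis fun i _ => hEm i]
    _ ≤ _ := by
        gcongr
        exact Set.sdiff_subset

/-- A sparse family of cubes on whose dilates the averages of `F` are at least one. -/
lemma SparseTree.tsum_wm_le (hn : 1 ≤ n) (hD : SparseTree D) (h : StarA1 w c)
    {S : Set (ℕ × DIdx n)} (hS : ∀ i ∈ S, i.2 ∈ D i.1) {F : Rn n → ℝ≥0∞} (hF : AEMeasurable F)
    (hSF : ∀ i ∈ S, 1 ≤ avg i.2 F) :
    ∑' i : S, wm w (dq (i : ℕ × DIdx n).2) ≤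
      4 * starC n ^ 2 * ENNReal.ofReal c * ∫⁻ x, F x * ENNReal.ofReal (w x) := by
  have hc : 0 < c := zero_lt_one.trans_le h.one_le
  set ι : DIdx n → ℝ := fun p => (avg p (fun x => ENNReal.ofReal (w x))).toReal / c with hι
  set ν : Measure (Rn n) := volume.withDensity F with hν
  have hιw : ∀ᵐ x ∂(volume : Measure (Rn n)), ∀ p, x ∈ star p → ι p ≤ w x := by
    refine ae_all_iff.2 fun p => ?_
    filter_upwards [h.le p] with x hx hxp
    have h1 := ENNReal.toReal_mono (by finiteness) (hx hxp)
    rw [ENNReal.toReal_mul, ENNReal.toReal_ofReal hc.le, ENNReal.toReal_ofReal (h.nonneg x)] at h1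
    rw [hι, div_le_iff₀ hc, mul_comm]
    exact h1
  have hlevel : ∀ t : ℝ, ∑' i : S, (Set.Ioo 0 (ι (i : ℕ × DIdx n).2)).indicator
      (fun _ => volume (dq (i : ℕ × DIdx n).2)) t ≤ 4 * starC n * ν {x | t < w x} := by
    intro t
    set R : Set (ℕ × DIdx n) := {i | i ∈ S ∧ t < ι i.2} with hR
    have h1 : ∑' i : S, (Set.Ioo 0 (ι (i : ℕ × DIdx n).2)).indicator
        (fun _ => volume (dq (i : ℕ × DIdx n).2)) t ≤ ∑' i : R, volume (dq (i : ℕ × DIdx n).2) := by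
      rw [tsum_subtype S fun i : ℕ × DIdx n =>
        (Set.Ioo 0 (ι i.2)).indicator (fun _ => volume (dq i.2)) t,
        tsum_subtype R fun i : ℕ × DIdx n => volume (dq i.2)]
      refine ENNReal.tsum_le_tsum fun i => ?_
      by_cases hi : i ∈ S
      · rw [Set.indicator_of_mem hi]
        by_cases ht : t ∈ Set.Ioo 0 (ι i.2)
        · rw [Set.indicator_of_mem ht, Set.indicator_of_mem (show i ∈ R from ⟨hi, ht.2⟩)]
        · rw [Set.indicator_of_notMem ht]; exact zero_le
      · rw [Set.indicator_of_notMem hi]; exact zero_le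
    have h2 := hD.tsum_volume_le (S := R) fun i hi => hS i hi.1
    set V : Set (Rn n) := ⋃ i ∈ R, star i.2 with hV
    have hVm : MeasurableSet V :=
      MeasurableSet.biUnion R.to_countable fun i _ => measurableSet_star i.2
    have h3 : (⋃ i ∈ R, dq i.2) ⊆ {x | 2⁻¹ < Mstar (V.indicator F) x} := by
      intro x hx
      obtain ⟨i, hi, hxi⟩ := Set.mem_iUnion₂.1 hx
      have h4 : avg i.2 (V.indicator F) = avg i.2 F := by
        unfold avg
        congr 1
        refine setLIntegral_congr_fun (measurableSet_star i.2) fun y hy => ?_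
        exact Set.indicator_of_mem (Set.mem_biUnion hi hy) _
      have h5 : 1 ≤ Mstar (V.indicator F) x :=
        (hSF i hi.1).trans (h4 ▸ avg_le_Mstar hxi)
      exact lt_of_lt_of_le (ENNReal.inv_lt_one.2 (by norm_num)) h5
    have h4 := mul_volume_Mstar_gt_le hn (V.indicator F) 2⁻¹
    rw [lintegral_indicator hVm, ← withDensity_apply F hVm] at h4
    have h5 : ν V ≤ ν {x | t < w x} := by
      refine measure_mono_ae ?_
      filter_upwards [(withDensity_absolutelyContinuous volume F).ae_le hιw] with x hx hxV
      obtain ⟨i, hi, hxi⟩ := Set.mem_iUnion₂.1 hxV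
      exact lt_of_lt_of_le hi.2 (hx _ hxi)
    calc _ ≤ _ := h1
      _ ≤ 2 * volume (⋃ i ∈ R, dq i.2) := h2
      _ ≤ 2 * volume {x | 2⁻¹ < Mstar (V.indicator F) x} := by gcongr
      _ = 4 * (2⁻¹ * volume {x | 2⁻¹ < Mstar (V.indicator F) x}) := by
          rw [← mul_assoc]
          congr 1
          rw [show (4 : ℝ≥0∞) = 2 * 2 by norm_num, mul_assoc,
            ENNReal.mul_inv_cancel (by norm_num) (by norm_num), mul_one]
      _ ≤ 4 * (starC n * ν V) := by gcongr
      _ ≤ 4 * (starC n * ν {x | t < w x}) := by gcongr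
      _ = _ := by ring
  have hwι : ∀ p, wm w (dq p) ≤ starC n * ENNReal.ofReal c *
      ∫⁻ t in Set.Ioi 0, (Set.Ioo 0 (ι p)).indicator (fun _ => volume (dq p)) t := by
    intro p
    have h1 : ENNReal.ofReal c * ENNReal.ofReal (ι p) = avg p (fun x => ENNReal.ofReal (w x)) := by
      rw [← ENNReal.ofReal_mul hc.le, hι, mul_div_cancel₀ _ hc.ne', ENNReal.ofReal_toReal
        (h.avg_ne_top p)]
    rw [lintegral_indicator_const measurableSet_Ioo, Measure.restrict_apply measurableSet_Ioo,
      Set.inter_eq_left.2 Set.Ioo_subset_Ioi_self, Real.volume_Ioo, sub_zero]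
    calc wm w (dq p) ≤ wm w (star p) := measure_mono (dq_subset_star p)
      _ = _ := by rw [wm_star_eq, ← h1]; ring
  have hlc : ∫⁻ t in Set.Ioi 0, ν {x | t < w x} = ∫⁻ x, F x * ENNReal.ofReal (w x) := by
    rw [← lintegral_eq_lintegral_meas_lt ν (Filter.Eventually.of_forall h.nonneg)
      h.measurable.aemeasurable, hν, lintegral_withDensity_eq_lintegral_mul₀ hF
      h.measurable.ennreal_ofReal.aemeasurable]
    rfl
  calc _ ≤ ∑' i : S, starC n * ENNReal.ofReal c * ∫⁻ t in Set.Ioi 0,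
        (Set.Ioo 0 (ι (i : ℕ × DIdx n).2)).indicator
          (fun _ => volume (dq (i : ℕ × DIdx n).2)) t := ENNReal.tsum_le_tsum fun i => hwι _
    _ = starC n * ENNReal.ofReal c * ∫⁻ t in Set.Ioi 0, ∑' i : S,
        (Set.Ioo 0 (ι (i : ℕ × DIdx n).2)).indicator
          (fun _ => volume (dq (i : ℕ × DIdx n).2)) t := by
        rw [ENNReal.tsum_mul_left, lintegral_tsum fun i =>
          (measurable_const.indicator measurableSet_Ioo).aemeasurable]
    _ ≤ starC n * ENNReal.ofReal c * ∫⁻ t in Set.Ioi 0, 4 * starC n * ν {x | t < w x} := by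
        gcongr with t
        exact hlevel t
    _ = _ := by
        rw [lintegral_const_mul' _ _ (by have := starC_ne_top (n := n); finiteness), hlc]
        ring

end Weighted

end CZ

end

noncomputable section

namespace CZ

variable {n : ℕ} {𝕜 : Type*} [RCLike 𝕜]

/-! ### Numerical lemmas -/

lemma one_sub_inv_pow_mul_le {r : ℝ} (hr : 1 ≤ r) (τ : ℕ) :
    (1 - r⁻¹) ^ τ * (τ + r) ≤ r ∧ (1 - r⁻¹) ^ τ * (τ + r) * τ ≤ 2 * r * r := by
  have hr0 : 0 < r := by linarith
  set x : ℝ := τ / r with hx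
  have hx0 : 0 ≤ x := by positivity
  have hτ : (τ : ℝ) = r * x := by rw [hx]; field_simp
  have h1 : (1 - r⁻¹) ^ τ ≤ Real.exp (-x) := by
    have h2 : 1 - r⁻¹ ≤ Real.exp (-r⁻¹) := by
      have := Real.add_one_le_exp (-r⁻¹); linarith
    have h3 : 0 ≤ 1 - r⁻¹ := sub_nonneg.2 (inv_le_one_of_one_le₀ hr)
    calc (1 - r⁻¹) ^ τ ≤ Real.exp (-r⁻¹) ^ τ := by gcongr
      _ = Real.exp (-x) := by rw [← Real.exp_nat_mul, hx]; congr 1; ring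
  have h2 := Real.quadratic_le_exp_of_nonneg hx0
  have h3 : Real.exp (-x) * (1 + x + x ^ 2 / 2) ≤ 1 := by
    calc Real.exp (-x) * (1 + x + x ^ 2 / 2) ≤ Real.exp (-x) * Real.exp x := by gcongr
      _ = 1 := by rw [← Real.exp_add]; simp
  have he := (Real.exp_pos (-x)).le
  constructor
  · calc (1 - r⁻¹) ^ τ * (τ + r) ≤ Real.exp (-x) * (τ + r) := by gcongr
      _ = r * (Real.exp (-x) * (1 + x)) := by rw [hτ]; ring
      _ ≤ r * 1 := by
          gcongr
          exact (mul_le_mul_of_nonneg_left (by nlinarith [sq_nonneg x]) he).trans h3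
      _ = r := mul_one r
  · calc (1 - r⁻¹) ^ τ * (τ + r) * τ ≤ Real.exp (-x) * (τ + r) * τ := by gcongr
      _ = r * r * (Real.exp (-x) * (x + x ^ 2)) := by rw [hτ]; ring
      _ ≤ r * r * (Real.exp (-x) * (2 * (1 + x + x ^ 2 / 2))) := by
          gcongr
          nlinarith
      _ = r * r * (2 * (Real.exp (-x) * (1 + x + x ^ 2 / 2))) := by ring
      _ ≤ r * r * (2 * 1) := by gcongr
      _ = _ := by ring

lemma exists_nat_two_mul_le_two_pow {r : ℝ} (hr : 1 ≤ r) :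
    ∃ K : ℕ, 2 * r ≤ 2 ^ K ∧ (K : ℝ) + 1 ≤ 3 * (1 + Real.log r) := by
  have hr0 : 0 < r := by linarith
  refine ⟨⌈Real.logb 2 (2 * r)⌉₊, ?_, ?_⟩
  · have h1 := Nat.le_ceil (Real.logb 2 (2 * r))
    calc 2 * r = (2 : ℝ) ^ (Real.logb 2 (2 * r)) := by
          rw [Real.rpow_logb (by norm_num) (by norm_num) (by positivity)]
      _ ≤ (2 : ℝ) ^ ((⌈Real.logb 2 (2 * r)⌉₊ : ℕ) : ℝ) := by
          gcongr
          norm_num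
      _ = _ := Real.rpow_natCast _ _
  · have hl : Real.logb 2 (2 * r) = 1 + Real.log r / Real.log 2 := by
      rw [Real.logb, Real.log_mul (by norm_num) hr0.ne', add_div, div_self]
      exact (Real.log_pos (by norm_num)).ne'
    have hlog := Real.log_nonneg hr
    have h2 := Real.log_two_gt_d9
    have h3 : Real.log r / Real.log 2 ≤ 2 * Real.log r := by
      rw [div_le_iff₀ (by linarith)]
      nlinarith
    have h4 := Nat.ceil_lt_add_one (a := Real.logb 2 (2 * r)) (by
      rw [hl]; have := div_nonneg hlog (by linarith : (0 : ℝ) ≤ Real.log 2); linarith)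
    rw [hl] at h4 ⊢
    linarith

lemma exists_tsum_geometric_decay_le : ∃ C : ℝ≥0∞, C ≠ ∞ ∧ ∀ r : ℝ, 1 ≤ r →
    ∑' k : ℕ, ((k : ℝ≥0∞) + 1) * ((1 - (ENNReal.ofReal r)⁻¹) ^ (2 ^ k) *
      ((2 ^ k : ℕ) + ENNReal.ofReal r)) ≤
        C * ENNReal.ofReal r * ENNReal.ofReal ((1 + Real.log r) ^ 2) := by
  have hA : ∑' i : ℕ, ((i : ℝ≥0∞) + 1) * 2⁻¹ ^ i ≠ ∞ := by
    have h1 : Summable fun i : ℕ => ((i : ℝ) + 1) * (2⁻¹ : ℝ) ^ i := by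
      have h2 := summable_pow_mul_geometric_of_norm_lt_one 1 (r := (2⁻¹ : ℝ)) (by norm_num)
      have h3 := summable_geometric_of_lt_one (r := (2⁻¹ : ℝ)) (by norm_num) (by norm_num)
      refine (h2.add h3).congr fun i => ?_
      ring
    have h2 := h1.tsum_ofReal_ne_top
    convert h2 using 3 with i
    rw [ENNReal.ofReal_mul (by positivity), ENNReal.ofReal_add (by positivity) (by norm_num),
      ENNReal.ofReal_natCast, ENNReal.ofReal_one, ENNReal.ofReal_pow (by norm_num),
      ENNReal.ofReal_inv_of_pos (by norm_num)]
    norm_num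
  set A := ∑' i : ℕ, ((i : ℝ≥0∞) + 1) * 2⁻¹ ^ i with hAdef
  refine ⟨9 * (1 + A), by finiteness, fun r hr => ?_⟩
  have hr0 : 0 < r := by linarith
  obtain ⟨K, hK1, hK2⟩ := exists_nat_two_mul_le_two_pow hr
  set u : ℕ → ℝ≥0∞ := fun τ => (1 - (ENNReal.ofReal r)⁻¹) ^ τ * (τ + ENNReal.ofReal r) with hu
  have hur : ∀ τ : ℕ, u τ = ENNReal.ofReal ((1 - r⁻¹) ^ τ * (τ + r)) := by
    intro τ
    have h3 : 0 ≤ 1 - r⁻¹ := sub_nonneg.2 (inv_le_one_of_one_le₀ hr)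
    rw [ENNReal.ofReal_mul (by positivity), ENNReal.ofReal_pow h3,
      ENNReal.ofReal_sub _ (by positivity),
      ENNReal.ofReal_one, ENNReal.ofReal_inv_of_pos hr0, ENNReal.ofReal_add (by positivity) hr0.le,
      ENNReal.ofReal_natCast]
  have hu1 : ∀ τ, u τ ≤ ENNReal.ofReal r := fun τ => by
    rw [hur]; exact ENNReal.ofReal_le_ofReal (one_sub_inv_pow_mul_le hr τ).1
  have hu2 : ∀ i, u (2 ^ (i + K)) ≤ ENNReal.ofReal r * 2⁻¹ ^ i := fun i => by
    rw [hur]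
    have h1 := (one_sub_inv_pow_mul_le hr (2 ^ (i + K))).2
    rw [show ENNReal.ofReal r * 2⁻¹ ^ i = ENNReal.ofReal (r * 2⁻¹ ^ i) by
      rw [ENNReal.ofReal_mul hr0.le, ENNReal.ofReal_pow (by norm_num),
        ENNReal.ofReal_inv_of_pos (by norm_num)]
      norm_num]
    refine ENNReal.ofReal_le_ofReal ?_
    have h2 : (0 : ℝ) < ((2 ^ (i + K) : ℕ) : ℝ) := by positivity
    refine le_of_mul_le_mul_right (h1.trans ?_) h2
    push_cast
    calc 2 * r * r ≤ 2 ^ K * r := by gcongr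
      _ = r * 2⁻¹ ^ i * 2 ^ (i + K) := by
          rw [pow_add, inv_pow]; field_simp
  have hK : (K : ℝ≥0∞) * K + A * (K + 1) ≤ (1 + A) * ((K : ℝ≥0∞) + 1) ^ 2 := by
    have h1 : (K : ℝ≥0∞) ≤ K + 1 := le_self_add
    have h2 : (1 : ℝ≥0∞) ≤ (K : ℝ≥0∞) + 1 := le_add_self
    calc (K : ℝ≥0∞) * K + A * (K + 1) ≤ (K + 1) * (K + 1) + A * ((K + 1) * (K + 1)) := by
          gcongr
          exact le_mul_of_one_le_right zero_le h2
      _ = _ := by ring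
  have hK' : ((K : ℝ≥0∞) + 1) ^ 2 ≤ 9 * ENNReal.ofReal ((1 + Real.log r) ^ 2) := by
    rw [show (K : ℝ≥0∞) + 1 = ENNReal.ofReal (K + 1) by
      rw [ENNReal.ofReal_add (by positivity) (by norm_num)]; simp,
      ← ENNReal.ofReal_pow (by positivity), show (9 : ℝ≥0∞) = ENNReal.ofReal 9 by norm_num,
      ← ENNReal.ofReal_mul (by norm_num)]
    refine ENNReal.ofReal_le_ofReal ?_
    calc ((K : ℝ) + 1) ^ 2 ≤ (3 * (1 + Real.log r)) ^ 2 := by gcongr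
      _ = _ := by ring
  change ∑' k : ℕ, ((k : ℝ≥0∞) + 1) * u (2 ^ k) ≤ _
  rw [← ENNReal.summable.sum_add_tsum_nat_add' (k := K)]
  calc _ ≤ ∑ i ∈ Finset.range K, (K : ℝ≥0∞) * ENNReal.ofReal r +
        ∑' i : ℕ, ((K : ℝ≥0∞) + 1) * ENNReal.ofReal r * (((i : ℝ≥0∞) + 1) * 2⁻¹ ^ i) := by
        refine add_le_add (Finset.sum_le_sum fun i hi => ?_) (ENNReal.tsum_le_tsum fun i => ?_)
        · have h1 : i + 1 ≤ K := Finset.mem_range.1 hi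
          refine mul_le_mul' ?_ (hu1 _)
          exact_mod_cast h1
        · have h1 : (((i + K : ℕ) : ℝ≥0∞) + 1) ≤ ((K : ℝ≥0∞) + 1) * ((i : ℝ≥0∞) + 1) := by
            have : i + K + 1 ≤ (K + 1) * (i + 1) := by nlinarith
            exact_mod_cast this
          calc _ ≤ ((K : ℝ≥0∞) + 1) * ((i : ℝ≥0∞) + 1) * (ENNReal.ofReal r * 2⁻¹ ^ i) :=
                mul_le_mul' h1 (hu2 i)
            _ = _ := by ring
    _ = ENNReal.ofReal r * (K * K + A * (K + 1)) := by
        rw [ENNReal.tsum_mul_left]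
        simp only [Finset.sum_const, Finset.card_range, nsmul_eq_mul]
        ring
    _ ≤ ENNReal.ofReal r * ((1 + A) * (9 * ENNReal.ofReal ((1 + Real.log r) ^ 2))) := by
        gcongr
        exact hK.trans (by gcongr)
    _ = _ := by ring

/-! ### Splitting a sparse sum according to the overlap -/

section Tree

variable {D : ℕ → Set (DIdx n)} {a : DIdx n → ℝ≥0∞} {w : Rn n → ℝ} {c : ℝ}

lemma SparseTree.tsum_indicator_mul_overlap_le (hD : SparseTree D) (τ : ℕ) (x : Rn n) :
    ∑' j, (layer D j \ layer D (j + τ)).indicator (overlap D j) x ≤ (τ : ℝ≥0∞) * τ := by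
  by_cases hall : ∀ j, x ∈ layer D j
  · simp [hall]
  push Not at hall
  classical
  obtain ⟨M, hM1, hM2⟩ : ∃ M, x ∉ layer D M ∧ ∀ j, j < M → x ∈ layer D j :=
    ⟨Nat.find hall, Nat.find_spec hall, fun j hj => not_not.1 (Nat.find_min hall hj)⟩
  have hM3 : ∀ j, M ≤ j → x ∉ layer D j := fun j hj h => hM1 (hD.antitone_layer hj h)
  have hov : ∀ j, overlap D j x ≤ ((M - j : ℕ) : ℝ≥0∞) := by
    intro j
    unfold overlap
    rw [tsum_eq_sum (s := Finset.range (M - j))]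
    · calc _ ≤ ∑ i ∈ Finset.range (M - j), (1 : ℝ≥0∞) :=
            Finset.sum_le_sum fun i _ => Set.indicator_le_self' (fun _ _ => zero_le) x
        _ = _ := by simp
    · intro i hi
      rw [Finset.mem_range, not_lt] at hi
      exact Set.indicator_of_notMem (hM3 _ (by omega)) _
  rw [tsum_eq_sum (s := Finset.Ico (M - τ) M)]
  · calc _ ≤ ∑ i ∈ Finset.Ico (M - τ) M, (τ : ℝ≥0∞) := by
          refine Finset.sum_le_sum fun i hi => ?_
          rw [Finset.mem_Ico] at hi
          refine (Set.indicator_le_self' (fun _ _ => zero_le) x).trans ((hov i).trans ?_)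
          exact_mod_cast (by omega : M - i ≤ τ)
      _ ≤ _ := by
          simp only [Finset.sum_const, Nat.card_Ico, nsmul_eq_mul]
          gcongr
          omega
  · intro j hj
    refine Set.indicator_of_notMem (fun h => hj ?_) _
    rw [Finset.mem_Ico]
    have h1 : j < M := by by_contra hc; exact hM3 j (not_lt.1 hc) h.1
    have h2 : ¬ j + τ < M := fun hc => h.2 (hM2 _ hc)
    omega

lemma SparseTree.lintegral_level_le (hD : SparseTree D) (h : StarA1 w c) (P : Set (DIdx n)) (τ : ℕ)
    (E : Set (Rn n)) :
    ∫⁻ x in E, ∑' j, layerVal D (P.indicator 1) j x * overlap D j x ∂(wm w) ≤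
      (τ : ℝ≥0∞) * τ * wm w E + (1 - (sparseRatio n c)⁻¹) ^ τ * (τ + sparseRatio n c) *
        ∑' i : {i : ℕ × DIdx n | i.2 ∈ D i.1 ∧ i.2 ∈ P}, wm w (dq (i : ℕ × DIdx n).2) := by
  set θ := (1 - (sparseRatio n c)⁻¹) ^ τ * (τ + sparseRatio n c) with hθ
  have hpt : ∀ x, ∑' j, layerVal D (P.indicator 1) j x * overlap D j x ≤
      (τ : ℝ≥0∞) * τ + ∑' j, ∑' p : D j, P.indicator 1 (p : DIdx n) *
        (dq (p : DIdx n) ∩ layer D (j + τ)).indicator (overlap D j) x := by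
    intro x
    refine le_trans ?_ (add_le_add_left (hD.tsum_indicator_mul_overlap_le τ x) _)
    rw [← ENNReal.tsum_add]
    refine ENNReal.tsum_le_tsum fun j => ?_
    by_cases hxj : x ∈ layer D j
    · obtain ⟨p, hp, hxp⟩ := mem_layer.1 hxj
      rw [hD.layerVal_eq hp hxp]
      by_cases hxτ : x ∈ layer D (j + τ)
      · refine le_trans ?_ le_add_self
        refine le_trans ?_ (ENNReal.le_tsum (⟨p, hp⟩ : D j))
        rw [Set.indicator_of_mem (show x ∈ dq p ∩ layer D (j + τ) from ⟨hxp, hxτ⟩)]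
      · refine le_trans ?_ le_self_add
        rw [Set.indicator_of_mem (show x ∈ layer D j \ layer D (j + τ) from ⟨hxj, hxτ⟩)]
        exact mul_le_of_le_one_left zero_le (Set.indicator_le_self' (fun _ _ => zero_le) p)
    · have : layerVal D (P.indicator 1) j x = 0 := by
        unfold layerVal
        refine ENNReal.tsum_eq_zero.2 fun p => Set.indicator_of_notMem (fun hx => hxj ?_) _
        exact dq_subset_layer p.2 hx
      rw [this, zero_mul]
      exact zero_le
  have hm : ∀ j (p : D j), Measurable fun x => P.indicator (1 : DIdx n → ℝ≥0∞) (p : DIdx n) *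
        (dq (p : DIdx n) ∩ layer D (j + τ)).indicator (overlap D j) x := fun j p =>
    ((measurable_overlap D j).indicator ((measurableSet_dq _).inter
      (measurableSet_layer D _))).const_mul _
  calc _ ≤ ∫⁻ x in E, ((τ : ℝ≥0∞) * τ + ∑' j, ∑' p : D j, P.indicator 1 (p : DIdx n) *
        (dq (p : DIdx n) ∩ layer D (j + τ)).indicator (overlap D j) x) ∂(wm w) :=
        lintegral_mono hpt
    _ = (τ : ℝ≥0∞) * τ * wm w E + ∑' j, ∑' p : D j, P.indicator 1 (p : DIdx n) *
        ∫⁻ x in E, (dq (p : DIdx n) ∩ layer D (j + τ)).indicator (overlap D j) x ∂(wm w) := by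
        rw [lintegral_add_left measurable_const, setLIntegral_const,
          lintegral_tsum fun j => (Measurable.tsum (hm j)).aemeasurable]
        congr 2
        funext j
        rw [lintegral_tsum fun p => (hm j p).aemeasurable]
        congr 1
        funext p
        rw [lintegral_const_mul _ ((measurable_overlap D j).indicator ((measurableSet_dq _).inter
          (measurableSet_layer D _)))]
    _ ≤ (τ : ℝ≥0∞) * τ * wm w E + ∑' j, ∑' p : D j, P.indicator 1 (p : DIdx n) *
        (θ * wm w (dq (p : DIdx n))) := by
        gcongr with j p
        refine (setLIntegral_le_lintegral _ _).trans ?_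
        rw [lintegral_indicator ((measurableSet_dq _).inter (measurableSet_layer D _))]
        exact hD.lintegral_overlap_le h τ p.2
    _ = _ := by
        congr 1
        rw [← ENNReal.tsum_mul_left, tsum_subtype {i : ℕ × DIdx n | i.2 ∈ D i.1 ∧ i.2 ∈ P}
          fun i => θ * wm w (dq i.2)]
        rw [ENNReal.tsum_prod (f := fun j p => Set.indicator
          {i : ℕ × DIdx n | i.2 ∈ D i.1 ∧ i.2 ∈ P}
          (fun i => θ * wm w (dq i.2)) (j, p))]
        congr 1
        funext j
        rw [tsum_subtype (D j) fun p => P.indicator 1 p * (θ * wm w (dq p))]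
        congr 1
        funext p
        by_cases hp : p ∈ D j <;> by_cases hP : p ∈ P <;> simp [hp, hP]

end Tree

end CZ

end

noncomputable section

namespace CZ

variable {n : ℕ} {𝕜 : Type*} [RCLike 𝕜]

/-! ### The weighted weak type estimate for sparse sums -/

section Tree

variable {D : ℕ → Set (DIdx n)} {a : DIdx n → ℝ≥0∞} {w : Rn n → ℝ} {c : ℝ}

lemma ofReal_Phi_eight_pow_mul_le (k : ℕ) {t : ℝ} (ht : 0 ≤ t) :
    ENNReal.ofReal (Phi (8 ^ k * t)) ≤ 8 ^ k * (1 + 3 * k) * ENNReal.ofReal (Phi t) := by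
  have h1 : Real.posLog ((8 : ℝ) ^ k) ≤ 3 * k := by
    rw [Real.posLog_eq_log (by rw [abs_of_pos (by positivity)]; exact one_le_pow₀ (by norm_num)),
      Real.log_pow, show (8 : ℝ) = 2 ^ 3 by norm_num, Real.log_pow]
    have h2 := Real.log_two_lt_d9
    have h3 : (0 : ℝ) ≤ k := by positivity
    push_cast
    nlinarith
  calc ENNReal.ofReal (Phi (8 ^ k * t)) ≤ ENNReal.ofReal (8 ^ k * (1 + 3 * k) * Phi t) := by
        refine ENNReal.ofReal_le_ofReal ((Phi_mul_le (by positivity) ht).trans ?_)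
        have := Phi_nonneg ht
        gcongr
    _ = _ := by
        rw [ENNReal.ofReal_mul (by positivity), ENNReal.ofReal_mul (by positivity),
          ENNReal.ofReal_pow (by norm_num), ENNReal.ofReal_add (by norm_num) (by positivity),
          ENNReal.ofReal_mul (by norm_num)]
        simp

/-- The coefficient threshold of index `k`. -/
def thr (H : ℝ) (k : ℕ) : ℝ≥0∞ := ENNReal.ofReal H * 8⁻¹ ^ k

/-- The cubes whose coefficient lies between the thresholds of index `k` and `k + 1`. -/
def band (H : ℝ) (a : DIdx n → ℝ≥0∞) (k : ℕ) : Set (DIdx n) :=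
  {p | thr H (k + 1) < a p ∧ a p ≤ thr H k}

lemma thr_mul (H : ℝ) (k : ℕ) : thr H k * 8 ^ k = ENNReal.ofReal H := by
  rw [thr, mul_assoc, ← mul_pow, ENNReal.inv_mul_cancel (by norm_num) (by norm_num), one_pow,
    mul_one]

lemma exists_mem_band {H : ℝ} {k₀ : ℕ} {p : DIdx n} (h0 : a p ≠ 0) (hle : a p ≤ thr H k₀) :
    ∃ k, p ∈ band H a (k₀ + k) := by
  have h1 : Filter.Tendsto (fun k => thr H (k₀ + k)) Filter.atTop (nhds 0) := by
    have h2 : Filter.Tendsto (fun k : ℕ => ENNReal.ofReal H * (8⁻¹ : ℝ≥0∞) ^ k) Filter.atTop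
        (nhds (ENNReal.ofReal H * 0)) :=
      ENNReal.Tendsto.const_mul (ENNReal.tendsto_pow_atTop_nhds_zero_of_lt_one
        (ENNReal.inv_lt_one.2 (by norm_num))) (Or.inr ENNReal.ofReal_ne_top)
    rw [mul_zero] at h2
    exact h2.comp (Filter.tendsto_add_atTop_nat k₀ |>.congr fun k => add_comm _ _)
  have h2 : ∃ k, thr H (k₀ + k) < a p :=
    (h1.eventually (gt_mem_nhds (pos_iff_ne_zero.2 h0))).exists
  classical
  obtain ⟨m, hm1, hm2⟩ : ∃ m, thr H (k₀ + m) < a p ∧ ∀ j, j < m → ¬ thr H (k₀ + j) < a p :=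
    ⟨Nat.find h2, Nat.find_spec h2, fun j hj => Nat.find_min h2 hj⟩
  cases m with
  | zero => exact absurd hm1 (not_lt.2 hle)
  | succ m => exact ⟨m, hm1, not_lt.1 (hm2 m (Nat.lt_succ_self m))⟩

lemma SparseTree.layerVal_le_tsum_band (hD : SparseTree D) {H : ℝ} {k₀ j : ℕ} {x : Rn n}
    (hx : ∀ p ∈ D j, x ∈ dq p → a p ≤ thr H k₀) :
    layerVal D a j x ≤
      ∑' k, thr H (k₀ + k) * layerVal D ((band H a (k₀ + k)).indicator 1) j x := by
  by_cases hxj : x ∈ layer D j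
  · obtain ⟨p, hp, hxp⟩ := mem_layer.1 hxj
    rw [hD.layerVal_eq hp hxp]
    by_cases h0 : a p = 0
    · rw [h0]; exact zero_le
    obtain ⟨k, hk⟩ := exists_mem_band h0 (hx p hp hxp)
    refine le_trans ?_ (ENNReal.le_tsum k)
    rw [hD.layerVal_eq hp hxp, Set.indicator_of_mem hk, Pi.one_apply, mul_one]
    exact hk.2
  · have : layerVal D a j x = 0 := by
      unfold layerVal
      refine ENNReal.tsum_eq_zero.2 fun p => Set.indicator_of_notMem (fun hx => hxj ?_) _
      exact dq_subset_layer p.2 hx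
    rw [this]
    exact zero_le

/-- The total weight of the cubes with large coefficients. -/
lemma SparseTree.tsum_wm_thr_le (hn : 1 ≤ n) (hD : SparseTree D) (h : StarA1 w c) {H : ℝ}
    {g : Rn n → ℝ} (hg : AEMeasurable g) (hg0 : ∀ x, 0 ≤ g x)
    (ha : ∀ s, 0 < s → ∀ p, avg p (fun x => ENNReal.ofReal (Phi (s * g x))) ≤ 1 →
      ENNReal.ofReal s * a p ≤ ENNReal.ofReal H) (k : ℕ) {S : Set (ℕ × DIdx n)}
    (hS : ∀ i ∈ S, i.2 ∈ D i.1 ∧ thr H k < a i.2) :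
    ∑' i : S, wm w (dq (i : ℕ × DIdx n).2) ≤
      4 * starC n ^ 2 * ENNReal.ofReal c * (8 ^ k * (1 + 3 * k) *
        ∫⁻ x, ENNReal.ofReal (Phi (g x)) * ENNReal.ofReal (w x)) := by
  have h1 := hD.tsum_wm_le hn h (S := S) (fun i hi => (hS i hi).1)
    (F := fun x => ENNReal.ofReal (Phi (8 ^ k * g x)))
    (measurable_Phi.comp_aemeasurable (hg.const_mul _)).ennreal_ofReal (by
      intro i hi
      by_contra hc
      have h2 := ha (8 ^ k) (by positivity) i.2 (not_le.1 hc).le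
      refine absurd (hS i hi).2 (not_lt.2 ?_)
      rw [ENNReal.ofReal_pow (by norm_num), ENNReal.ofReal_ofNat, mul_comm] at h2
      rw [thr, ← ENNReal.inv_pow, ← div_eq_mul_inv]
      rwa [ENNReal.le_div_iff_mul_le (Or.inl (by positivity)) (Or.inl (by finiteness))])
  refine h1.trans ?_
  gcongr
  rw [← lintegral_const_mul' _ _ (by finiteness)]
  refine lintegral_mono fun x => ?_
  rw [← mul_assoc]
  exact mul_le_mul_left (ofReal_Phi_eight_pow_mul_le k (hg0 x)) _

lemma exists_two_pow_inv_mul_le {A : ℝ≥0∞} (hA : A ≠ ∞) : ∃ k : ℕ, A * 2⁻¹ ^ k ≤ 2⁻¹ := by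
  have h2 : Filter.Tendsto (fun k : ℕ => A * (2⁻¹ : ℝ≥0∞) ^ k) Filter.atTop (nhds (A * 0)) :=
    ENNReal.Tendsto.const_mul (ENNReal.tendsto_pow_atTop_nhds_zero_of_lt_one
      (ENNReal.inv_lt_one.2 (by norm_num))) (Or.inr hA)
  rw [mul_zero] at h2
  exact (h2.eventually (ge_mem_nhds (by simp))).exists

lemma exists_log_sparseRatio_le (n : ℕ) : ∃ C : ℝ≥0∞, C ≠ ∞ ∧ ∀ c : ℝ, 1 ≤ c →
    ENNReal.ofReal ((1 + Real.log (sparseRatio n c).toReal) ^ 2) ≤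
      C * ENNReal.ofReal ((1 + Real.log c) ^ 2) := by
  set s := (2 * starC n).toReal with hs
  have hs1 : 1 ≤ s := by
    rw [hs, ← ENNReal.toReal_one]
    refine ENNReal.toReal_mono ?_ (one_le_mul (by norm_num) one_le_starC)
    have := starC_ne_top (n := n)
    finiteness
  refine ⟨ENNReal.ofReal ((1 + Real.log s) ^ 2), by finiteness, fun c hc => ?_⟩
  have h1 : (sparseRatio n c).toReal = s * c := by
    rw [sparseRatio, ENNReal.toReal_mul, ENNReal.toReal_ofReal (by linarith)]
  rw [h1, ← ENNReal.ofReal_mul (by positivity), ← mul_pow,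
    Real.log_mul (by linarith) (by linarith)]
  have h2 := Real.log_nonneg hs1
  have h3 := Real.log_nonneg hc
  refine ENNReal.ofReal_le_ofReal ?_
  gcongr
  nlinarith

/-- The weak type `L log L` estimate for sparse sums with `A₁` weights. -/
lemma exists_wm_sparseSum_gt_le (hn : 1 ≤ n) {C₁ : ℝ≥0∞} (hC₁ : C₁ ≠ ∞) (H : ℝ) :
    ∃ C : ℝ≥0∞, C ≠ ∞ ∧ ∀ (D : ℕ → Set (DIdx n)), SparseTree D → ∀ (w : Rn n → ℝ) (c : ℝ),
      StarA1 w c → wm w (layer D 0) ≠ ∞ → ∀ (g : Rn n → ℝ) (a : DIdx n → ℝ≥0∞),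
      AEMeasurable g → (∀ x, 0 ≤ g x) →
      (∀ s, 0 < s → ∀ p, avg p (fun x => ENNReal.ofReal (Phi (s * g x))) ≤ 1 →
        ENNReal.ofReal s * a p ≤ ENNReal.ofReal H) →
      wm w (layer D 0 ∩ {x | 1 < C₁ * sparseSum D a 0 x}) ≤
        C * ENNReal.ofReal (Phi c ^ 2) *
          ∫⁻ x, ENNReal.ofReal (Phi (g x)) * ENNReal.ofReal (w x) := by
  obtain ⟨k₀, hk₀⟩ := exists_two_pow_inv_mul_le (A := C₁ * ENNReal.ofReal H * 2) (by finiteness)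
  obtain ⟨CN, hCN, hN⟩ := exists_tsum_geometric_decay_le
  obtain ⟨CL, hCL, hL⟩ := exists_log_sparseRatio_le n
  have hsC := starC_ne_top (n := n)
  set X₁ : ℝ≥0∞ := 4 * starC n ^ 2 * (8 ^ k₀ * (1 + 3 * k₀)) with hX₁
  set X₂ : ℝ≥0∞ := 2 * (C₁ * (8 * ENNReal.ofReal H * (4 * starC n ^ 2) * 4 *
    (CN * (2 * starC n) * CL))) with hX₂
  refine ⟨X₁ + X₂, by finiteness, ?_⟩
  intro D hD w c h hfin g a hg hg0 ha
  obtain ⟨G, hG⟩ : ∃ G, G = ∫⁻ x, ENNReal.ofReal (Phi (g x)) * ENNReal.ofReal (w x) := ⟨_, rfl⟩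
  have hbig := fun k S hS => hD.tsum_wm_thr_le hn h hg hg0 ha k (S := S) hS
  rw [← hG] at hbig ⊢
  have hc := h.one_le
  have hlog := Real.log_nonneg hc
  have hPhi : Phi c = c * (1 + Real.log c) := by
    rw [Phi, Real.posLog_eq_log (by rwa [abs_of_pos (by linarith)])]
  have hR : ENNReal.ofReal (sparseRatio n c).toReal = sparseRatio n c :=
    ENNReal.ofReal_toReal sparseRatio_ne_top
  -- the cubes with large coefficients
  set S₀ : Set (ℕ × DIdx n) := {i | i.2 ∈ D i.1 ∧ thr H k₀ < a i.2} with hS₀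
  set Rem : Set (Rn n) := ⋃ i ∈ S₀, dq i.2 with hRem
  have hRemm : MeasurableSet Rem :=
    MeasurableSet.biUnion S₀.to_countable fun i _ => measurableSet_dq i.2
  have hRemle : wm w Rem ≤ X₁ * ENNReal.ofReal (Phi c ^ 2) * G := by
    calc wm w Rem ≤ ∑' i : S₀, wm w (dq (i : ℕ × DIdx n).2) :=
          measure_biUnion_le _ S₀.to_countable _
      _ ≤ _ := hbig k₀ S₀ fun i hi => hi
      _ = X₁ * ENNReal.ofReal c * G := by rw [hX₁]; ring
      _ ≤ _ := by
          gcongr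
          rw [hPhi]
          nlinarith [mul_nonneg (by linarith : (0 : ℝ) ≤ c) hlog,
            sq_nonneg (c * (1 + Real.log c) - 1)]
  set E : Set (Rn n) := (layer D 0 ∩ {x | 1 < C₁ * sparseSum D a 0 x}) \ Rem with hE
  have hEm : MeasurableSet E := ((measurableSet_layer D 0).inter
    (measurableSet_lt measurable_const ((measurable_sparseSum D a 0).const_mul _))).diff hRemm
  have hEfin : wm w E ≠ ∞ := ne_top_of_le_ne_top hfin
    (measure_mono (Set.sdiff_subset.trans Set.inter_subset_left))
  set tail : ℕ → ℝ≥0∞ := fun k => (1 - (sparseRatio n c)⁻¹) ^ (2 ^ k) *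
    ((2 ^ k : ℕ) + sparseRatio n c) with htail
  have hlev : ∀ k, ∫⁻ x in E, ∑' j, layerVal D ((band H a k).indicator 1) j x *
      overlap D j x ∂(wm w) ≤ 4 ^ k * wm w E + tail k *
        (4 * starC n ^ 2 * ENNReal.ofReal c * (8 ^ (k + 1) * (4 * (k + 1)) * G)) := by
    intro k
    refine (hD.lintegral_level_le h (band H a k) (2 ^ k) E).trans ?_
    refine add_le_add (le_of_eq ?_) (mul_le_mul_right ?_ _)
    · push_cast
      rw [← mul_pow]
      norm_num
    · refine (hbig (k + 1) _ fun i hi => ⟨hi.1, hi.2.1⟩).trans ?_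
      gcongr
      push_cast
      calc (1 : ℝ≥0∞) + 3 * (k + 1) ≤ (1 + k) + 3 * (k + 1) := by gcongr; exact le_self_add
        _ = _ := by ring
  have hint : ∫⁻ x in E, sparseSum D a 0 x ∂(wm w) ≤ ∑' k, thr H (k₀ + k) *
      (4 ^ (k₀ + k) * wm w E + tail (k₀ + k) * (4 * starC n ^ 2 * ENNReal.ofReal c *
        (8 ^ (k₀ + k + 1) * (4 * ((k₀ + k : ℕ) + 1)) * G))) := by
    have hmeas : ∀ k, Measurable fun x => ∑' j, layerVal D ((band H a k).indicator 1) j x *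
        overlap D j x := fun k =>
      Measurable.tsum fun j => (measurable_layerVal D _ j).mul (measurable_overlap D j)
    calc ∫⁻ x in E, sparseSum D a 0 x ∂(wm w)
        ≤ ∫⁻ x in E, ∑' k, thr H (k₀ + k) * ∑' j, layerVal D ((band H a (k₀ + k)).indicator 1) j x *
            overlap D j x ∂(wm w) := by
          refine setLIntegral_mono (Measurable.tsum fun k => (hmeas _).const_mul _) ?_
          intro x hx
          unfold sparseSum
          simp_rw [← ENNReal.tsum_mul_left]
          rw [ENNReal.tsum_comm]
          refine ENNReal.tsum_le_tsum fun j => ?_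
          rw [zero_add]
          have h1 : layerVal D a j x ≤
              ∑' k, thr H (k₀ + k) * layerVal D ((band H a (k₀ + k)).indicator 1) j x := by
            refine hD.layerVal_le_tsum_band fun p hp hxp => not_lt.1 fun hlt => hx.2 ?_
            exact Set.mem_biUnion (x := (j, p)) (show (j, p) ∈ S₀ from ⟨hp, hlt⟩) hxp
          simp_rw [← mul_assoc]
          rw [ENNReal.tsum_mul_right]
          gcongr
      _ = ∑' k, thr H (k₀ + k) * ∫⁻ x in E, ∑' j,
            layerVal D ((band H a (k₀ + k)).indicator 1) j x * overlap D j x ∂(wm w) := by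
          rw [lintegral_tsum fun k => ((hmeas _).const_mul _).aemeasurable]
          congr 1
          funext k
          rw [lintegral_const_mul _ (hmeas _)]
      _ ≤ _ := ENNReal.tsum_le_tsum fun k => mul_le_mul_right (hlev _) _
  have hsum1 : C₁ * ∑' k, thr H (k₀ + k) * 4 ^ (k₀ + k) ≤ 2⁻¹ := by
    have h1 : ∀ k, thr H k * 4 ^ k = ENNReal.ofReal H * 2⁻¹ ^ k := by
      intro k
      rw [thr, mul_assoc, ← mul_pow]
      congr 2
      rw [show (8 : ℝ≥0∞) = 2 * 4 by norm_num, ENNReal.mul_inv (by simp) (by simp), mul_assoc,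
        ENNReal.inv_mul_cancel (by norm_num) (by norm_num), mul_one]
    simp_rw [h1, pow_add]
    rw [ENNReal.tsum_mul_left, ENNReal.tsum_mul_left, ENNReal.tsum_geometric,
      ENNReal.one_sub_inv_two, inv_inv]
    calc _ = C₁ * ENNReal.ofReal H * 2 * 2⁻¹ ^ k₀ := by ring
      _ ≤ _ := hk₀
  have hsum2 : ∑' k, thr H (k₀ + k) * (tail (k₀ + k) * (4 * starC n ^ 2 * ENNReal.ofReal c *
        (8 ^ (k₀ + k + 1) * (4 * ((k₀ + k : ℕ) + 1)) * G))) ≤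
      8 * ENNReal.ofReal H * (4 * starC n ^ 2) * 4 * (CN * (2 * starC n) * CL) *
        ENNReal.ofReal (Phi c ^ 2) * G := by
    have h1 : ∀ k : ℕ, thr H k * (tail k * (4 * starC n ^ 2 * ENNReal.ofReal c *
        (8 ^ (k + 1) * (4 * ((k : ℝ≥0∞) + 1)) * G))) =
        8 * ENNReal.ofReal H * (4 * starC n ^ 2) * 4 * ENNReal.ofReal c * G *
          (((k : ℝ≥0∞) + 1) * tail k) := by
      intro k
      rw [← thr_mul H k]
      ring
    simp_rw [h1]
    rw [ENNReal.tsum_mul_left]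
    have h2 : ∑' k : ℕ, (((k₀ + k : ℕ) : ℝ≥0∞) + 1) * tail (k₀ + k) ≤
        CN * sparseRatio n c * (CL * ENNReal.ofReal ((1 + Real.log c) ^ 2)) := by
      have h3 := hN (sparseRatio n c).toReal (by
        rw [← ENNReal.toReal_one]
        exact ENNReal.toReal_mono sparseRatio_ne_top h.one_le_sparseRatio)
      rw [hR] at h3
      refine (ENNReal.tsum_comp_le_tsum_of_injective (add_right_injective k₀)
        fun k : ℕ => ((k : ℝ≥0∞) + 1) * tail k).trans (h3.trans ?_)
      gcongr
      exact hL c hc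
    refine (mul_le_mul_right h2 _).trans (le_of_eq ?_)
    rw [hPhi, mul_pow, ENNReal.ofReal_mul (by positivity),
      ENNReal.ofReal_pow (by linarith : 0 ≤ c), sparseRatio]
    ring
  have hEle : wm w E ≤ 2⁻¹ * wm w E + C₁ * (8 * ENNReal.ofReal H * (4 * starC n ^ 2) * 4 *
      (CN * (2 * starC n) * CL) * ENNReal.ofReal (Phi c ^ 2) * G) := by
    calc wm w E = ∫⁻ x in E, 1 ∂(wm w) := by simp
      _ ≤ ∫⁻ x in E, C₁ * sparseSum D a 0 x ∂(wm w) := by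
          refine setLIntegral_mono ((measurable_sparseSum D a 0).const_mul _) fun x hx => ?_
          exact le_of_lt hx.1.2
      _ = C₁ * ∫⁻ x in E, sparseSum D a 0 x ∂(wm w) :=
          lintegral_const_mul _ (measurable_sparseSum D a 0)
      _ ≤ C₁ * _ := mul_le_mul_right hint _
      _ = (C₁ * ∑' k, thr H (k₀ + k) * 4 ^ (k₀ + k)) * wm w E + C₁ * ∑' k, thr H (k₀ + k) *
          (tail (k₀ + k) * (4 * starC n ^ 2 * ENNReal.ofReal c *
            (8 ^ (k₀ + k + 1) * (4 * ((k₀ + k : ℕ) + 1)) * G))) := by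
          simp_rw [mul_add (thr H _)]
          rw [ENNReal.tsum_add, mul_add, mul_assoc C₁, ← ENNReal.tsum_mul_right]
          simp_rw [mul_assoc]
      _ ≤ _ := add_le_add (mul_le_mul_left hsum1 _) (mul_le_mul_right hsum2 _)
  have hE2 : wm w E ≤ X₂ * ENNReal.ofReal (Phi c ^ 2) * G := by
    have h6 : 2⁻¹ * wm w E ≠ ∞ := ENNReal.mul_ne_top (by simp) hEfin
    have h5 : wm w E = 2⁻¹ * wm w E + 2⁻¹ * wm w E := by
      rw [← add_mul, ENNReal.inv_two_add_inv_two, one_mul]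
    have h7 := (ENNReal.add_le_add_iff_left h6).1 (h5.symm.le.trans hEle)
    calc wm w E = 2 * (2⁻¹ * wm w E) := by
          rw [← mul_assoc, ENNReal.mul_inv_cancel (by norm_num) (by norm_num), one_mul]
      _ ≤ 2 * _ := mul_le_mul_right h7 _
      _ = _ := by rw [hX₂]; ring
  calc wm w (layer D 0 ∩ {x | 1 < C₁ * sparseSum D a 0 x}) ≤ wm w (Rem ∪ E) :=
        measure_mono fun x hx => by
          by_cases hxR : x ∈ Rem
          · exact Or.inl hxR
          · exact Or.inr ⟨hx, hxR⟩
    _ ≤ wm w Rem + wm w E := measure_union_le _ _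
    _ ≤ _ := add_le_add hRemle hE2
    _ = _ := by ring

end Tree

end CZ

end

noncomputable section

namespace CZ

variable {n : ℕ} {𝕜 : Type*} [RCLike 𝕜]

/-! ### `A₁` weights -/

section A1

variable {w : Rn n → ℝ} {c : ℝ}

/-- The constant `[w]_{A₁}` is attained. -/
lemma MemA1.a1Bound (hw : MemA1 w) : A1Bound w (A1Const w) := by
  set S := {c : ℝ | 0 ≤ c ∧ A1Bound w c} with hS
  have hne : S.Nonempty := hw.exists_bound
  have h1 : ∀ m : ℕ, A1Bound w (A1Const w + 1 / ((m : ℝ) + 1)) := by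
    intro m
    obtain ⟨c, hc, hlt⟩ := exists_lt_of_csInf_lt hne
      (show sInf S < A1Const w + 1 / ((m : ℝ) + 1) by
        have : (0 : ℝ) < 1 / ((m : ℝ) + 1) := by positivity
        change sInf S < sInf S + _
        linarith)
    filter_upwards [hc.2] with x hx
    exact hx.trans (by gcongr)
  filter_upwards [ae_all_iff.2 h1] with x hx
  have h2 : Filter.Tendsto (fun m : ℕ => ENNReal.ofReal (A1Const w + 1 / ((m : ℝ) + 1)) *
      ENNReal.ofReal (w x)) Filter.atTop
        (nhds (ENNReal.ofReal (A1Const w + 0) * ENNReal.ofReal (w x))) :=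
    ENNReal.Tendsto.mul_const (ENNReal.tendsto_ofReal
      (tendsto_const_nhds.add tendsto_one_div_add_atTop_nhds_zero_nat)) (Or.inr (by finiteness))
  rw [add_zero] at h2
  exact ge_of_tendsto' h2 hx

lemma A1Bound.avg_le (hw : IsWeight w) (h : A1Bound w c) (p : DIdx n) :
    ∀ᵐ x ∂volume, x ∈ star p →
      avg p (fun x => ENNReal.ofReal (w x)) ≤ ENNReal.ofReal c * ENNReal.ofReal (w x) := by
  have hae := dil_ae_eq_cube (2 * n + 1) p
  set l := side p * (2 * ((2 * n + 1 : ℕ) : ℝ) + 1) with hl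
  have hl0 : 0 < l := mul_pos (side_pos p) (by positivity)
  have h1 : avg p (fun x => ENNReal.ofReal (w x)) =
      (volume (cube (corner (2 * n + 1) p) l))⁻¹ *
        ∫⁻ y in cube (corner (2 * n + 1) p) l, ‖w y‖ₑ := by
    unfold avg star
    rw [setLIntegral_congr hae, measure_congr hae]
    congr 1
    refine lintegral_congr_ae (ae_restrict_of_ae ?_)
    filter_upwards [hw.nonneg] with x hx
    rw [Real.enorm_eq_ofReal hx]
  filter_upwards [h, hae.mem_iff] with x hx hxc hxp
  rw [h1]
  refine le_trans ?_ hx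
  unfold maximalFunction
  exact le_iSup₂_of_le (corner (2 * n + 1) p) l (le_iSup₂_of_le hl0 (hxc.1 hxp) le_rfl)

/-- A nontrivial `A₁` weight has a measurable version, and its constant is at least one. -/
lemma MemA1.exists_starA1 (hw : MemA1 w) (h0 : ¬ w =ᵐ[volume] 0) :
    ∃ w' : Rn n → ℝ, w =ᵐ[volume] w' ∧ StarA1 w' (A1Const w) := by
  have hm := hw.isWeight.locallyIntegrable.aestronglyMeasurable
  obtain ⟨w', hw'⟩ : ∃ w' : Rn n → ℝ, w' = fun x => max (hm.mk w x) 0 := ⟨_, rfl⟩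
  have hmeas : Measurable w' := by
    rw [hw']; exact hm.stronglyMeasurable_mk.measurable.max measurable_const
  have hae : w =ᵐ[volume] w' := by
    filter_upwards [hm.ae_eq_mk, hw.isWeight.nonneg] with x hx hx0
    rw [hw']
    simp only
    rw [← hx, max_eq_left hx0]
  have hnn : ∀ x, 0 ≤ w' x := fun x => by rw [hw']; exact le_max_right _ _
  have hli : LocallyIntegrable w' volume := hw.isWeight.locallyIntegrable.congr hae
  have hle : ∀ p : DIdx n, ∀ᵐ x ∂volume, x ∈ star p →
      avg p (fun x => ENNReal.ofReal (w' x)) ≤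
        ENNReal.ofReal (A1Const w) * ENNReal.ofReal (w' x) := by
    intro p
    have h1 : avg p (fun x => ENNReal.ofReal (w' x)) = avg p (fun x => ENNReal.ofReal (w x)) := by
      unfold avg
      congr 1
      refine lintegral_congr_ae (ae_restrict_of_ae ?_)
      filter_upwards [hae] with x hx
      rw [hx]
    rw [h1]
    filter_upwards [hw.a1Bound.avg_le hw.isWeight p, hae] with x hx hx2 hxp
    rw [← hx2]
    exact hx hxp
  refine ⟨w', hae, hmeas, hnn, hli, ?_, hle⟩
  by_contra hc
  rw [not_le] at hc
  refine h0 (hae.trans ?_)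
  have hz : ∀ p : DIdx n, ∫⁻ x in star p, ENNReal.ofReal (w' x) = 0 := by
    intro p
    set I := ∫⁻ x in star p, ENNReal.ofReal (w' x) with hI
    have hIt : I ≠ ∞ := ((hli.integrableOn_isCompact
      (isBounded_star p).isCompact_closure).mono_set subset_closure).lintegral_lt_top.ne
    have h1 : I ≤ ENNReal.ofReal (A1Const w) * I := by
      calc I = ∫⁻ x in star p, avg p (fun x => ENNReal.ofReal (w' x)) := by
            rw [setLIntegral_const, mul_comm, volume_mul_avg]
        _ ≤ ∫⁻ x in star p, ENNReal.ofReal (A1Const w) * ENNReal.ofReal (w' x) :=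
            setLIntegral_mono_ae' (measurableSet_star p) (hle p)
        _ = _ := lintegral_const_mul _ hmeas.ennreal_ofReal
    by_contra hI0
    have h2 : ENNReal.ofReal (A1Const w) * I < 1 * I :=
      ENNReal.mul_lt_mul_left hI0 hIt (by rw [← ENNReal.ofReal_one]; exact
        (ENNReal.ofReal_lt_ofReal_iff one_pos).2 hc)
    rw [one_mul] at h2
    exact absurd h1 (not_le.2 h2)
  have hz' : ∀ᵐ x ∂(volume : Measure (Rn n)), ∀ p : DIdx n, x ∈ star p → w' x = 0 := by
    refine ae_all_iff.2 fun p => ?_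
    have h1 := (lintegral_eq_zero_iff hmeas.ennreal_ofReal).1 (hz p)
    have h2 := (ae_restrict_iff' (measurableSet_star p)).1 h1
    filter_upwards [h2] with x hx hxp
    exact le_antisymm (ENNReal.ofReal_eq_zero.1 (hx hxp)) (hnn x)
  filter_upwards [hz'] with x hx
  exact hx (cb 0 x) (dq_subset_star _ (mem_dq_cb 0 x))

lemma wm_congr {w' : Rn n → ℝ} (h : w =ᵐ[volume] w') : wm w = wm w' := by
  refine withDensity_congr_ae ?_
  filter_upwards [h] with x hx
  rw [hx]

end A1

/-! ### The weighted weak type estimate for the commutator -/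

section Final

variable {T : Lp 𝕜 2 (volume : Measure (Rn n)) →L[𝕜] Lp 𝕜 2 (volume : Measure (Rn n))}
  {K : Rn n → Rn n → 𝕜}

lemma sparseSum_const_mul (D : ℕ → Set (DIdx n)) (t : ℝ≥0∞) (a : DIdx n → ℝ≥0∞) (j : ℕ)
    (x : Rn n) : sparseSum D (fun p => t * a p) j x = t * sparseSum D a j x := by
  have h1 : ∀ j, layerVal D (fun p => t * a p) j x = t * layerVal D a j x := by
    intro j
    unfold layerVal
    rw [← ENNReal.tsum_mul_left]
    congr 1
    funext p
    by_cases hx : x ∈ dq (p : DIdx n) <;> simp [hx]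
  unfold sparseSum
  simp_rw [h1, mul_assoc]
  rw [ENNReal.tsum_mul_left]

lemma Represents.exists_locComm_weak_type (hn : 1 ≤ n) (hr : Represents K T)
    (hK : IsStandardKernel K) {B : ℝ} (hB : 0 < B) :
    ∃ C : ℝ≥0∞, C ≠ ∞ ∧ ∀ (b f : Rn n → 𝕜), BMOBound b B → MemLp f 2 volume →
      MemLp (fun x => b x * f x) 2 volume → ∀ (w : Rn n → ℝ) (c : ℝ), StarA1 w c →
      ∀ lam : ℝ, 0 < lam → ∀ p : DIdx n,
        wm w (dq p ∩ {x | lam < ‖locComm T b f p x‖}) ≤ C * ENNReal.ofReal (Phi c ^ 2) *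
          ∫⁻ x, ENNReal.ofReal (Phi (‖f x‖ / lam)) * ENNReal.ofReal (w x) := by
  obtain ⟨C₁, hC₁, hdom⟩ := hr.exists_sparse_domination hn hK B
  obtain ⟨H, hH, hcoef⟩ := BMOBound.exists_coef_le (𝕜 := 𝕜) n hB
  obtain ⟨C, hC, hsp⟩ := exists_wm_sparseSum_gt_le hn hC₁ H
  refine ⟨C, hC, fun b f hb hf hbf w c hw lam hlam p => ?_⟩
  obtain ⟨D, hD0, hD, hle⟩ := hdom b f hb hf hbf p
  have hl0 : layer D 0 = dq p := by simp [layer, hD0]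
  have h1 := hsp D hD w c hw (by rw [hl0]; exact hw.wm_dq_ne_top p) (fun x => ‖f x‖ / lam)
    (fun p => ENNReal.ofReal lam⁻¹ * coef b f p)
    (hf.aestronglyMeasurable.norm.aemeasurable.div_const lam) (fun x => by positivity) (by
      intro s hs q hq
      have h2 := hcoef b hb f (s * lam⁻¹) (by positivity) q (by
        refine le_of_eq_of_le ?_ hq
        congr 1
        funext x
        congr 2
        ring)
      rwa [ENNReal.ofReal_mul hs.le, mul_assoc] at h2)
  refine le_trans (measure_mono_ae ?_) h1
  have hac : wm w ≪ volume := withDensity_absolutelyContinuous _ _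
  filter_upwards [hac.ae_le hle] with x hx hxm
  refine ⟨by rw [hl0]; exact hxm.1, ?_⟩
  show 1 < C₁ * sparseSum D _ 0 x
  rw [sparseSum_const_mul]
  have h2 : ENNReal.ofReal lam < C₁ * sparseSum D (coef b f) 0 x := by
    refine lt_of_lt_of_le ?_ (hx hxm.1)
    rw [← ofReal_norm]
    exact (ENNReal.ofReal_lt_ofReal_iff (hlam.trans hxm.2)).2 hxm.2
  calc (1 : ℝ≥0∞) = ENNReal.ofReal lam * ENNReal.ofReal lam⁻¹ := by
        rw [← ENNReal.ofReal_mul hlam.le, mul_inv_cancel₀ hlam.ne', ENNReal.ofReal_one]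
    _ < C₁ * sparseSum D (coef b f) 0 x * ENNReal.ofReal lam⁻¹ :=
        ENNReal.mul_lt_mul_left (by simpa using hlam) (by finiteness) h2
    _ = _ := by ring

/-- A ball is covered by boundedly many dyadic cubes whose dilates contain the ball. -/
lemma exists_finset_ball_subset (hn : 1 ≤ n) (R : ℝ) : ∃ Q : Finset (DIdx n),
    Q.card ≤ 3 ^ n ∧ Metric.ball 0 R ⊆ ⋃ q ∈ Q, dq q ∧ ∀ q ∈ Q, Metric.ball 0 R ⊆ star q := by
  obtain ⟨N, hN⟩ := pow_unbounded_of_one_lt R (by norm_num : (1 : ℝ) < 2)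
  set p : DIdx n := (-N, 0) with hp
  have hside : side p = 2 ^ N := by simp [side, hp]
  have hball : Metric.ball 0 R ⊆ dil 1 p := by
    intro x hx
    rw [mem_dil_iff]
    intro i
    have h1 := abs_lt.1 (((abs_apply_le_norm x i).trans_lt (mem_ball_zero_iff.1 hx)).trans hN)
    have h2 : (0 : ℝ) < 2 ^ N := by positivity
    rw [hside]
    simp only [hp, Pi.zero_apply, Int.cast_zero, Nat.cast_one]
    constructor <;> linarith
  refine ⟨nbr 1 p, ?_, by rw [← dil_eq_biUnion]; exact hball, fun q hq => hball.trans ?_⟩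
  · refine Finset.card_image_le.trans ?_
    rw [Pi.card_Icc]
    simp [hp]
  · obtain ⟨h1, h2⟩ := mem_nbr.1 hq
    intro x hx i
    have h3 := hx i
    have h4 := h2 i
    rw [h1]
    push_cast at *
    constructor <;> linarith

lemma memLp_two_of_hasCompactSupport {f : Rn n → 𝕜} (hf : MemLp f ∞ volume)
    (hc : HasCompactSupport f) : MemLp f 2 volume :=
  hf.mono_exponent_of_measure_support_ne_top (s := tsupport f)
    (fun _ hx => image_eq_zero_of_notMem_tsupport hx) hc.measure_lt_top.ne le_top

lemma Represents.exists_commutator_weak_type (hn : 1 ≤ n) (hr : Represents K T)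
    (hK : IsStandardKernel K) {B : ℝ} (hB : 0 < B) :
    ∃ C : ℝ≥0∞, C ≠ ∞ ∧ ∀ (b f : Rn n → 𝕜), BMOBound b B → HasCompactSupport f →
      ∀ (hf : MemLp f 2 volume) (hbf : MemLp (fun x => b x * f x) 2 volume)
      (w : Rn n → ℝ) (c : ℝ), StarA1 w c → ∀ lam : ℝ, 0 < lam →
        wm w {x | lam < ‖commutator b T f hf hbf x‖} ≤ C * ENNReal.ofReal (Phi c ^ 2) *
          ∫⁻ x, ENNReal.ofReal (Phi (‖f x‖ / lam)) * ENNReal.ofReal (w x) := by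
  obtain ⟨C, hC, h⟩ := hr.exists_locComm_weak_type hn hK hB
  refine ⟨3 ^ n * C, by finiteness, fun b f hb hc hf hbf w c hw lam hlam => ?_⟩
  obtain ⟨G, hG⟩ : ∃ G, G = ∫⁻ x, ENNReal.ofReal (Phi (‖f x‖ / lam)) * ENNReal.ofReal (w x) :=
    ⟨_, rfl⟩
  have h := fun p => h b f hb hf hbf w c hw lam hlam p
  rw [← hG] at h ⊢
  set A := {x | lam < ‖commutator b T f hf hbf x‖} with hA
  obtain ⟨R₀, hR₀⟩ := hc.isCompact.isBounded.subset_ball (0 : Rn n)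
  have hloc : ∀ R, R₀ ≤ R → wm w (A ∩ Metric.ball 0 R) ≤
      3 ^ n * C * ENNReal.ofReal (Phi c ^ 2) * G := by
    intro R hR
    obtain ⟨Q, hQ1, hQ2, hQ3⟩ := exists_finset_ball_subset hn R
    have hcomm : ∀ q ∈ Q, ∀ x, commutator b T f hf hbf x = locComm T b f q x := by
      intro q hq x
      have hz : ∀ y, y ∉ star q → f y = 0 := fun y hy =>
        image_eq_zero_of_notMem_tsupport fun hy' =>
          hy (hQ3 q hq (Metric.ball_subset_ball hR (hR₀ hy')))
      have h1 : (star q).indicator f = f :=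
        Set.indicator_eq_self.2 fun y hy => by_contra fun hy' => hy (hz y hy')
      have h2 : ((star q).indicator fun x => b x * f x) = fun x => b x * f x :=
        Set.indicator_eq_self.2 fun y hy => by_contra fun hy' => hy (by simp [hz y hy'])
      unfold commutator locComm
      rw [h1, h2, Top_eq hf, Top_eq hbf]
    calc wm w (A ∩ Metric.ball 0 R)
        ≤ wm w (⋃ q ∈ Q, dq q ∩ {x | lam < ‖locComm T b f q x‖}) := by
          refine measure_mono ?_
          rintro x ⟨hxA, hxR⟩
          obtain ⟨q, hq, hxq⟩ := Set.mem_iUnion₂.1 (hQ2 hxR)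
          refine Set.mem_biUnion (show q ∈ (Q : Set (DIdx n)) from hq) ⟨hxq, ?_⟩
          show lam < ‖locComm T b f q x‖
          rw [← hcomm q hq x]
          exact hxA
      _ ≤ ∑ q ∈ Q, wm w (dq q ∩ {x | lam < ‖locComm T b f q x‖}) :=
          measure_biUnion_finset_le _ _
      _ ≤ ∑ q ∈ Q, C * ENNReal.ofReal (Phi c ^ 2) * G := Finset.sum_le_sum fun q _ => h q
      _ = Q.card * (C * ENNReal.ofReal (Phi c ^ 2) * G) := by simp
      _ ≤ (3 ^ n : ℕ) * (C * ENNReal.ofReal (Phi c ^ 2) * G) := by gcongr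
      _ = _ := by push_cast; ring
  have hmono : Monotone fun m : ℕ => A ∩ Metric.ball (0 : Rn n) (R₀ + m) := fun m k hmk =>
    Set.inter_subset_inter_right _ (Metric.ball_subset_ball (by gcongr))
  have hun : A = ⋃ m : ℕ, A ∩ Metric.ball (0 : Rn n) (R₀ + m) := by
    rw [← Set.inter_iUnion, eq_comm, Set.inter_eq_left]
    intro x _
    obtain ⟨m, hm⟩ := exists_nat_gt (‖x‖ - R₀)
    exact Set.mem_iUnion.2 ⟨m, by rw [mem_ball_zero_iff]; linarith⟩
  rw [hun, hmono.measure_iUnion]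
  exact iSup_le fun m => hloc _ (by simp)

end Final

end CZ

end

theorem theorem1p4 {𝕜 : Type*} [RCLike 𝕜] {n : ℕ} (hn : 1 ≤ n)
    (T : Lp 𝕜 2 (volume : Measure (CZ.Rn n)) →L[𝕜] Lp 𝕜 2 (volume : Measure (CZ.Rn n)))
    (hT : CZ.IsCalderonZygmund T) :
    ∃ c : ℝ → ℝ, ∀ b : CZ.Rn n → 𝕜, CZ.MemBMO b → ∀ w : CZ.Rn n → ℝ, CZ.MemA1 w →
      ∀ f : CZ.Rn n → 𝕜, MemLp f ∞ volume → HasCompactSupport f →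
        ∃ (hf : MemLp f 2 volume) (hbf : MemLp (fun x => b x * f x) 2 volume),
          ∀ lam : ℝ, 0 < lam →
            ∫⁻ x in {x | lam < ‖CZ.commutator b T f hf hbf x‖}, ENNReal.ofReal (w x) ≤
              ENNReal.ofReal (c (CZ.bmoNorm b).toReal * CZ.Phi (CZ.A1Const w) ^ 2) *
                ∫⁻ x, ENNReal.ofReal (CZ.Phi (‖f x‖ / lam) * w x) := by
  obtain ⟨K, hK, hr⟩ := hT
  have hex := fun B : {B : ℝ // 0 < B} =>
    CZ.Represents.exists_commutator_weak_type hn (T := T) hr hK B.2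
  choose C hC h using hex
  have hpos : ∀ r : ℝ, 0 < max r 0 + 1 := fun r => by
    have := le_max_right r 0; linarith
  refine ⟨fun r => (C ⟨max r 0 + 1, hpos r⟩).toReal, fun b hb w hw f hft hfc => ?_⟩
  have hf := CZ.memLp_two_of_hasCompactSupport hft hfc
  obtain ⟨B, hBr⟩ : ∃ B : {B : ℝ // 0 < B}, B = ⟨max (CZ.bmoNorm b).toReal 0 + 1, hpos _⟩ :=
    ⟨_, rfl⟩
  have hbB : CZ.BMOBound b (B : ℝ) := by
    rw [hBr]
    simp only [max_eq_left ENNReal.toReal_nonneg]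
    exact hb.bmoBound
  have hbf : MemLp (fun x => b x * f x) 2 volume := by
    obtain ⟨R, hR⟩ := hfc.isCompact.isBounded.subset_ball (0 : CZ.Rn n)
    obtain ⟨Q, -, hQ, hQs⟩ := CZ.exists_finset_ball_subset hn (max R 1)
    obtain ⟨q, hq, -⟩ := Set.mem_iUnion₂.1 (hQ (Metric.mem_ball_self (by positivity)))
    refine hbB.memLp_mul hft hf (p := q) fun x hx => image_eq_zero_of_notMem_tsupport fun hx' => ?_
    exact hx (hQs q hq (Metric.ball_subset_ball (le_max_left _ _) (hR hx')))
  refine ⟨hf, hbf, fun lam hlam => ?_⟩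
  beta_reduce
  rw [← hBr, ← withDensity_apply' (fun x => ENNReal.ofReal (w x))]
  change CZ.wm w _ ≤ _
  by_cases h0 : w =ᵐ[volume] 0
  · rw [CZ.wm_congr h0]
    simp [CZ.wm]
  obtain ⟨w', hae, hw'⟩ := hw.exists_starA1 h0
  rw [CZ.wm_congr hae, ENNReal.ofReal_mul ENNReal.toReal_nonneg, ENNReal.ofReal_toReal (hC B)]
  refine (h B b f hbB hfc hf hbf w' _ hw' lam hlam).trans (le_of_eq ?_)
  congr 1
  refine lintegral_congr_ae ?_
  filter_upwards [hae] with x hx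
  rw [hx, ENNReal.ofReal_mul (CZ.Phi_nonneg (by positivity))]
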